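/- **Setting.** Let $\Omega_f,\Omega_p\subset\mathbb R^2$ be disjoint bounded open sets with Lipschitz boundary, $\Gamma=\partial\Omega_f\cap\partial\Omega_p$, $\mathbf n$ the outward unit normal of $\Omega_f$ and $\boldsymbol\tau$ the unit tangent on $\Gamma$. Let $\nu,g,S_0,K,T>0$, $\alpha\ge 0$, and let the conductivity tensor be $\mathbb K=K\mathbb I$, so that $\operatorname{tr}\mathbb K=2K$. Put $$H_f=\{\mathbf v\in H^1(\Omega_f)^2:\mathbf v|_{\partial\Omega_f\setminus\Gamma}=0\},\quad H_p=\{\psi\in H^1(\Omega_p):\psi|_{\partial\Omega_p\setminus\Gamma}=0\},\quad Q_f=L^2(\Omega_f),$$ $$a(\mathbf u,\mathbf v,\mathbf w)=((\mathbf u\cdot\nabla)\mathbf v,\mathbf w)_f-\tfrac12\int_\Gamma(\mathbf u\cdot\mathbf v)(\mathbf w\cdot\mathbf n)\,ds,\qquad c_\Gamma(\mathbf v,\phi)=g\int_\Gamma\phi\,\mathbf v\cdot\mathbf n\,ds,\qquad \beta=\alpha\sqrt{\tfrac{\nu g}{\operatorname{tr}\mathbb K}},$$ $$\mathcal E(\mathbf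 u,\phi)=\tfrac12\|\mathbf u\|_f^2+\tfrac{gS_0}2\|\phi\|_p^2,\qquad \mathcal I(\mathbf u,\phi)=\nu\|\nabla\mathbf u\|_f^2+\beta\int_\Gamma(\mathbf u\cdot\boldsymbol\tau)^2ds+gK\|\nabla\phi\|_p^2,$$ where $(\cdot,\cdot)_X$, $\|\cdot\|_X$ are the inner product and norm of $L^2(\Omega_X)$, and $H^{-1}$ denotes the dual of the corresponding test space ($H_f$ or $H_p$). **Exact solution.** Let $(\mathbf u,p,\phi)$ with $\mathbf u(t)\in H_f$, $p(t)\in Q_f$, $\phi(t)\in H_p$ be a weak solution of the Navier–Stokes–Darcy model: for all $t\in(0,T]$, $\mathbf v\in H_f$, $\psi\in H_p$, $q\in Q_f$, $$(\partial_t\mathbf u,\mathbf v)_f+gS_0(\partial_t\phi,\psi)_p+\nu(\nabla\mathbf u,\nabla\mathbf v)_f-(p,\nabla\cdot\mathbf v)_f+a(\mathbf u,\mathbf u,\mathbf v)+\beta\int_\Gamma(\mathbf u\cdot\boldsymbol\tau)(\mathbf v\cdot\boldsymbol\tau)ds$$ $$+gK(\nabla\phi,\nabla\psi)_p+c_\Gamma(\mathbf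 v,\phi)-c_\Gamma(\mathbf u,\psi)=(\mathbf f_f,\mathbf v)_f+g(f_p,\psi)_p,\qquad(\nabla\cdot\mathbf u,q)_f=0,$$ where $(\mathbf f_f,\cdot)_f$, $(f_p,\cdot)_p$ are the duality pairings. Assume $\mathbf u\in L^\infty(0,T;H^2)$, $\partial_t\mathbf u\in L^2(0,T;H^2)$, $\partial_{tt}\mathbf u\in L^2(0,T;H^{-1})$, $p\in L^2(0,T;H^1)$, $\phi\in L^\infty(0,T;H^2)$, $\partial_t\phi\in L^2(0,T;H^2)$, $\partial_{tt}\phi\in L^2(0,T;H^{-1})$, $\mathbf f_f,f_p\in L^2(0,T;H^{-1})$. Assume further that the forces do no net work on the solution, $(\mathbf f_f(t),\mathbf u(t))_f+g(f_p(t),\phi(t))_p=0$ for $t\in(0,T]$ (for instance $\mathbf f_f=0$, $f_p=0$), and that the energy $E(t)=\mathcal E(\mathbf u(t),\phi(t))$ is positive for every $t\in[0,T]$. **Scheme I.** Let $t^n=n\Delta t$. Start from $\tilde{\mathbf u}^0=\mathbf u^0=\mathbf u(0)$, $\tilde\phi^0=\phi^0=\phi(0)$, $E^0=E(0)$. For each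 $n\ge 0$ with $t^{n+1}\le T$, let $(\tilde{\mathbf u}^{n+1},p^{n+1},\tilde\phi^{n+1})\in H_f\times Q_f\times H_p$ satisfy, for all $(\mathbf v,q,\psi)\in H_f\times Q_f\times H_p$, $$\Big(\tfrac{\tilde{\mathbf u}^{n+1}-\tilde{\mathbf u}^n}{\Delta t},\mathbf v\Big)_f+\nu(\nabla\tilde{\mathbf u}^{n+1},\nabla\mathbf v)_f+\beta\int_\Gamma(\tilde{\mathbf u}^{n+1}\cdot\boldsymbol\tau)(\mathbf v\cdot\boldsymbol\tau)ds-(p^{n+1},\nabla\cdot\mathbf v)_f+a(\mathbf u^n,\mathbf u^n,\mathbf v)+c_\Gamma(\mathbf v,\phi^n)=(\mathbf f_f(t^{n+1}),\mathbf v)_f,$$ $$(\nabla\cdot\tilde{\mathbf u}^{n+1},q)_f=0,\qquad gS_0\Big(\tfrac{\tilde\phi^{n+1}-\tilde\phi^n}{\Delta t},\psi\Big)_p+gK(\nabla\tilde\phi^{n+1},\nabla\psi)_p-c_\Gamma(\mathbf u^n,\psi)=g(f_p(t^{n+1}),\psi)_p,$$ and let $\xi^{n+1},E^{n+1}\in\mathbb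 R$ and $\mathbf u^{n+1},\phi^{n+1}$ satisfy $$E^{n+1}=\xi^{n+1}\mathcal E(\tilde{\mathbf u}^{n+1},\tilde\phi^{n+1}),\quad \frac{E^{n+1}-E^n}{\Delta t}=-\xi^{n+1}\mathcal I(\tilde{\mathbf u}^{n+1},\tilde\phi^{n+1}),\quad \mathbf u^{n+1}=\sqrt{\xi^{n+1}}\,\tilde{\mathbf u}^{n+1},\quad \phi^{n+1}=\sqrt{\xi^{n+1}}\,\tilde\phi^{n+1}.$$ **Theorem.** There are constants $C>0$ and $\delta>0$, independent of $\Delta t$, such that for every $0<\Delta t\le\delta$, every sequence produced by Scheme I with step $\Delta t$, and every integer $k\ge 0$ with $(k+1)\Delta t\le T$, $$|E^{k+1}-E(t^{k+1})|+\|\tilde{\mathbf u}^{k+1}-\mathbf u(t^{k+1})\|_f+\|\tilde\phi^{k+1}-\phi(t^{k+1})\|_p\le C\Delta t,$$ $$\|\mathbf u^{k+1}-\mathbf u(t^{k+1})\|_f+\|\phi^{k+1}-\phi(t^{k+1})\|_p\le C\Delta t.$$ -/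

import Mathlib

open MeasureTheory Set Filter Topology
open scoped ENNReal ContDiff

noncomputable section

namespace NSD

/-! ### Geometry of the plane -/

/-- The Euclidean plane. -/
abbrev Plane : Type := EuclideanSpace ℝ (Fin 2)

/-- The `i`-th coordinate vector. -/
def basisVec (i : Fin 2) : Plane := EuclideanSpace.single i 1

/-- `Ω` is a bounded open set whose boundary is locally, in suitable orthonormal coordinates,
the graph of a Lipschitz function, with `Ω` on exactly one side of the graph. -/
structure IsBoundedLipschitz (Ω : Set Plane) : Prop where
  isOpen : IsOpen Ω
  isBounded : Bornology.IsBounded Ω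
  local_graph : ∀ x ∈ frontier Ω, ∃ r > (0 : ℝ), ∃ e : Plane ≃ₗᵢ[ℝ] Plane,
    ∃ L : NNReal, ∃ h : ℝ → ℝ, LipschitzWith L h ∧
      ∀ y ∈ Metric.ball x r, (y ∈ Ω ↔ h (e y 0) < e y 1)

/-- `ν` is the outward unit normal of `Ω` at the boundary point `x`: near `x`, any cone around `ν`
with opening less than a half plane is outside `Ω` and the opposite cone is inside. -/
def IsOutwardUnitNormal (Ω : Set Plane) (x ν : Plane) : Prop :=
  ‖ν‖ = 1 ∧ ∀ ε > (0 : ℝ), ∃ r > (0 : ℝ), ∀ y ∈ Metric.ball x r,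
    (ε * ‖y - x‖ < inner ℝ (y - x) ν → y ∉ Ω) ∧
    (inner ℝ (y - x) ν < -(ε * ‖y - x‖) → y ∈ Ω)

/-- There is at most one outward unit normal at a point. -/
theorem IsOutwardUnitNormal.unique {Ω : Set Plane} {x ν ν' : Plane}
    (h : IsOutwardUnitNormal Ω x ν) (h' : IsOutwardUnitNormal Ω x ν') : ν = ν' := by
  by_contra hne
  have hd : 0 < ‖ν - ν'‖ := norm_pos_iff.2 (sub_ne_zero.2 hne)
  have h1 : inner ℝ (ν - ν') ν = ‖ν - ν'‖ ^ 2 / 2 := by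
    rw [norm_sub_sq_real, h.1, h'.1, inner_sub_left, real_inner_self_eq_norm_sq, h.1,
      real_inner_comm ν]
    ring
  have h2 : inner ℝ (ν - ν') ν' = -(‖ν - ν'‖ ^ 2 / 2) := by
    rw [norm_sub_sq_real, h.1, h'.1, inner_sub_left, real_inner_self_eq_norm_sq, h'.1]
    ring
  set d := ‖ν - ν'‖ with hddef
  obtain ⟨r, hr, H⟩ := h.2 (d / 4) (by positivity)
  obtain ⟨r', hr', H'⟩ := h'.2 (d / 4) (by positivity)
  have hm : 0 < min r r' := lt_min hr hr'
  set s := min r r' / (2 * d) with hs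
  have hs0 : 0 < s := by positivity
  have hsd : s * d = min r r' / 2 := by rw [hs]; field_simp
  have hdist : dist (x + s • (ν - ν')) x < min r r' := by
    rw [dist_eq_norm, add_sub_cancel_left, norm_smul, Real.norm_of_nonneg hs0.le, ← hddef, hsd]
    linarith
  have hlt : d / 4 * (s * d) < s * (d ^ 2 / 2) := by nlinarith [mul_pos hs0 (pow_pos hd 2)]
  refine (H _ (Metric.mem_ball.2 (hdist.trans_le (min_le_left _ _)))).1 ?_
    ((H' _ (Metric.mem_ball.2 (hdist.trans_le (min_le_right _ _)))).2 ?_)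
  · rw [add_sub_cancel_left, norm_smul, Real.norm_of_nonneg hs0.le, inner_smul_left, h1, ← hddef]
    simpa using hlt
  · rw [add_sub_cancel_left, norm_smul, Real.norm_of_nonneg hs0.le, inner_smul_left, h2, ← hddef]
    simp only [conj_trivial]
    linarith

open Classical in
/-- The outward unit normal field (with value `0` where there is no normal; on the boundary of a
Lipschitz set this happens only on a set of length zero). -/
def outwardNormal (Ω : Set Plane) (x : Plane) : Plane :=
  if h : ∃ ν, IsOutwardUnitNormal Ω x ν then h.choose else 0

/-- The unit tangent field, the normal rotated by a right angle. -/
def unitTangent (Ω : Set Plane) (x : Plane) : Plane :=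
  !₂[-(outwardNormal Ω x 1), outwardNormal Ω x 0]

/-- Arc length on the boundary of `Ω`. -/
def bdryMeasure (Ω : Set Plane) : Measure Plane :=
  (Measure.hausdorffMeasure 1 : Measure Plane).restrict (frontier Ω)

/-! ### Sobolev spaces -/

section Sobolev

/-- The Lebesgue space `L²(Ω; F)`. -/
abbrev L2 (Ω : Set Plane) (F : Type) [NormedAddCommGroup F] : Type :=
  Lp F 2 ((volume : Measure Plane).restrict Ω)

variable {F : Type} [NormedAddCommGroup F] [InnerProductSpace ℝ F]

/-- `w` is the weak partial derivative of `u` in the direction `i` on `Ω`. -/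
def IsWeakDeriv (Ω : Set Plane) (i : Fin 2) (u w : L2 Ω F) : Prop :=
  ∀ η : Plane → ℝ, ContDiff ℝ ∞ η → HasCompactSupport η → tsupport η ⊆ Ω →
    ∫ x in Ω, (fderiv ℝ η x (basisVec i)) • u x = -∫ x in Ω, η x • w x

theorem integrable_smul_L2 {Ω : Set Plane} {η : Plane → ℝ} (hη : Continuous η)
    (hc : HasCompactSupport η) (u : L2 Ω F) :
    Integrable (fun x => η x • u x) ((volume : Measure Plane).restrict Ω) := by
  have h1 : MemLp η 2 ((volume : Measure Plane).restrict Ω) :=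
    hη.memLp_of_hasCompactSupport hc
  exact memLp_one_iff_integrable.1 ((Lp.memLp u).smul h1)

theorem continuous_partial {η : Plane → ℝ} (hη : ContDiff ℝ ∞ η) (i : Fin 2) :
    Continuous fun x => fderiv ℝ η x (basisVec i) :=
  (hη.continuous_fderiv (by simp)).clm_apply continuous_const

theorem hasCompactSupport_partial {η : Plane → ℝ} (hc : HasCompactSupport η) (i : Fin 2) :
    HasCompactSupport fun x => fderiv ℝ η x (basisVec i) :=
  hc.fderiv_apply ℝ (basisVec i)

theorem IsWeakDeriv.add {Ω : Set Plane} {i : Fin 2} {u w u' w' : L2 Ω F}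
    (h : IsWeakDeriv Ω i u w) (h' : IsWeakDeriv Ω i u' w') :
    IsWeakDeriv Ω i (u + u') (w + w') := by
  intro η hη hc hs
  have e1 : ∫ x in Ω, (fderiv ℝ η x (basisVec i)) • (u + u') x
      = ∫ x in Ω, ((fderiv ℝ η x (basisVec i)) • u x + (fderiv ℝ η x (basisVec i)) • u' x) := by
    refine integral_congr_ae ?_
    filter_upwards [Lp.coeFn_add u u'] with x hx
    rw [hx, Pi.add_apply, smul_add]
  have e2 : ∫ x in Ω, η x • (w + w') x = ∫ x in Ω, (η x • w x + η x • w' x) := by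
    refine integral_congr_ae ?_
    filter_upwards [Lp.coeFn_add w w'] with x hx
    rw [hx, Pi.add_apply, smul_add]
  rw [e1, e2, integral_add (integrable_smul_L2 (continuous_partial hη i)
      (hasCompactSupport_partial hc i) u) (integrable_smul_L2 (continuous_partial hη i)
      (hasCompactSupport_partial hc i) u'),
    integral_add (integrable_smul_L2 hη.continuous hc w) (integrable_smul_L2 hη.continuous hc w'),
    h η hη hc hs, h' η hη hc hs, neg_add]

theorem IsWeakDeriv.smul {Ω : Set Plane} {i : Fin 2} {u w : L2 Ω F} (c : ℝ)
    (h : IsWeakDeriv Ω i u w) : IsWeakDeriv Ω i (c • u) (c • w) := by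
  intro η hη hc hs
  have e1 : ∫ x in Ω, (fderiv ℝ η x (basisVec i)) • (c • u) x
      = ∫ x in Ω, c • ((fderiv ℝ η x (basisVec i)) • u x) := by
    refine integral_congr_ae ?_
    filter_upwards [Lp.coeFn_smul c u] with x hx
    rw [hx, Pi.smul_apply, smul_comm]
  have e2 : ∫ x in Ω, η x • (c • w) x = ∫ x in Ω, c • (η x • w x) := by
    refine integral_congr_ae ?_
    filter_upwards [Lp.coeFn_smul c w] with x hx
    rw [hx, Pi.smul_apply, smul_comm]
  rw [e1, e2, integral_smul, integral_smul, h η hη hc hs, smul_neg]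

theorem IsWeakDeriv.zero (Ω : Set Plane) (i : Fin 2) : IsWeakDeriv Ω i (0 : L2 Ω F) 0 := by
  intro η hη hc hs
  have e1 : ∫ x in Ω, (fderiv ℝ η x (basisVec i)) • (0 : L2 Ω F) x = 0 := by
    refine integral_eq_zero_of_ae ?_
    filter_upwards [Lp.coeFn_zero F 2 ((volume : Measure Plane).restrict Ω)] with x hx
    rw [hx]; simp
  have e2 : ∫ x in Ω, η x • (0 : L2 Ω F) x = 0 := by
    refine integral_eq_zero_of_ae ?_
    filter_upwards [Lp.coeFn_zero F 2 ((volume : Measure Plane).restrict Ω)] with x hx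
    rw [hx]; simp
  rw [e1, e2, neg_zero]

variable (F) in
/-- The Sobolev space `H¹(Ω; F)` as a subspace: square integrable functions together with their
square integrable weak partial derivatives. -/
def H1Sub (Ω : Set Plane) : Submodule ℝ (L2 Ω F × (Fin 2 → L2 Ω F)) where
  carrier := {w | ∀ i, IsWeakDeriv Ω i w.1 (w.2 i)}
  add_mem' := fun h h' i => (h i).add (h' i)
  zero_mem' := fun i => IsWeakDeriv.zero Ω i
  smul_mem' := fun c _ h i => (h i).smul c

variable (F) in
/-- The Sobolev space `H¹(Ω; F)`. Its norm (the maximum of the `L²` norms of the function and of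
its partial derivatives) is equivalent to the usual one. -/
def H1 (Ω : Set Plane) : Type := H1Sub F Ω

instance (Ω : Set Plane) : NormedAddCommGroup (H1 F Ω) :=
  inferInstanceAs (NormedAddCommGroup (H1Sub F Ω))

instance (Ω : Set Plane) : NormedSpace ℝ (H1 F Ω) :=
  inferInstanceAs (NormedSpace ℝ (H1Sub F Ω))

/-- The underlying `L²` function. -/
def val {Ω : Set Plane} (w : H1 F Ω) : L2 Ω F := w.1.1

/-- The weak partial derivatives. -/
def grad {Ω : Set Plane} (w : H1 F Ω) (i : Fin 2) : L2 Ω F := w.1.2 i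

variable (F) in
/-- The Sobolev space `H²(Ω; F)`: functions in `H¹` together with their partial derivatives,
these being in `H¹` as well. -/
def H2 (Ω : Set Plane) : Submodule ℝ (H1 F Ω × (Fin 2 → H1 F Ω)) where
  carrier := {w | ∀ i, val (w.2 i) = grad w.1 i}
  add_mem' := fun {a b} h h' i => by
    have := congrArg₂ (· + ·) (h i) (h' i)
    exact this
  zero_mem' := fun _ => rfl
  smul_mem' := fun c a h i => by
    have := congrArg (c • ·) (h i)
    exact this

/-- An `H²` function as an `H¹` function. -/
def toH1 {Ω : Set Plane} (w : H2 F Ω) : H1 F Ω := w.1.1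

/-- `b` is the trace on the boundary of `w ∈ H¹(Ω; F)`: the pair `(w, b)` is the limit, in
`H¹(Ω) × L²(∂Ω)`, of pairs formed by a smooth function and its boundary values. -/
def IsTrace {Ω : Set Plane} (w : H1 F Ω) (b : Lp F 2 (bdryMeasure Ω)) : Prop :=
  ∀ ε : ℝ≥0∞, 0 < ε → ∃ ψ : Plane → F, ContDiff ℝ ∞ ψ ∧ HasCompactSupport ψ ∧
    eLpNorm (fun x => val w x - ψ x) 2 ((volume : Measure Plane).restrict Ω) < ε ∧
    (∀ i, eLpNorm (fun x => grad w i x - fderiv ℝ ψ x (basisVec i)) 2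
      ((volume : Measure Plane).restrict Ω) < ε) ∧
    eLpNorm (fun x => b x - ψ x) 2 (bdryMeasure Ω) < ε

open Classical in
/-- The trace operator `H¹(Ω; F) → L²(∂Ω; F)`. -/
def trace {Ω : Set Plane} (w : H1 F Ω) : Lp F 2 (bdryMeasure Ω) :=
  if h : ∃ b, IsTrace w b then h.choose else 0

theorem IsTrace.add {Ω : Set Plane} {w w' : H1 F Ω} {b b' : Lp F 2 (bdryMeasure Ω)}
    (h : IsTrace w b) (h' : IsTrace w' b') : IsTrace (w + w') (b + b') := by
  intro ε hε
  obtain ⟨ψ, h1, h2, h3, h4, h5⟩ := h (ε / 2) (ENNReal.half_pos hε.ne')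
  obtain ⟨ψ', h1', h2', h3', h4', h5'⟩ := h' (ε / 2) (ENNReal.half_pos hε.ne')
  have key : ∀ {μ : Measure Plane} (f f' : Lp F 2 μ) (q q' : Plane → F), Continuous q →
      Continuous q' → eLpNorm (fun x => f x - q x) 2 μ < ε / 2 →
      eLpNorm (fun x => f' x - q' x) 2 μ < ε / 2 →
      eLpNorm (fun x => (f + f') x - (q x + q' x)) 2 μ < ε := by
    intro μ f f' q q' hq hq' hf hf'
    have e : eLpNorm (fun x => (f + f') x - (q x + q' x)) 2 μ
        = eLpNorm ((fun x => f x - q x) + fun x => f' x - q' x) 2 μ := by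
      refine eLpNorm_congr_ae ?_
      filter_upwards [Lp.coeFn_add f f'] with x hx
      rw [hx, Pi.add_apply, Pi.add_apply]
      abel
    rw [e]
    calc _ ≤ _ := eLpNorm_add_le
          ((Lp.aestronglyMeasurable f).sub hq.aestronglyMeasurable)
          ((Lp.aestronglyMeasurable f').sub hq'.aestronglyMeasurable) (by norm_num)
      _ < ε / 2 + ε / 2 := ENNReal.add_lt_add hf hf'
      _ = ε := ENNReal.add_halves ε
  have hd : ∀ x v, fderiv ℝ (fun y => ψ y + ψ' y) x v = fderiv ℝ ψ x v + fderiv ℝ ψ' x v := by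
    intro x v
    rw [fderiv_fun_add ((h1.differentiable (by simp)) x) ((h1'.differentiable (by simp)) x)]
    rfl
  refine ⟨fun x => ψ x + ψ' x, h1.add h1', h2.add h2', ?_, fun i => ?_, ?_⟩
  · exact key (val w) (val w') ψ ψ' h1.continuous h1'.continuous h3 h3'
  · simp only [hd]
    exact key (grad w i) (grad w' i) _ _
      ((h1.continuous_fderiv (by simp)).clm_apply continuous_const)
      ((h1'.continuous_fderiv (by simp)).clm_apply continuous_const) (h4 i) (h4' i)
  · exact key b b' ψ ψ' h1.continuous h1'.continuous h5 h5'

theorem IsTrace.zero (Ω : Set Plane) : IsTrace (0 : H1 F Ω) 0 := by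
  intro ε hε
  have key : ∀ {μ : Measure Plane}, eLpNorm (fun x => (0 : Lp F 2 μ) x - (0 : F)) 2 μ < ε := by
    intro μ
    have e : eLpNorm (fun x => (0 : Lp F 2 μ) x - (0 : F)) 2 μ = 0 := by
      rw [show (0 : ℝ≥0∞) = eLpNorm (0 : Plane → F) 2 μ by simp]
      refine eLpNorm_congr_ae ?_
      filter_upwards [Lp.coeFn_zero F 2 μ] with x hx
      rw [hx]; simp
    rw [e]; exact hε
  have hd : ∀ x v, fderiv ℝ (fun _ : Plane => (0 : F)) x v = 0 := by
    intro x v; simp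
  refine ⟨fun _ => 0, contDiff_const, HasCompactSupport.zero, ?_, fun i => ?_, ?_⟩
  · exact key
  · simp only [hd]
    exact key
  · exact key

theorem IsTrace.smul {Ω : Set Plane} {w : H1 F Ω} {b : Lp F 2 (bdryMeasure Ω)} (c : ℝ)
    (h : IsTrace w b) : IsTrace (c • w) (c • b) := by
  intro ε hε
  obtain ⟨δ, hδ, hcδ⟩ : ∃ δ : ℝ≥0∞, 0 < δ ∧ ∀ a, a < δ → ‖c‖ₑ * a < ε := by
    by_cases hc : c = 0
    · exact ⟨1, one_pos, fun a _ => by simpa [hc] using hε⟩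
    · have hc0 : ‖c‖ₑ ≠ 0 := by simpa using hc
      refine ⟨ε / ‖c‖ₑ, ENNReal.div_pos hε.ne' enorm_ne_top, fun a ha => ?_⟩
      rw [mul_comm]
      exact (ENNReal.lt_div_iff_mul_lt (Or.inl hc0) (Or.inl enorm_ne_top)).1 ha
  obtain ⟨ψ, h1, h2, h3, h4, h5⟩ := h δ hδ
  have key : ∀ {μ : Measure Plane} (f : Lp F 2 μ) (q : Plane → F),
      eLpNorm (fun x => f x - q x) 2 μ < δ →
      eLpNorm (fun x => (c • f) x - c • q x) 2 μ < ε := by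
    intro μ f q hf
    have e : eLpNorm (fun x => (c • f) x - c • q x) 2 μ
        = eLpNorm (c • fun x => f x - q x) 2 μ := by
      refine eLpNorm_congr_ae ?_
      filter_upwards [Lp.coeFn_smul c f] with x hx
      rw [hx, Pi.smul_apply, Pi.smul_apply, smul_sub]
    rw [e, eLpNorm_const_smul]
    exact hcδ _ hf
  have hd : ∀ x v, fderiv ℝ (fun y => c • ψ y) x v = c • fderiv ℝ ψ x v := by
    intro x v
    rw [fderiv_fun_const_smul ((h1.differentiable (by simp)) x)]
    rfl
  refine ⟨fun x => c • ψ x, h1.const_smul c, h2.smul_left (f := fun _ => c), ?_, fun i => ?_, ?_⟩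
  · exact key (val w) ψ h3
  · simp only [hd]
    exact key (grad w i) _ (h4 i)
  · exact key b ψ h5

variable (F) in
/-- The functions in `H¹(Ω; F)` whose trace vanishes on the part `S` of the boundary. -/
def H1Vanishing (Ω S : Set Plane) : Submodule ℝ (H1 F Ω) where
  carrier := {w | ∃ b, IsTrace w b ∧ ∀ᵐ x ∂(bdryMeasure Ω), x ∈ S → b x = 0}
  add_mem' := by
    rintro w w' ⟨b, hb, h⟩ ⟨b', hb', h'⟩
    refine ⟨b + b', hb.add hb', ?_⟩
    filter_upwards [h, h', Lp.coeFn_add b b'] with x hx hx' hs hxS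
    rw [hs, Pi.add_apply, hx hxS, hx' hxS, add_zero]
  zero_mem' := by
    refine ⟨0, IsTrace.zero Ω, ?_⟩
    filter_upwards [Lp.coeFn_zero F 2 (bdryMeasure Ω)] with x hx _
    rw [hx]; rfl
  smul_mem' := by
    rintro c w ⟨b, hb, h⟩
    refine ⟨c • b, hb.smul c, ?_⟩
    filter_upwards [h, Lp.coeFn_smul c b] with x hx hs hxS
    rw [hs, Pi.smul_apply, hx hxS, smul_zero]

end Sobolev

/-! ### The Navier–Stokes–Darcy model -/

/-- The physical constants: viscosity `ν`, gravity `g`, storativity `S₀`, scalar hydraulic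
conductivity `K` (the conductivity tensor is `K` times the identity), Beavers–Joseph–Saffman
coefficient `α`, and the final time `T`. -/
structure Params where
  ν : ℝ
  g : ℝ
  S₀ : ℝ
  K : ℝ
  α : ℝ
  T : ℝ
  ν_pos : 0 < ν
  g_pos : 0 < g
  S₀_pos : 0 < S₀
  K_pos : 0 < K
  α_nonneg : 0 ≤ α
  T_pos : 0 < T

/-- The interface between the two regions. -/
def interface (Ωf Ωp : Set Plane) : Set Plane := frontier Ωf ∩ frontier Ωp

/-- The velocity space `H_f`: `H¹` vector fields on `Ωf` vanishing on `∂Ωf ∖ Γ`. -/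
abbrev VelSpace (Ωf Ωp : Set Plane) : Type :=
  H1Vanishing Plane Ωf (frontier Ωf \ interface Ωf Ωp)

/-- The head space `H_p`: `H¹` functions on `Ωp` vanishing on `∂Ωp ∖ Γ`. -/
abbrev HeadSpace (Ωf Ωp : Set Plane) : Type :=
  H1Vanishing ℝ Ωp (frontier Ωp \ interface Ωf Ωp)

/-- The inner product `(∇w, ∇z)` in `L²(Ω)`. -/
def gradInner {F : Type} [NormedAddCommGroup F] [InnerProductSpace ℝ F] {Ω : Set Plane}
    (w z : H1 F Ω) : ℝ :=
  ∑ i, inner ℝ (grad w i) (grad z i)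

/-- `(q, ∇ · v)_f`. -/
def divPairing {Ω : Set Plane} (q : L2 Ω ℝ) (v : H1 Plane Ω) : ℝ :=
  ∫ x in Ω, q x * ∑ i, grad v i x i

/-- The boundary form `∫_Γ (u · τ) (v · τ) ds`. -/
def tangentialForm {Ωf Ωp : Set Plane} (u v : VelSpace Ωf Ωp) : ℝ :=
  ∫ x in interface Ωf Ωp, inner ℝ (trace (u : H1 Plane Ωf) x) (unitTangent Ωf x) *
    inner ℝ (trace (v : H1 Plane Ωf) x) (unitTangent Ωf x) ∂(Measure.hausdorffMeasure 1)

/-- The convective form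
`a(u, v, w) = ((u · ∇) v, w)_f - (1 / 2) ∫_Γ (u · v) (w · n) ds`. -/
def convForm {Ωf Ωp : Set Plane} (u v w : VelSpace Ωf Ωp) : ℝ :=
  (∫ x in Ωf, ∑ i, val (u : H1 Plane Ωf) x i *
    inner ℝ (grad (v : H1 Plane Ωf) i x) (val (w : H1 Plane Ωf) x)) -
  1 / 2 * ∫ x in interface Ωf Ωp,
    inner ℝ (trace (u : H1 Plane Ωf) x) (trace (v : H1 Plane Ωf) x) *
    inner ℝ (trace (w : H1 Plane Ωf) x) (outwardNormal Ωf x) ∂(Measure.hausdorffMeasure 1)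

namespace Params

variable (P : Params)

/-- The interface friction coefficient `α √(ν g / tr 𝕂)`; here `tr 𝕂 = 2 K`. -/
def friction : ℝ := P.α * √(P.ν * P.g / (2 * P.K))

/-- The coupling form `c_Γ(v, φ) = g ∫_Γ φ v · n ds`. -/
def coupling {Ωf Ωp : Set Plane} (v : VelSpace Ωf Ωp) (φ : HeadSpace Ωf Ωp) : ℝ :=
  P.g * ∫ x in interface Ωf Ωp, trace (φ : H1 ℝ Ωp) x *
    inner ℝ (trace (v : H1 Plane Ωf) x) (outwardNormal Ωf x) ∂(Measure.hausdorffMeasure 1)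

/-- The energy `(1 / 2) ‖u‖_f² + (g S₀ / 2) ‖φ‖_p²`. -/
def energy {Ωf Ωp : Set Plane} (u : VelSpace Ωf Ωp) (φ : HeadSpace Ωf Ωp) : ℝ :=
  1 / 2 * ‖val (u : H1 Plane Ωf)‖ ^ 2 + P.g * P.S₀ / 2 * ‖val (φ : H1 ℝ Ωp)‖ ^ 2

/-- The dissipation
`ν ‖∇u‖_f² + α √(ν g / tr 𝕂) ∫_Γ (u · τ)² ds + g K ‖∇φ‖_p²`. -/
def dissipation {Ωf Ωp : Set Plane} (u : VelSpace Ωf Ωp) (φ : HeadSpace Ωf Ωp) : ℝ :=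
  P.ν * gradInner (u : H1 Plane Ωf) u + P.friction * tangentialForm u u +
    P.g * P.K * gradInner (φ : H1 ℝ Ωp) φ

end Params

/-- Lebesgue measure on the time interval. -/
def timeMeasure (T : ℝ) : Measure ℝ := volume.restrict (Ioo 0 T)

/-- `(u, p, φ)` is a weak solution on `[0, T]` of the Navier–Stokes–Darcy model with forces
`ff` and `fp`; `u'` and `φ'` are the time derivatives of `u` and `φ`, as functions with values
in `L²`. -/
structure IsWeakSolution (P : Params) {Ωf Ωp : Set Plane}
    (ff : ℝ → VelSpace Ωf Ωp →L[ℝ] ℝ) (fp : ℝ → HeadSpace Ωf Ωp →L[ℝ] ℝ)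
    (u : ℝ → VelSpace Ωf Ωp) (u' : ℝ → L2 Ωf Plane) (p : ℝ → L2 Ωf ℝ)
    (φ : ℝ → HeadSpace Ωf Ωp) (φ' : ℝ → L2 Ωp ℝ) : Prop where
  deriv_u : ∀ t ∈ Icc 0 P.T,
    val (u t : H1 Plane Ωf) = val (u 0 : H1 Plane Ωf) + ∫ s in (0 : ℝ)..t, u' s
  deriv_φ : ∀ t ∈ Icc 0 P.T,
    val (φ t : H1 ℝ Ωp) = val (φ 0 : H1 ℝ Ωp) + ∫ s in (0 : ℝ)..t, φ' s
  equation : ∀ t ∈ Ioc 0 P.T, ∀ (v : VelSpace Ωf Ωp) (ψ : HeadSpace Ωf Ωp),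
    inner ℝ (u' t) (val (v : H1 Plane Ωf)) + P.g * P.S₀ * inner ℝ (φ' t) (val (ψ : H1 ℝ Ωp))
      + P.ν * gradInner (u t : H1 Plane Ωf) v - divPairing (p t) (v : H1 Plane Ωf)
      + convForm (u t) (u t) v + P.friction * tangentialForm (u t) v
      + P.g * P.K * gradInner (φ t : H1 ℝ Ωp) ψ
      + P.coupling v (φ t) - P.coupling (u t) ψ
      = ff t v + P.g * fp t ψ
  div_free : ∀ t ∈ Ioc 0 P.T, ∀ q : L2 Ωf ℝ, divPairing q (u t : H1 Plane Ωf) = 0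

/-- The regularity properties of the exact solution and the data:
`u ∈ L^∞(0,T;H²)`, `∂ₜu ∈ L²(0,T;H²)`, `∂ₜₜu ∈ L²(0,T;H⁻¹)`, `p ∈ L²(0,T;H¹)`, the same for `φ`
as for `u`, and `ff`, `fp` in `L²(0,T;H⁻¹)`. Here `H⁻¹` is the dual of the space of test
functions. -/
structure IsRegular (P : Params) {Ωf Ωp : Set Plane}
    (ff : ℝ → VelSpace Ωf Ωp →L[ℝ] ℝ) (fp : ℝ → HeadSpace Ωf Ωp →L[ℝ] ℝ)
    (u : ℝ → VelSpace Ωf Ωp) (u' : ℝ → L2 Ωf Plane) (p : ℝ → L2 Ωf ℝ)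
    (φ : ℝ → HeadSpace Ωf Ωp) (φ' : ℝ → L2 Ωp ℝ) : Prop where
  u_H2 : ∃ U : ℝ → H2 Plane Ωf, MemLp U ∞ (timeMeasure P.T) ∧
    ∀ᵐ t ∂(timeMeasure P.T), toH1 (U t) = u t
  u'_H2 : ∃ V : ℝ → H2 Plane Ωf, MemLp V 2 (timeMeasure P.T) ∧
    ∀ᵐ t ∂(timeMeasure P.T), val (toH1 (V t)) = u' t
  u'' : ∃ Z : ℝ → VelSpace Ωf Ωp →L[ℝ] ℝ, MemLp Z 2 (timeMeasure P.T) ∧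
    ∀ s ∈ Ioc 0 P.T, ∀ t ∈ Ioc 0 P.T, ∀ v : VelSpace Ωf Ωp,
      inner ℝ (u' t - u' s) (val (v : H1 Plane Ωf)) = ∫ r in s..t, Z r v
  p_H1 : ∃ Q : ℝ → H1 ℝ Ωf, MemLp Q 2 (timeMeasure P.T) ∧
    ∀ᵐ t ∂(timeMeasure P.T), val (Q t) = p t
  φ_H2 : ∃ U : ℝ → H2 ℝ Ωp, MemLp U ∞ (timeMeasure P.T) ∧
    ∀ᵐ t ∂(timeMeasure P.T), toH1 (U t) = φ t
  φ'_H2 : ∃ V : ℝ → H2 ℝ Ωp, MemLp V 2 (timeMeasure P.T) ∧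
    ∀ᵐ t ∂(timeMeasure P.T), val (toH1 (V t)) = φ' t
  φ'' : ∃ Z : ℝ → HeadSpace Ωf Ωp →L[ℝ] ℝ, MemLp Z 2 (timeMeasure P.T) ∧
    ∀ s ∈ Ioc 0 P.T, ∀ t ∈ Ioc 0 P.T, ∀ ψ : HeadSpace Ωf Ωp,
      inner ℝ (φ' t - φ' s) (val (ψ : H1 ℝ Ωp)) = ∫ r in s..t, Z r ψ
  ff_L2 : MemLp ff 2 (timeMeasure P.T)
  fp_L2 : MemLp fp 2 (timeMeasure P.T)

/-! ### The first-order prediction–correction scheme -/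

/-- The quantities computed by the scheme: predicted velocity and head `ut`, `φt`, pressure `p`,
relaxation factor `ξ`, energy `E`, and corrected velocity and head `u`, `φ`. -/
structure DiscreteSolution (Ωf Ωp : Set Plane) where
  ut : ℕ → VelSpace Ωf Ωp
  φt : ℕ → HeadSpace Ωf Ωp
  p : ℕ → L2 Ωf ℝ
  ξ : ℕ → ℝ
  E : ℕ → ℝ
  u : ℕ → VelSpace Ωf Ωp
  φ : ℕ → HeadSpace Ωf Ωp

/-- `D` is produced by the first-order scheme with time step `Δt`, forces `ff`, `fp` and initial
data `u₀`, `φ₀`, at all the time levels `(n + 1) Δt ≤ T`. -/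
structure IsSchemeI (P : Params) {Ωf Ωp : Set Plane}
    (ff : ℝ → VelSpace Ωf Ωp →L[ℝ] ℝ) (fp : ℝ → HeadSpace Ωf Ωp →L[ℝ] ℝ)
    (u₀ : VelSpace Ωf Ωp) (φ₀ : HeadSpace Ωf Ωp) (Δt : ℝ)
    (D : DiscreteSolution Ωf Ωp) : Prop where
  init_ut : D.ut 0 = u₀
  init_φt : D.φt 0 = φ₀
  init_u : D.u 0 = u₀
  init_φ : D.φ 0 = φ₀
  init_E : D.E 0 = P.energy u₀ φ₀
  momentum : ∀ n : ℕ, (n + 1) * Δt ≤ P.T → ∀ v : VelSpace Ωf Ωp,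
    inner ℝ (Δt⁻¹ • (val (D.ut (n + 1) : H1 Plane Ωf) - val (D.ut n : H1 Plane Ωf)))
        (val (v : H1 Plane Ωf))
      + P.ν * gradInner (D.ut (n + 1) : H1 Plane Ωf) v
      + P.friction * tangentialForm (D.ut (n + 1)) v
      - divPairing (D.p (n + 1)) (v : H1 Plane Ωf)
      + convForm (D.u n) (D.u n) v + P.coupling v (D.φ n)
      = ff ((n + 1) * Δt) v
  div_free : ∀ n : ℕ, (n + 1) * Δt ≤ P.T → ∀ q : L2 Ωf ℝ,
    divPairing q (D.ut (n + 1) : H1 Plane Ωf) = 0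
  darcy : ∀ n : ℕ, (n + 1) * Δt ≤ P.T → ∀ ψ : HeadSpace Ωf Ωp,
    P.g * P.S₀ * inner ℝ (Δt⁻¹ • (val (D.φt (n + 1) : H1 ℝ Ωp) - val (D.φt n : H1 ℝ Ωp)))
        (val (ψ : H1 ℝ Ωp))
      + P.g * P.K * gradInner (D.φt (n + 1) : H1 ℝ Ωp) ψ
      - P.coupling (D.u n) ψ
      = P.g * fp ((n + 1) * Δt) ψ
  energy_eq : ∀ n : ℕ, (n + 1) * Δt ≤ P.T →
    D.E (n + 1) = D.ξ (n + 1) * P.energy (D.ut (n + 1)) (D.φt (n + 1))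
  relaxation : ∀ n : ℕ, (n + 1) * Δt ≤ P.T →
    (D.E (n + 1) - D.E n) / Δt
      = -(D.ξ (n + 1) * P.dissipation (D.ut (n + 1)) (D.φt (n + 1)))
  correct_u : ∀ n : ℕ, (n + 1) * Δt ≤ P.T → D.u (n + 1) = √(D.ξ (n + 1)) • D.ut (n + 1)
  correct_φ : ∀ n : ℕ, (n + 1) * Δt ≤ P.T → D.φ (n + 1) = √(D.ξ (n + 1)) • D.φt (n + 1)

end NSD

end

open NSD

namespace NSD

/-! ### Discrete Gronwall inequalities -/

/-! Write a state as x = (u, φ). Let m be its mass form, A its dissipation form, and N the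
convective and interface terms, which the scheme treats explicitly. Against divergence-free test
pairs the pressures drop out. The exact values X_j then satisfy a backward Euler equation for m, A
and N up to truncation, and the predictions X_j + e_j satisfy it exactly, except that N is evaluated
at the previous correction w_j = η_j (X_j + e_j), where η = √ξ.

The central estimate is `Params.exists_explicitForm_bound`. In N(x, z) - N(y, z) the test function z
pays only the geometric mean of its L² and H¹ norms, while x - y pays its H¹ norm. Two applications
of Young's inequality bound N(w_j) - N(X_{j+1}), tested with e_{j+1}, by small multiples of the
dissipation of e_j and e_{j+1}, plus multiples of m(e, e), of (1 - η_j)² and of the squared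
truncation error (`predictor_step`).

The scalar energy is compared with the exact law E' = -A(X, X). That law holds because a(u, u, u) =
0 for divergence-free fields, the two interface terms cancel, and the forces do no work. Eliminating
ξ gives a damped recursion for the energy error, and |1 - √ξ| is bounded by the energy error plus
√m(e, e), since the energy stays away from zero (`corrector_step`).

Both step estimates require the errors to be small already, in H¹ as well as in energy. Discrete
Gronwall gives m(e_n, e_n) + Δt Σ A(e_j, e_j) = O(Δt²), hence A(e_n, e_n) = O(Δt) at each single
level. For small Δt this keeps the next step in the admissible range, and induction on the time
level closes (`bootstrap`).

The inputs from analysis are these. Ladyzhenskaya's inequality and the trace inequalities follow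
from W^{1,1} estimates, proved by integrating along segments inside the Lipschitz domain and applied
to powers of |ψ|. The identity a(u, u, u) = 0 is the divergence theorem for |u|²u; since normals and
arc length are defined geometrically, it requires identifying them on Lipschitz graphs. The
regularity in time gives per-step truncation quantities ϖ_j with Σ ϖ_j ≤ Ω and Σ ϖ_j² ≤ Ω Δt, which
is what first order needs. -/

theorem discrete_gronwall {y : ℕ → ℝ} {A κ : ℝ} (hκ : 0 ≤ κ) (n : ℕ)
    (h : ∀ j ≤ n, y j ≤ A + κ * ∑ i ∈ Finset.range j, y i) :
    y n ≤ A * (1 + κ) ^ n := by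
  have key : ∀ j ≤ n, A + κ * ∑ i ∈ Finset.range j, y i ≤ A * (1 + κ) ^ j := by
    intro j
    induction j with
    | zero => intro _; simp
    | succ j ih =>
      intro hj
      have h1 := ih (by omega)
      have h2 := h j (by omega)
      rw [Finset.sum_range_succ, pow_succ]
      nlinarith [mul_le_mul_of_nonneg_left (h2.trans h1) hκ]
  exact (h n le_rfl).trans (key n le_rfl)

theorem one_add_pow_le_exp {κ Δt T : ℝ} (hκ : 0 ≤ κ) (hΔ : 0 ≤ Δt) {n : ℕ} (hn : n * Δt ≤ T) :
    (1 + κ * Δt) ^ n ≤ Real.exp (κ * T) := by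
  calc (1 + κ * Δt) ^ n ≤ (Real.exp (κ * Δt)) ^ n := by
        gcongr
        linarith [Real.add_one_le_exp (κ * Δt)]
    _ = Real.exp (κ * (n * Δt)) := by rw [← Real.exp_nat_mul]; ring_nf
    _ ≤ _ := by gcongr

theorem sq_sum_range_le (s : ℕ → ℝ) (n : ℕ) :
    (∑ i ∈ Finset.range n, s i) ^ 2 ≤ n * ∑ i ∈ Finset.range n, s i ^ 2 := by
  simpa using sq_sum_le_card_mul_sum_sq (s := Finset.range n) (f := s)

/-- The accumulated energy error is controlled by the accumulated errors in velocity and head. -/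
theorem accumulated_bound {c T Ω Δt : ℝ} (hc : 0 ≤ c) (hΔ : 0 < Δt) {n : ℕ}
    (hn : n * Δt ≤ T) {q a b ϖ : ℕ → ℝ} (hq : ∀ j, 0 ≤ q j) (ha : ∀ j, 0 ≤ a j) (hb : ∀ j, 0 ≤ b j)
    (hb0 : b 0 = 0) (hϖ1 : ∑ j ∈ Finset.range n, ϖ j ≤ Ω)
    (hϖ2 : ∑ j ∈ Finset.range n, ϖ j ^ 2 ≤ Ω * Δt)
    (h : ∀ j < n, b (j + 1) ≤ b j
      + c * (Δt * √(q (j + 1) + a (j + 1)) + Δt * ϖ j + ϖ j ^ 2)) :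
    b n ^ 2 ≤ 8 * c ^ 2 * Ω ^ 2 * Δt ^ 2
      + 2 * c ^ 2 * T * (Δt * ∑ j ∈ Finset.range (n + 1), (q j + a j)) := by
  have h1 : ∀ j ≤ n, b j ≤ c * (Δt * ∑ i ∈ Finset.range j, √(q (i + 1) + a (i + 1))
      + Δt * ∑ i ∈ Finset.range j, ϖ i + ∑ i ∈ Finset.range j, ϖ i ^ 2) := by
    intro j
    induction j with
    | zero => intro _; simp [hb0]
    | succ j ih =>
      intro hj
      have h2 := ih (by omega)
      have h3 := h j (by omega)
      simp only [Finset.sum_range_succ]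
      nlinarith
  set S := ∑ i ∈ Finset.range n, √(q (i + 1) + a (i + 1)) with hS
  have hS0 : 0 ≤ S := Finset.sum_nonneg fun i _ => Real.sqrt_nonneg _
  -- Both truncation sums are at most Ω Δt: one is Δt times a bounded sum, the other is the sum of
  -- squares.
  have h2 : b n ≤ c * (Δt * S) + c * (2 * Ω * Δt) := by
    have := h1 n le_rfl
    have h4 : Δt * ∑ i ∈ Finset.range n, ϖ i ≤ Δt * Ω := by gcongr
    nlinarith [mul_le_mul_of_nonneg_left h4 hc, mul_le_mul_of_nonneg_left hϖ2 hc]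
  have h3 : S ^ 2 ≤ n * ∑ j ∈ Finset.range (n + 1), (q j + a j) := by
    refine (sq_sum_range_le _ _).trans ?_
    gcongr
    rw [Finset.sum_range_succ' (fun j => q j + a j)]
    have : ∀ i, √(q (i + 1) + a (i + 1)) ^ 2 = q (i + 1) + a (i + 1) := fun i =>
      Real.sq_sqrt (add_nonneg (hq _) (ha _))
    simp only [this]
    linarith [hq 0, ha 0]
  have hX : 0 ≤ ∑ j ∈ Finset.range (n + 1), (q j + a j) :=
    Finset.sum_nonneg fun i _ => add_nonneg (hq _) (ha _)
  -- Cauchy–Schwarz costs a factor n, and n Δt ≤ T pays for it. One Δt is left in front of the sum,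
  -- so the energy error is controlled by the time-integrated dissipation of the errors.
  have h5 : (Δt * S) ^ 2 ≤ T * (Δt * ∑ j ∈ Finset.range (n + 1), (q j + a j)) := by
    calc (Δt * S) ^ 2 = Δt ^ 2 * S ^ 2 := by ring
      _ ≤ Δt ^ 2 * (n * ∑ j ∈ Finset.range (n + 1), (q j + a j)) := by gcongr
      _ = (n * Δt) * (Δt * ∑ j ∈ Finset.range (n + 1), (q j + a j)) := by ring
      _ ≤ _ := by gcongr
  calc b n ^ 2 ≤ (c * (Δt * S) + c * (2 * Ω * Δt)) ^ 2 := by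
        gcongr
        exact hb n
    _ ≤ 2 * (c * (Δt * S)) ^ 2 + 2 * (c * (2 * Ω * Δt)) ^ 2 := by
        nlinarith [sq_nonneg (c * (Δt * S) - c * (2 * Ω * Δt))]
    _ = 8 * c ^ 2 * Ω ^ 2 * Δt ^ 2 + 2 * c ^ 2 * (Δt * S) ^ 2 := by ring
    _ ≤ _ := by nlinarith [mul_le_mul_of_nonneg_left h5 (sq_nonneg c)]

theorem weighted_sum_le {x y d g z : ℝ} (hx : 0 ≤ x) (hy : 0 ≤ y) (hd : 0 ≤ d) (hg : 0 ≤ g)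
    (hz : 0 ≤ z) : x * d + y * (g + 2 * z) + z ≤ (x + 3 * y + 1) * (d + g + z) := by
  nlinarith [mul_nonneg hx hg, mul_nonneg hx hz, mul_nonneg hy hd, mul_nonneg hy hg,
    mul_nonneg hy hz]

set_option maxHeartbeats 800000 in
/-- The error quantities are of second order as long as the step inequalities hold. -/
theorem gronwall_of_steps {c T Ω : ℝ} (hc : 0 ≤ c) (hT : 0 < T) (hΩ : 0 ≤ Ω) :
    ∃ C₀ ≥ (0 : ℝ), ∃ δ > (0 : ℝ), ∀ Δt : ℝ, 0 < Δt → Δt ≤ δ → ∀ n : ℕ, n * Δt ≤ T →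
      ∀ q a b θ ϖ : ℕ → ℝ, (∀ j, 0 ≤ q j) → (∀ j, 0 ≤ a j) → (∀ j, 0 ≤ b j) → (∀ j, 0 ≤ θ j) →
      (∀ j, 0 ≤ ϖ j) →
      q 0 = 0 → a 0 = 0 → b 0 = 0 → θ 0 = 0 →
      ∑ j ∈ Finset.range n, ϖ j ≤ Ω → ∑ j ∈ Finset.range n, ϖ j ^ 2 ≤ Ω * Δt →
      (∀ j < n, q (j + 1) + Δt * a (j + 1) ≤ q j + 1 / 2 * Δt * a j
        + c * Δt * (q (j + 1) + q j + ϖ j ^ 2 + θ j ^ 2)) →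
      (∀ j, j + 1 < n → b (j + 1) ≤ b j
        + c * (Δt * √(q (j + 1) + a (j + 1)) + Δt * ϖ j + ϖ j ^ 2)) →
      (∀ j, j + 1 < n → θ (j + 1) ≤ c * (b (j + 1) + √(q (j + 1)))) →
      q n + 1 / 2 * (Δt * ∑ j ∈ Finset.range (n + 1), a j) ≤ C₀ * Δt ^ 2 := by
  -- `k1` is the constant in the bound of θ j ² by Δt² + G j + Y j below; the factor 3 comes from
  -- `weighted_sum_le`. `k2` and `k3` are the coefficients of Δt² and of G j in `hstep`.
  set k1 : ℝ := 2 * c ^ 2 * (8 * c ^ 2 * Ω ^ 2 + 3 * (2 * c ^ 2 * T) + 1) with hk1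
  have hk1' : 0 ≤ k1 := by positivity
  set k2 : ℝ := c * Ω + c * k1 * T with hk2
  set k3 : ℝ := 2 * c + c * k1 * T + c * k1 with hk3
  have hk2' : 0 ≤ k2 := by positivity
  have hk3' : 0 ≤ k3 := by positivity
  refine ⟨2 * k2 * Real.exp (2 * k3 * T), by positivity, 1 / (2 * k3 + 1), by positivity, ?_⟩
  intro Δt hΔ hδ n hn q a b θ ϖ hq ha hb hθ hϖ hq0 ha0 hb0 hθ0 hϖ1 hϖ2 H1 H2 H3
  have hsmall : k3 * Δt ≤ 1 / 2 := by
    rw [le_div_iff₀ (by positivity)] at hδ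
    nlinarith
  -- Each step puts Δt a (j + 1) on the left and half of Δt a j on the right, so after telescoping
  -- half of the dissipation sum survives.
  set Y : ℕ → ℝ := fun j => q j + 1 / 2 * (Δt * ∑ i ∈ Finset.range (j + 1), a i) with hY
  have hsa : ∀ j, 0 ≤ ∑ i ∈ Finset.range (j + 1), a i := fun j => Finset.sum_nonneg fun i _ => ha i
  have hY0 : ∀ j, 0 ≤ Y j := fun j => by
    have := hsa j; have := hq j
    simp only [hY]; positivity
  have hqY : ∀ j, q j ≤ Y j := fun j => by
    have := mul_nonneg hΔ.le (hsa j)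
    simp only [hY]; linarith
  have haY : ∀ j, Δt * ∑ i ∈ Finset.range (j + 1), a i ≤ 2 * Y j := fun j => by
    have := hq j
    simp only [hY]; linarith
  set G : ℕ → ℝ := fun j => Δt * ∑ i ∈ Finset.range (j + 1), Y i with hG
  have hG0 : ∀ j, 0 ≤ G j := fun j => mul_nonneg hΔ.le (Finset.sum_nonneg fun i _ => hY0 i)
  have hGmono : ∀ i j, i ≤ j → G i ≤ G j := fun i j hij => by
    simp only [hG]
    gcongr
    exact fun i _ _ => hY0 i
  have hϖn : ∀ j ≤ n, ∑ i ∈ Finset.range j, ϖ i ≤ Ω := fun j hj =>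
    (Finset.sum_le_sum_of_subset_of_nonneg (Finset.range_mono hj) fun i _ _ => hϖ i).trans hϖ1
  have hϖn2 : ∀ j ≤ n, ∑ i ∈ Finset.range j, ϖ i ^ 2 ≤ Ω * Δt := fun j hj =>
    (Finset.sum_le_sum_of_subset_of_nonneg (Finset.range_mono hj)
      fun i _ _ => sq_nonneg _).trans hϖ2
  have hjT : ∀ j ≤ n, j * Δt ≤ T := fun j hj => le_trans (by gcongr) hn
  -- bound on the relaxation error
  have hθb : ∀ j < n, θ j ^ 2 ≤ k1 * (Δt ^ 2 + G j + Y j) := by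
    intro j hj
    rcases j with _ | j
    · rw [hθ0]
      nlinarith [mul_nonneg hk1' (add_nonneg (add_nonneg (sq_nonneg Δt) (hG0 0)) (hY0 0))]
    have hacc := accumulated_bound hc hΔ (hjT (j + 1) hj.le) hq ha hb hb0 (hϖn _ hj.le)
      (hϖn2 _ hj.le) (fun i hi => H2 i (by omega))
    have h4 : Δt * ∑ i ∈ Finset.range (j + 1 + 1), (q i + a i) ≤ G (j + 1) + 2 * Y (j + 1) := by
      rw [Finset.sum_add_distrib, mul_add]
      refine add_le_add ?_ (haY _)
      simp only [hG]
      gcongr with i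
      exact hqY i
    have h5 := H3 j hj
    have h6 : θ (j + 1) ^ 2 ≤ 2 * c ^ 2 * (b (j + 1) ^ 2 + q (j + 1)) := by
      calc θ (j + 1) ^ 2 ≤ (c * (b (j + 1) + √(q (j + 1)))) ^ 2 := by gcongr; exact hθ _
        _ = c ^ 2 * (b (j + 1) + √(q (j + 1))) ^ 2 := by ring
        _ ≤ c ^ 2 * (2 * (b (j + 1) ^ 2 + √(q (j + 1)) ^ 2)) := by
            gcongr
            nlinarith [sq_nonneg (b (j + 1) - √(q (j + 1)))]
        _ = _ := by rw [Real.sq_sqrt (hq _)]; ring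
    refine h6.trans ?_
    have h7 := hqY (j + 1)
    have h8 : b (j + 1) ^ 2 + q (j + 1) ≤ 8 * c ^ 2 * Ω ^ 2 * Δt ^ 2
        + 2 * c ^ 2 * T * (G (j + 1) + 2 * Y (j + 1)) + Y (j + 1) := by
      have : 2 * c ^ 2 * T * (Δt * ∑ i ∈ Finset.range (j + 1 + 1), (q i + a i))
          ≤ 2 * c ^ 2 * T * (G (j + 1) + 2 * Y (j + 1)) := by gcongr
      linarith
    rw [hk1, mul_assoc (2 * c ^ 2)]
    refine mul_le_mul_of_nonneg_left (h8.trans ?_) (by positivity)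
    have e1 : 0 ≤ 8 * c ^ 2 * Ω ^ 2 := by positivity
    have e2 : 0 ≤ 2 * c ^ 2 * T := by positivity
    have e := weighted_sum_le e1 e2 (sq_nonneg Δt) (hG0 (j + 1)) (hY0 (j + 1))
    linarith
  -- summation of the step inequalities
  have hsum : ∀ j ≤ n, Y j + 1 / 2 * Δt * a j ≤ ∑ i ∈ Finset.range j,
      c * Δt * (q (i + 1) + q i + ϖ i ^ 2 + θ i ^ 2) := by
    intro j
    induction j with
    | zero => intro _; simp [hY, hq0, ha0]
    | succ j ih =>
      intro hj
      have h1 := ih (by omega)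
      have h2 := H1 j (by omega)
      rw [Finset.sum_range_succ]
      have h3 : Y (j + 1) = q (j + 1) - q j + Y j + 1 / 2 * (Δt * a (j + 1)) := by
        simp only [hY]
        rw [Finset.sum_range_succ a (j + 1)]
        ring
      rw [h3]
      linarith
  -- The bound of θ i ² contains G i, itself a sum over earlier levels. By monotonicity it is
  -- replaced by G j, and the j summands carry the total weight j Δt ≤ T; this is how T enters `k2`
  -- and `k3`.
  have hstep : ∀ j ≤ n, Y j ≤ k2 * Δt ^ 2 + k3 * G j := by
    intro j hj
    have h1 := hsum j hj
    have hbound : ∀ i ∈ Finset.range j, c * Δt * (q (i + 1) + q i + ϖ i ^ 2 + θ i ^ 2)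
        ≤ c * Δt * Y (i + 1) + c * Δt * Y i + c * Δt * ϖ i ^ 2
          + c * Δt * (k1 * (Δt ^ 2 + G j)) + c * Δt * (k1 * Y i) := by
      intro i hi
      have hij := Finset.mem_range.1 hi
      have h2 := hθb i (by omega)
      have h3 := hGmono i j hij.le
      have h4 := hqY i
      have h5 := hqY (i + 1)
      have h6 : k1 * G i ≤ k1 * G j := by gcongr
      rw [← mul_add, ← mul_add, ← mul_add, ← mul_add]
      refine mul_le_mul_of_nonneg_left ?_ (by positivity)
      linarith
    have h2 := Finset.sum_le_sum hbound
    simp only [Finset.sum_add_distrib, ← Finset.mul_sum, Finset.sum_const, Finset.card_range,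
      nsmul_eq_mul] at h2
    have e1 : Δt * ∑ i ∈ Finset.range j, Y (i + 1) ≤ G j := by
      simp only [hG]
      gcongr
      rw [Finset.sum_range_succ' Y]
      linarith [hY0 0]
    have e2 : Δt * ∑ i ∈ Finset.range j, Y i ≤ G j := by
      simp only [hG]
      rw [Finset.sum_range_succ Y, mul_add]
      linarith [mul_nonneg hΔ.le (hY0 j)]
    have e3 := hϖn2 j hj
    have e4 := hjT j hj
    have e5 := hG0 j
    have e6 := sq_nonneg Δt
    have f1 : c * (Δt * ∑ i ∈ Finset.range j, Y (i + 1)) ≤ c * G j := by gcongr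
    have f2 : c * (Δt * ∑ i ∈ Finset.range j, Y i) ≤ c * G j := by gcongr
    have f3 : c * Δt * ∑ i ∈ Finset.range j, ϖ i ^ 2 ≤ c * Δt * (Ω * Δt) := by gcongr
    have f4 : (c * k1) * ((j * Δt) * (Δt ^ 2 + G j)) ≤ (c * k1) * (T * (Δt ^ 2 + G j)) := by
      gcongr
    have f5 : (c * k1) * (Δt * ∑ i ∈ Finset.range j, Y i) ≤ (c * k1) * G j := by gcongr
    have g1 : ∑ i ∈ Finset.range j, c * Δt * (q (i + 1) + q i + ϖ i ^ 2 + θ i ^ 2)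
        = c * Δt * ∑ i ∈ Finset.range j, (q (i + 1) + q i + ϖ i ^ 2 + θ i ^ 2) :=
      (Finset.mul_sum _ _ _).symm
    have h0 : 0 ≤ 1 / 2 * Δt * a j := by have := ha j; positivity
    rw [hk2, hk3]
    rw [g1] at h1
    simp only [Finset.sum_add_distrib] at h1
    linarith
  -- The last summand of G j is Δt Y j, the unknown itself. As k3 Δt ≤ 1/2 it moves to the left, at
  -- the price of doubling both constants.
  have hfin : ∀ j ≤ n, Y j ≤ 2 * k2 * Δt ^ 2 + (2 * k3 * Δt) * ∑ i ∈ Finset.range j, Y i := by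
    intro j hj
    have h1 := hstep j hj
    have h2 : G j = Δt * ∑ i ∈ Finset.range j, Y i + Δt * Y j := by
      simp only [hG, Finset.sum_range_succ, mul_add]
    rw [h2] at h1
    have h3 := mul_le_mul_of_nonneg_right hsmall (hY0 j)
    linarith
  have h1 := discrete_gronwall (by positivity) n hfin
  refine h1.trans ?_
  have h2 := one_add_pow_le_exp (κ := 2 * k3) (by positivity) hΔ.le hn
  calc 2 * k2 * Δt ^ 2 * (1 + 2 * k3 * Δt) ^ n ≤ 2 * k2 * Δt ^ 2 * Real.exp (2 * k3 * T) := by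
        gcongr
    _ = _ := by ring

/-- Bootstrap: step inequalities that hold only as long as the errors are small give first-order
bounds for all the steps. -/
theorem bootstrap {c T Ω ρ : ℝ} (hc : 0 ≤ c) (hT : 0 < T) (hΩ : 0 ≤ Ω) (hρ : 0 < ρ) :
    ∃ C > (0 : ℝ), ∃ δ > (0 : ℝ), ∀ Δt : ℝ, 0 < Δt → Δt ≤ δ → ∀ K : ℕ, K * Δt ≤ T →
      ∀ q a b θ ϖ : ℕ → ℝ, (∀ j, 0 ≤ q j) → (∀ j, 0 ≤ a j) → (∀ j, 0 ≤ b j) → (∀ j, 0 ≤ θ j) →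
      (∀ j, 0 ≤ ϖ j) →
      q 0 = 0 → a 0 = 0 → b 0 = 0 → θ 0 = 0 →
      ∑ j ∈ Finset.range K, ϖ j ≤ Ω → ∑ j ∈ Finset.range K, ϖ j ^ 2 ≤ Ω * Δt →
      (∀ j < K, q j + a j ≤ ρ → θ j ≤ 1 → q (j + 1) + Δt * a (j + 1) ≤ q j + 1 / 2 * Δt * a j
        + c * Δt * (q (j + 1) + q j + ϖ j ^ 2 + θ j ^ 2)) →
      (∀ j < K, b j ≤ ρ → q (j + 1) + a (j + 1) ≤ ρ → b (j + 1) ≤ b j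
        + c * (Δt * √(q (j + 1) + a (j + 1)) + Δt * ϖ j + ϖ j ^ 2)) →
      (∀ j < K, b j ≤ ρ → q (j + 1) + a (j + 1) ≤ ρ → θ (j + 1) ≤ c * (b (j + 1) + √(q (j + 1)))) →
      ∀ j ≤ K, √(q j) ≤ C * Δt ∧ b j ≤ C * Δt ∧ θ j ≤ C * Δt := by
  obtain ⟨C₀, hC₀, δ₀, hδ₀, H⟩ := gronwall_of_steps hc hT hΩ
  -- The bound of `accumulated_bound` once Y ≤ C₀ Δt² is known: the dissipation contributes 2 C₀
  -- Δt², and the mass terms, summed over the time interval, contribute T C₀ Δt².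
  set C₁ : ℝ := √(8 * c ^ 2 * Ω ^ 2 + 2 * c ^ 2 * T * (T * C₀ + 2 * C₀)) with hC₁
  have hC₁0 : 0 ≤ C₁ := Real.sqrt_nonneg _
  set C₂ : ℝ := c * (C₁ + √C₀) with hC₂
  have hC₂0 : 0 ≤ C₂ := by positivity
  -- Beyond the Gronwall threshold, the step must satisfy Δt ≤ 1 and make 3 C₀ Δt ≤ ρ, C₁ Δt ≤ ρ and
  -- C₂ Δt ≤ 1. These are exactly the smallness conditions of the step inequalities.
  refine ⟨√C₀ + C₁ + C₂ + 1, by positivity,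
    min (min δ₀ 1) (min (ρ / (3 * C₀ + 1)) (min (ρ / (C₁ + 1)) (1 / (C₂ + 1)))), by positivity, ?_⟩
  intro Δt hΔ hδ K hK q a b θ ϖ hq ha hb hθ hϖ hq0 ha0 hb0 hθ0 hϖ1 hϖ2 H1 H2 H3
  simp only [le_min_iff] at hδ
  obtain ⟨⟨hd0, hd1⟩, hd2, hd3, hd4⟩ := hδ
  rw [le_div_iff₀ (by positivity)] at hd2 hd3 hd4
  have hϖn : ∀ j ≤ K, ∑ i ∈ Finset.range j, ϖ i ≤ Ω := fun j hj =>
    (Finset.sum_le_sum_of_subset_of_nonneg (Finset.range_mono hj) fun i _ _ => hϖ i).trans hϖ1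
  have hϖn2 : ∀ j ≤ K, ∑ i ∈ Finset.range j, ϖ i ^ 2 ≤ Ω * Δt := fun j hj =>
    (Finset.sum_le_sum_of_subset_of_nonneg (Finset.range_mono hj)
      fun i _ _ => sq_nonneg _).trans hϖ2
  have hjT : ∀ j ≤ K, j * Δt ≤ T := fun j hj => le_trans (by gcongr) hK
  have main : ∀ n ≤ K, ∀ j ≤ n,
      q j + 1 / 2 * (Δt * ∑ i ∈ Finset.range (j + 1), a i) ≤ C₀ * Δt ^ 2 ∧
      b j ≤ C₁ * Δt ∧ θ j ≤ C₂ * Δt := by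
    intro n
    induction n with
    | zero =>
      intro _ j hj
      obtain rfl : j = 0 := by omega
      refine ⟨?_, ?_, ?_⟩
      · simp [hq0, ha0]; positivity
      · rw [hb0]; positivity
      · rw [hθ0]; positivity
    | succ n ih =>
      intro hn
      have IH := ih (by omega)
      -- The second-order bound contains Δt a j. Dividing by Δt leaves a j = O(Δt) at the single
      -- level j: the summed estimate yields pointwise smallness in H¹.
      have hsm : ∀ j, q j + 1 / 2 * (Δt * ∑ i ∈ Finset.range (j + 1), a i) ≤ C₀ * Δt ^ 2 →
          q j + a j ≤ ρ := by
        intro j h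
        have h1 : a j ≤ ∑ i ∈ Finset.range (j + 1), a i :=
          Finset.single_le_sum (fun i _ => ha i) (Finset.self_mem_range_succ j)
        have h2 : Δt * a j ≤ 2 * C₀ * Δt * Δt := by
          have := mul_le_mul_of_nonneg_left h1 hΔ.le
          nlinarith [hq j]
        have h3 : a j ≤ 2 * C₀ * Δt := by
          have : Δt * a j ≤ Δt * (2 * C₀ * Δt) := by linarith
          exact le_of_mul_le_mul_left this hΔ
        have h4 : q j ≤ C₀ * Δt ^ 2 := by
          have : 0 ≤ Δt * ∑ i ∈ Finset.range (j + 1), a i :=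
            mul_nonneg hΔ.le (Finset.sum_nonneg fun i _ => ha i)
          linarith
        have h5 : C₀ * Δt ^ 2 ≤ C₀ * Δt := by
          gcongr
          nlinarith
        nlinarith
      have hbρ : ∀ j ≤ n, b j ≤ ρ := fun j hj => (IH j hj).2.1.trans (by nlinarith)
      have hθ1 : ∀ j ≤ n, θ j ≤ 1 := fun j hj => (IH j hj).2.2.trans (by nlinarith)
      -- There is no circularity. The predictor step needs smallness at its starting level only, and
      -- the Gronwall lemma uses the energy inequalities only at levels up to n, where smallness is
      -- already known.
      have hY : q (n + 1) + 1 / 2 * (Δt * ∑ i ∈ Finset.range (n + 1 + 1), a i) ≤ C₀ * Δt ^ 2 := by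
        refine H Δt hΔ hd0 (n + 1) (hjT _ hn) q a b θ ϖ hq ha hb hθ hϖ hq0 ha0 hb0 hθ0
          (hϖn _ hn) (hϖn2 _ hn) ?_ ?_ ?_
        · intro j hj
          exact H1 j (by omega) (hsm j (IH j (by omega)).1) (hθ1 j (by omega))
        · intro j hj
          exact H2 j (by omega) (hbρ j (by omega)) (hsm _ (IH (j + 1) (by omega)).1)
        · intro j hj
          exact H3 j (by omega) (hbρ j (by omega)) (hsm _ (IH (j + 1) (by omega)).1)
      have hall : ∀ j ≤ n + 1,
          q j + 1 / 2 * (Δt * ∑ i ∈ Finset.range (j + 1), a i) ≤ C₀ * Δt ^ 2 := by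
        intro j hj
        rcases Nat.lt_or_ge j (n + 1) with h | h
        · exact (IH j (by omega)).1
        · obtain rfl : j = n + 1 := by omega
          exact hY
      have hqs : ∀ j ≤ n + 1, q j ≤ C₀ * Δt ^ 2 := fun j hj => by
        have : 0 ≤ Δt * ∑ i ∈ Finset.range (j + 1), a i :=
          mul_nonneg hΔ.le (Finset.sum_nonneg fun i _ => ha i)
        linarith [hall j hj]
      -- Only now, with the prediction error at level n + 1 under control, may the energy inequality
      -- be used for the last step.
      have hbn : b (n + 1) ≤ C₁ * Δt := by
        have hacc := accumulated_bound (n := n + 1) hc hΔ (hjT _ hn) hq ha hb hb0 (hϖn _ hn)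
          (hϖn2 _ hn) (fun j hj => H2 j (by omega) (hbρ j (by omega)) (hsm _ (hall _ (by omega))))
        have h1 : Δt * ∑ j ∈ Finset.range (n + 1 + 1), (q j + a j)
            ≤ (T * C₀ + 2 * C₀) * Δt ^ 2 := by
          rw [Finset.sum_add_distrib, mul_add]
          have e1 : Δt * ∑ i ∈ Finset.range (n + 1 + 1), a i ≤ 2 * C₀ * Δt ^ 2 := by
            linarith [hall (n + 1) le_rfl, hq (n + 1)]
          have e2 : Δt * ∑ i ∈ Finset.range (n + 1 + 1), q i ≤ T * C₀ * Δt ^ 2 := by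
            rw [Finset.sum_range_succ', hq0, add_zero]
            calc Δt * ∑ i ∈ Finset.range (n + 1), q (i + 1)
                ≤ Δt * ∑ i ∈ Finset.range (n + 1), C₀ * Δt ^ 2 := by
                  gcongr with i hi
                  exact hqs _ (by have := Finset.mem_range.1 hi; omega)
              _ = ((n + 1 : ℕ) * Δt) * (C₀ * Δt ^ 2) := by
                  rw [Finset.sum_const, Finset.card_range, nsmul_eq_mul]; ring
              _ ≤ T * (C₀ * Δt ^ 2) := by
                  gcongr
                  exact hjT _ hn
              _ = _ := by ring
          linarith
        have h2 : b (n + 1) ^ 2 ≤ (C₁ * Δt) ^ 2 := by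
          rw [mul_pow, hC₁, Real.sq_sqrt (by positivity)]
          have : 2 * c ^ 2 * T * (Δt * ∑ j ∈ Finset.range (n + 1 + 1), (q j + a j))
            ≤ 2 * c ^ 2 * T * ((T * C₀ + 2 * C₀) * Δt ^ 2) := by gcongr
          linarith
        exact abs_le_of_sq_le_sq' h2 (by positivity) |>.2
      have hθn : θ (n + 1) ≤ C₂ * Δt := by
        have h1 := H3 n (by omega) (hbρ n le_rfl) (hsm _ hY)
        have h2 : √(q (n + 1)) ≤ √C₀ * Δt := by
          rw [← Real.sqrt_sq hΔ.le, ← Real.sqrt_mul hC₀]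
          exact Real.sqrt_le_sqrt (hqs _ le_rfl)
        calc θ (n + 1) ≤ c * (b (n + 1) + √(q (n + 1))) := h1
          _ ≤ c * (C₁ * Δt + √C₀ * Δt) := by gcongr
          _ = _ := by rw [hC₂]; ring
      intro j hj
      rcases Nat.lt_or_ge j (n + 1) with h | h
      · exact IH j (by omega)
      · obtain rfl : j = n + 1 := by omega
        exact ⟨hY, hbn, hθn⟩
  intro j hj
  obtain ⟨h1, h2, h3⟩ := main K le_rfl j hj
  have hs : 0 ≤ √C₀ := Real.sqrt_nonneg _
  refine ⟨?_, h2.trans ?_, h3.trans ?_⟩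
  · have : q j ≤ C₀ * Δt ^ 2 := by
      have : 0 ≤ Δt * ∑ i ∈ Finset.range (j + 1), a i :=
        mul_nonneg hΔ.le (Finset.sum_nonneg fun i _ => ha i)
      linarith
    calc √(q j) ≤ √(C₀ * Δt ^ 2) := Real.sqrt_le_sqrt this
      _ = √C₀ * Δt := by rw [Real.sqrt_mul hC₀, Real.sqrt_sq hΔ.le]
      _ ≤ _ := by gcongr; linarith
  · gcongr; linarith
  · gcongr; linarith

end NSD

namespace NSD

/-! ### The prediction–correction scheme in abstract form -/

section AbstractScheme

variable {W : Type*} [NormedAddCommGroup W] [NormedSpace ℝ W]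

theorem bilin_sq_le {m : W →ₗ[ℝ] W →ₗ[ℝ] ℝ} (hs : ∀ x y, m x y = m y x) (h0 : ∀ x, 0 ≤ m x x)
    (x y : W) : |m x y| ≤ √(m x x) * √(m y y) := by
  rw [← Real.sqrt_mul (h0 x)]
  refine Real.abs_le_sqrt ?_
  have := LinearMap.BilinForm.apply_mul_apply_le_of_forall_zero_le m h0 x y
  rw [hs y x] at this
  nlinarith

theorem bilin_add_le {m : W →ₗ[ℝ] W →ₗ[ℝ] ℝ} (h0 : ∀ x, 0 ≤ m x x) (x y : W) :
    m (x + y) (x + y) ≤ 2 * m x x + 2 * m y y := by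
  have h1 := h0 (x - y)
  simp only [map_add, map_sub, LinearMap.add_apply, LinearMap.sub_apply] at *
  linarith

theorem young_two {ε x y : ℝ} (hε : 0 < ε) : x * y ≤ ε * x ^ 2 + y ^ 2 / (4 * ε) := by
  have h : ε * x ^ 2 + y ^ 2 / (4 * ε) - x * y = (2 * ε * x - y) ^ 2 / (4 * ε) := by
    field_simp
    ring
  have : 0 ≤ (2 * ε * x - y) ^ 2 / (4 * ε) := by positivity
  linarith

set_option maxHeartbeats 800000 in
/-- One step of the predictor. -/
theorem predictor_step {m A : W →ₗ[ℝ] W →ₗ[ℝ] ℝ} {N : W → W → ℝ} {c M r : ℝ}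
    (hc : 1 ≤ c) (hM : 0 ≤ M) (hr : 0 ≤ r)
    (ms : ∀ x y, m x y = m y x) (m0 : ∀ x, 0 ≤ m x x) (A0 : ∀ x, 0 ≤ A x x)
    (hco : ∀ x, ‖x‖ ^ 2 ≤ c * (m x x + A x x))
    (hN : ∀ x y z, |N x z - N y z| ≤ c * (1 + ‖x‖ + ‖y‖) * ‖x - y‖ * √(√(m z z) * ‖z‖)) :
    ∃ C ≥ (0 : ℝ), ∀ (Δt ϖ η μ F : ℝ) (X₀ X₁ e₀ e₁ w : W), 0 ≤ Δt → w = η • (X₀ + e₀) →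
      |1 - η| ≤ 1 → ‖e₀‖ ≤ r → ‖X₀‖ ≤ M → ‖X₁‖ ≤ M → ‖X₁ - X₀‖ ≤ ϖ →
      |m (X₁ - X₀) e₁ - Δt * μ| ≤ Δt * ϖ * ‖e₁‖ →
      m (X₁ + e₁ - (X₀ + e₀)) e₁ + Δt * (A (X₁ + e₁) e₁ + N w e₁) = Δt * F →
      μ + A X₁ e₁ + N X₁ e₁ = F →
      m e₁ e₁ + Δt * A e₁ e₁ ≤ m e₀ e₀ + 1 / 2 * Δt * A e₀ e₀
        + C * Δt * (m e₁ e₁ + m e₀ e₀ + ϖ ^ 2 + |1 - η| ^ 2) := by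
  -- After doubling, the square ‖e₀‖² appears with weight 24 ε and ‖e₁‖² with weight 4 ε. Coercivity
  -- with ε c = 1/48 turns these into half of A e₀ e₀ and a twelfth of A e₁ e₁, besides mass terms.
  set ε : ℝ := 1 / (48 * c) with hε
  have hε0 : 0 < ε := by positivity
  have hεc : ε * c = 1 / 48 := by rw [hε]; field_simp
  -- Since |η| ≤ 2, the correction w has norm at most 2 (M + r); `κ` is then the Lipschitz constant
  -- of N on the relevant ball.
  set κ : ℝ := c * (1 + 2 * (M + r) + M) with hκ
  have hκ0 : 0 ≤ κ := by positivity
  set κ' : ℝ := (κ ^ 2 / (4 * ε)) ^ 2 / (4 * ε) with hκ'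
  have hκ'0 : 0 ≤ κ' := by positivity
  refine ⟨2 * κ' + 2 * (1 / (4 * ε)) + 6 * ε * M ^ 2 + 6 * ε + 1, by positivity, ?_⟩
  intro Δt ϖ η μ F X₀ X₁ e₀ e₁ w hΔ hw hη he hX₀ hX₁ hX htr hsch hex
  have hϖ : 0 ≤ ϖ := (norm_nonneg _).trans hX
  clear_value ε κ κ'
  set θ := |1 - η| with hθ
  have hθ0 : 0 ≤ θ := abs_nonneg _
  have hη2 : |η| ≤ 2 := by
    have := abs_le.1 hη
    rw [abs_le]; constructor <;> linarith
  have hwn : ‖w‖ ≤ 2 * (M + r) := by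
    rw [hw, norm_smul, Real.norm_eq_abs]
    have := norm_add_le X₀ e₀
    gcongr
    linarith
  -- Three sources of deviation: the previous error, the relaxation factor, and the lag of one time
  -- step.
  have hd : ‖w - X₁‖ ≤ 2 * ‖e₀‖ + θ * M + ϖ := by
    have e : w - X₁ = η • e₀ - (1 - η) • X₀ - (X₁ - X₀) := by rw [hw]; module
    rw [e]
    calc _ ≤ ‖η • e₀‖ + ‖(1 - η) • X₀‖ + ‖X₁ - X₀‖ :=
          (norm_sub_le _ _).trans (by gcongr; exact norm_sub_le _ _)
      _ ≤ _ := by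
          rw [norm_smul, norm_smul, Real.norm_eq_abs, Real.norm_eq_abs]
          gcongr
  have hd2 : ‖w - X₁‖ ^ 2 ≤ 12 * ‖e₀‖ ^ 2 + 3 * θ ^ 2 * M ^ 2 + 3 * ϖ ^ 2 := by
    calc ‖w - X₁‖ ^ 2 ≤ (2 * ‖e₀‖ + θ * M + ϖ) ^ 2 := by gcongr
      _ ≤ _ := by
        nlinarith [sq_nonneg (2 * ‖e₀‖ - θ * M), sq_nonneg (2 * ‖e₀‖ - ϖ), sq_nonneg (θ * M - ϖ)]
  set q₁ := m e₁ e₁ with hq₁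
  have hq₁0 : 0 ≤ q₁ := m0 _
  have hs2 : √(√q₁ * ‖e₁‖) ^ 2 = √q₁ * ‖e₁‖ := Real.sq_sqrt (by positivity)
  -- The first use of Young's inequality splits off ‖w - X₁‖² and leaves ‖e₁‖ √q₁; the second splits
  -- this into ε ‖e₁‖² and a multiple of q₁. This works because the test function is not charged its
  -- full H¹ norm.
  have hNd : |N w e₁ - N X₁ e₁| ≤ ε * ‖w - X₁‖ ^ 2 + ε * ‖e₁‖ ^ 2 + κ' * q₁ := by
    calc |N w e₁ - N X₁ e₁| ≤ c * (1 + ‖w‖ + ‖X₁‖) * ‖w - X₁‖ * √(√q₁ * ‖e₁‖) := hN _ _ _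
      _ ≤ κ * ‖w - X₁‖ * √(√q₁ * ‖e₁‖) := by
          rw [hκ]
          gcongr
      _ = ‖w - X₁‖ * (κ * √(√q₁ * ‖e₁‖)) := by ring
      _ ≤ ε * ‖w - X₁‖ ^ 2 + (κ * √(√q₁ * ‖e₁‖)) ^ 2 / (4 * ε) := young_two hε0
      _ = ε * ‖w - X₁‖ ^ 2 + ‖e₁‖ * ((κ ^ 2 / (4 * ε)) * √q₁) := by
          rw [mul_pow, hs2]; ring
      _ ≤ ε * ‖w - X₁‖ ^ 2 + (ε * ‖e₁‖ ^ 2 + ((κ ^ 2 / (4 * ε)) * √q₁) ^ 2 / (4 * ε)) := by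
          gcongr
          exact young_two hε0
      _ = _ := by rw [mul_pow, Real.sq_sqrt hq₁0, hκ']; ring
  have htr' : ϖ * ‖e₁‖ ≤ ε * ‖e₁‖ ^ 2 + 1 / (4 * ε) * ϖ ^ 2 := by
    rw [mul_comm ϖ]
    refine (young_two hε0).trans (le_of_eq ?_)
    ring
  have hmm : 1 / 2 * q₁ - 1 / 2 * m e₀ e₀ ≤ m (e₁ - e₀) e₁ := by
    have h1 := m0 (e₁ - e₀)
    have h2 := ms e₀ e₁
    simp only [map_sub, LinearMap.sub_apply] at *
    linarith
  -- The error equation: the scheme minus the exact equation, both tested with e₁, so that the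
  -- forces cancel.
  have hid : m (e₁ - e₀) e₁ + (m (X₁ - X₀) e₁ - Δt * μ)
      + Δt * (A e₁ e₁ + (N w e₁ - N X₁ e₁)) = 0 := by
    have h1 : m (X₁ + e₁ - (X₀ + e₀)) e₁ = m (X₁ - X₀) e₁ + m (e₁ - e₀) e₁ := by
      simp only [map_add, map_sub, LinearMap.add_apply, LinearMap.sub_apply]; ring
    have h2 : A (X₁ + e₁) e₁ = A X₁ e₁ + A e₁ e₁ := by simp
    rw [h1, h2, ← hex] at hsch
    linarith
  have hco₁ := hco e₁
  have hco₀ := hco e₀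
  have g1 : ε * ‖e₁‖ ^ 2 ≤ 1 / 48 * (q₁ + A e₁ e₁) := by
    calc ε * ‖e₁‖ ^ 2 ≤ ε * (c * (q₁ + A e₁ e₁)) := by gcongr
      _ = _ := by rw [← mul_assoc, hεc]
  have g0 : ε * ‖e₀‖ ^ 2 ≤ 1 / 48 * (m e₀ e₀ + A e₀ e₀) := by
    calc ε * ‖e₀‖ ^ 2 ≤ ε * (c * (m e₀ e₀ + A e₀ e₀)) := by gcongr
      _ = _ := by rw [← mul_assoc, hεc]
  have gd : ε * ‖w - X₁‖ ^ 2 ≤ ε * (12 * ‖e₀‖ ^ 2 + 3 * θ ^ 2 * M ^ 2 + 3 * ϖ ^ 2) := by gcongr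
  have hmain : q₁ + 2 * (Δt * A e₁ e₁) ≤ m e₀ e₀ + 2 * (Δt * (ϖ * ‖e₁‖
      + (ε * ‖w - X₁‖ ^ 2 + ε * ‖e₁‖ ^ 2 + κ' * q₁))) := by
    have h1 := (abs_le.1 htr).1
    have h2 := mul_le_mul_of_nonneg_left (neg_le_of_abs_le hNd) hΔ
    linarith
  have hA1 := A0 e₁
  have hA0 := A0 e₀
  have hq0 := m0 e₀
  have hin : 2 * (ϖ * ‖e₁‖ + (ε * ‖w - X₁‖ ^ 2 + ε * ‖e₁‖ ^ 2 + κ' * q₁)) ≤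
      A e₁ e₁ + 1 / 2 * A e₀ e₀ + (2 * κ' + 2 * (1 / (4 * ε)) + 6 * ε * M ^ 2 + 6 * ε + 1)
        * (q₁ + m e₀ e₀ + ϖ ^ 2 + θ ^ 2) := by
    have p1 : 0 ≤ 1 / (4 * ε) := by positivity
    have p2 : 0 ≤ ε * M ^ 2 := by positivity
    have p3 := sq_nonneg ϖ
    have p4 := sq_nonneg θ
    have k1 : 0 ≤ κ' * (m e₀ e₀ + ϖ ^ 2 + θ ^ 2) := by positivity
    have k2 : 0 ≤ 1 / (4 * ε) * (q₁ + m e₀ e₀ + θ ^ 2) := by positivity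
    have k3 : 0 ≤ ε * M ^ 2 * (q₁ + m e₀ e₀ + ϖ ^ 2) := by positivity
    have k4 : 0 ≤ ε * (q₁ + m e₀ e₀ + θ ^ 2) := by positivity
    linarith
  have := mul_le_mul_of_nonneg_left hin hΔ
  linarith

set_option maxHeartbeats 800000 in
/-- One step of the energy correction. -/
theorem corrector_step {m A : W →ₗ[ℝ] W →ₗ[ℝ] ℝ} {c M r c₀ : ℝ}
    (hc : 1 ≤ c) (hM : 0 ≤ M) (hr : 0 ≤ r) (hc₀ : 0 < c₀)
    (ms : ∀ x y, m x y = m y x) (m0 : ∀ x, 0 ≤ m x x) (As : ∀ x y, A x y = A y x)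
    (A0 : ∀ x, 0 ≤ A x x)
    (hm : ∀ x y, |m x y| ≤ c * ‖x‖ * ‖y‖) (hA : ∀ x y, |A x y| ≤ c * ‖x‖ * ‖y‖)
    (hco : ∀ x, ‖x‖ ^ 2 ≤ c * (m x x + A x x)) :
    ∃ C ≥ (0 : ℝ), ∀ (Δt ϖ ξ E₀ E₁ μ : ℝ) (X₀ X₁ e₁ : W), 0 < Δt →
      ‖e₁‖ ≤ r → ‖X₁‖ ≤ M → ‖X₁ - X₀‖ ≤ ϖ → c₀ ≤ m X₁ X₁ → 0 < E₀ →
      c₀ / 2 ≤ m (X₁ + e₁) (X₁ + e₁) →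
      |m (X₁ - X₀) X₁ - Δt * μ| ≤ Δt * ϖ * ‖X₁‖ → μ + A X₁ X₁ = 0 →
      E₁ = ξ * (1 / 2 * m (X₁ + e₁) (X₁ + e₁)) →
      (E₁ - E₀) / Δt = -(ξ * A (X₁ + e₁) (X₁ + e₁)) →
      |E₁ - 1 / 2 * m X₁ X₁| ≤ |E₀ - 1 / 2 * m X₀ X₀|
        + C * (Δt * √(m e₁ e₁ + A e₁ e₁) + Δt * ϖ + ϖ ^ 2) ∧
      |1 - √ξ| ≤ C * (|E₁ - 1 / 2 * m X₁ X₁| + √(m e₁ e₁)) := by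
  set κ : ℝ := c * (2 * M + r) with hκ
  have hκ0 : 0 ≤ κ := by positivity
  set κ₁ : ℝ := (c * M * M * κ + c * M * M * κ) / (c₀ / 4) * c with hκ₁
  have hκ₁0 : 0 ≤ κ₁ := by positivity
  set κ₂ : ℝ := (4 / c₀) * (1 + c * M + c * r) with hκ₂
  have hκ₂0 : 0 ≤ κ₂ := by positivity
  refine ⟨κ₁ + M + c + κ₂, by positivity, ?_⟩
  intro Δt ϖ ξ E₀ E₁ μ X₀ X₁ e₁ hΔ he hX₁ hX hE hE₀ hE₁ htr hex hξ hrel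
  have hϖ : 0 ≤ ϖ := (norm_nonneg _).trans hX
  set Ew := 1 / 2 * m (X₁ + e₁) (X₁ + e₁) with hEw
  set Ex := 1 / 2 * m X₁ X₁ with hEx
  set Aw := A (X₁ + e₁) (X₁ + e₁) with hAw
  clear_value κ κ₁ κ₂ Ew Ex Aw
  have hEw0 : c₀ / 4 ≤ Ew := by rw [hEw]; linarith
  have hEwp : 0 < Ew := by linarith
  have hAw0 : 0 ≤ Aw := hAw ▸ A0 _
  have hE1 : E₁ - E₀ = -(Δt * (ξ * Aw)) := by
    rw [div_eq_iff hΔ.ne'] at hrel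
    rw [hrel]; ring
  -- The two scalar relations give ξ (Ew + Δt Aw) = E₀, so the positive energy of the previous level
  -- makes ξ positive.
  have hξp : 0 < ξ := by
    have h : ξ * (Ew + Δt * Aw) = E₀ := by rw [hξ] at hE1; linarith
    by_contra hn
    have h1 : 0 < Ew + Δt * Aw := by positivity
    nlinarith [mul_nonneg (sub_nonneg.2 (not_lt.1 hn)) h1.le]
  have hsq : ∀ {B : W →ₗ[ℝ] W →ₗ[ℝ] ℝ}, (∀ x y, B x y = B y x) →
      (∀ x y, |B x y| ≤ c * ‖x‖ * ‖y‖) → |B (X₁ + e₁) (X₁ + e₁) - B X₁ X₁| ≤ κ * ‖e₁‖ := by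
    intro B Bs hB
    have e : B (X₁ + e₁) (X₁ + e₁) - B X₁ X₁ = 2 * B X₁ e₁ + B e₁ e₁ := by
      have := Bs e₁ X₁
      simp only [map_add, LinearMap.add_apply]
      linarith
    rw [e]
    have h1 : |B X₁ e₁| ≤ c * M * ‖e₁‖ := (hB _ _).trans (by gcongr)
    have h2 : |B e₁ e₁| ≤ c * r * ‖e₁‖ := (hB _ _).trans (by gcongr)
    calc _ ≤ |2 * B X₁ e₁| + |B e₁ e₁| := abs_add_le _ _
      _ = 2 * |B X₁ e₁| + |B e₁ e₁| := by rw [abs_mul, abs_two]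
      _ ≤ _ := by rw [hκ]; linarith
  have hquad : ∀ {B : W →ₗ[ℝ] W →ₗ[ℝ] ℝ}, (∀ x y, |B x y| ≤ c * ‖x‖ * ‖y‖) →
      |B X₁ X₁| ≤ c * M * M := fun hB => (hB _ _).trans (by gcongr)
  have hed : |Ew - Ex| ≤ κ * ‖e₁‖ := by
    have h := hsq ms hm
    have e : Ew - Ex = 1 / 2 * (m (X₁ + e₁) (X₁ + e₁) - m X₁ X₁) := by rw [hEw, hEx]; ring
    rw [e, abs_mul, abs_of_pos (by norm_num : (0 : ℝ) < 1 / 2)]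
    have := abs_nonneg (m (X₁ + e₁) (X₁ + e₁) - m X₁ X₁)
    linarith
  have hE0 : |Ex| ≤ c * M * M := by
    have h := hquad hm
    rw [hEx, abs_mul, abs_of_pos (by norm_num : (0 : ℝ) < 1 / 2)]
    have := abs_nonneg (m X₁ X₁)
    linarith
  have hes : ‖e₁‖ ≤ c * √(m e₁ e₁ + A e₁ e₁) := by
    have h0 : 0 ≤ m e₁ e₁ + A e₁ e₁ := add_nonneg (m0 _) (A0 _)
    refine abs_le_of_sq_le_sq' ?_ (by positivity) |>.2
    rw [mul_pow, Real.sq_sqrt h0]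
    refine (hco e₁).trans ?_
    gcongr
    nlinarith
  constructor
  -- `R` is the defect of the exact values in the backward Euler form of the energy law. Its
  -- quadratic part comes from expanding the energy of X₀ around X₁.
  · set R := Ex - 1 / 2 * m X₀ X₀ + Δt * A X₁ X₁ with hR
    have hRb : |R| ≤ Δt * ϖ * M + c * ϖ ^ 2 := by
      have e : R = (m (X₁ - X₀) X₁ - Δt * μ) - 1 / 2 * m (X₁ - X₀) (X₁ - X₀) := by
        have h1 := ms X₀ X₁
        have h2 : A X₁ X₁ = -μ := by linarith
        rw [hR, hEx, h2]
        simp only [map_sub, LinearMap.sub_apply]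
        linarith
      rw [e]
      have h1 : |m (X₁ - X₀) (X₁ - X₀)| ≤ c * ϖ ^ 2 := by
        refine (hm _ _).trans ?_
        rw [mul_assoc, ← sq]
        gcongr
      have h2 : |m (X₁ - X₀) X₁ - Δt * μ| ≤ Δt * ϖ * M := htr.trans (by gcongr)
      refine (abs_sub _ _).trans ?_
      rw [abs_mul, abs_of_pos (by norm_num : (0 : ℝ) < 1 / 2)]
      have := abs_nonneg (m (X₁ - X₀) (X₁ - X₀))
      linarith
    have hξE : ξ = E₁ / Ew := by rw [hξ]; field_simp
    -- With ξ = E₁ / Ew eliminated, the decay rate of the discrete energy is Aw / Ew. `D` is the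
    -- effect of this perturbed rate on the exact energy; it vanishes with e₁ and is linear in its
    -- norm.
    set D := (Ex * Aw - A X₁ X₁ * Ew) / Ew with hD
    have hDb : |D| ≤ κ₁ * √(m e₁ e₁ + A e₁ e₁) := by
      have h1 : |Ex * Aw - A X₁ X₁ * Ew| ≤ (c * M * M * κ + c * M * M * κ) * ‖e₁‖ := by
        have e : Ex * Aw - A X₁ X₁ * Ew = Ex * (Aw - A X₁ X₁) - A X₁ X₁ * (Ew - Ex) := by ring
        rw [e]
        refine (abs_sub _ _).trans ?_
        rw [abs_mul Ex, abs_mul (A X₁ X₁)]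
        have h2 := hsq As hA
        rw [← hAw] at h2
        have h3 := hquad hA
        refine (add_le_add (mul_le_mul hE0 h2 (abs_nonneg _) (by positivity))
                (mul_le_mul h3 hed (abs_nonneg _) (by positivity))).trans (le_of_eq ?_)
        ring
      rw [hD, abs_div, abs_of_pos hEwp]
      calc _ ≤ (c * M * M * κ + c * M * M * κ) * ‖e₁‖ / (c₀ / 4) := by gcongr
        _ ≤ (c * M * M * κ + c * M * M * κ) * (c * √(m e₁ e₁ + A e₁ e₁)) / (c₀ / 4) := by gcongr
        _ = _ := by rw [hκ₁]; ring
    clear_value D R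
    have hid : (E₁ - Ex) * (1 + Δt * (Aw / Ew)) = (E₀ - 1 / 2 * m X₀ X₀) - Δt * D - R := by
      have h1 : ξ * Aw = (E₁ - Ex) * (Aw / Ew) + Ex * (Aw / Ew) := by rw [hξE]; ring
      have h2 : D = Ex * (Aw / Ew) - A X₁ X₁ := by rw [hD]; field_simp
      rw [h1] at hE1
      rw [h2, hR]
      linarith
    -- The implicit factor is at least one and can be dropped, so the energy error is not amplified
    -- from one step to the next.
    have hfac : 1 ≤ 1 + Δt * (Aw / Ew) := by
      have : 0 ≤ Δt * (Aw / Ew) := by positivity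
      linarith
    calc |E₁ - Ex| ≤ |E₁ - Ex| * (1 + Δt * (Aw / Ew)) :=
          le_mul_of_one_le_right (abs_nonneg _) hfac
      _ = |(E₁ - Ex) * (1 + Δt * (Aw / Ew))| := by
          rw [abs_mul, abs_of_pos (by linarith : 0 < 1 + Δt * (Aw / Ew))]
      _ = |(E₀ - 1 / 2 * m X₀ X₀) - Δt * D - R| := by rw [hid]
      _ ≤ |E₀ - 1 / 2 * m X₀ X₀| + Δt * |D| + |R| := by
          refine (abs_sub _ _).trans ?_
          gcongr
          refine (abs_sub _ _).trans ?_
          rw [abs_mul, abs_of_pos hΔ]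
      _ ≤ |E₀ - 1 / 2 * m X₀ X₀| + Δt * (κ₁ * √(m e₁ e₁ + A e₁ e₁))
          + (Δt * ϖ * M + c * ϖ ^ 2) := by gcongr
      _ ≤ _ := by
          have s0 : 0 ≤ √(m e₁ e₁ + A e₁ e₁) := Real.sqrt_nonneg _
          have k1 : 0 ≤ (M + c + κ₂) * (Δt * √(m e₁ e₁ + A e₁ e₁)) := by positivity
          have k2 : 0 ≤ (κ₁ + c + κ₂) * (Δt * ϖ) := by positivity
          have k3 : 0 ≤ (κ₁ + M + κ₂) * ϖ ^ 2 := by positivity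
          linarith
  · have h1 : |1 - √ξ| ≤ |1 - ξ| := by
      have hs := Real.sq_sqrt hξp.le
      have hs0 := Real.sqrt_nonneg ξ
      have e : 1 - ξ = (1 - √ξ) * (1 + √ξ) := by linear_combination hs
      rw [e, abs_mul, abs_of_pos (by linarith : 0 < 1 + √ξ)]
      exact le_mul_of_one_le_right (abs_nonneg _) (by linarith)
    have h2 : 1 - ξ = ((Ew - Ex) - (E₁ - Ex)) / Ew := by rw [hξ]; field_simp; ring
    -- Unlike `hed`, this must use √(m e₁ e₁) and not the H¹ norm: the relaxation error returns to
    -- the predictor with a constant that is not small, and a dissipation term there could not be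
    -- absorbed.
    have h3 : |Ew - Ex| ≤ (c * M + c * r) * √(m e₁ e₁) := by
      have e : Ew - Ex = m X₁ e₁ + 1 / 2 * m e₁ e₁ := by
        have := ms e₁ X₁
        rw [hEw, hEx]
        simp only [map_add, LinearMap.add_apply]
        linarith
      have hb : ∀ y, m y y ≤ (c * ‖y‖) ^ 2 := fun y => by
        refine (le_abs_self _).trans ((hm _ _).trans ?_)
        have := norm_nonneg y
        rw [sq]
        gcongr
        exact le_mul_of_one_le_left this hc
      have hs : ∀ y, √(m y y) ≤ c * ‖y‖ := fun y => by
        rw [← Real.sqrt_sq (by positivity : 0 ≤ c * ‖y‖)]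
        exact Real.sqrt_le_sqrt (hb y)
      have k1 : |m X₁ e₁| ≤ c * M * √(m e₁ e₁) := by
        refine (bilin_sq_le ms m0 _ _).trans ?_
        gcongr
        exact (hs _).trans (by gcongr)
      have k2 : m e₁ e₁ ≤ c * r * √(m e₁ e₁) := by
        nth_rewrite 1 [← Real.mul_self_sqrt (m0 e₁)]
        gcongr
        exact (hs _).trans (by gcongr)
      rw [e]
      refine (abs_add_le _ _).trans ?_
      rw [abs_of_nonneg (by have := m0 e₁; positivity : 0 ≤ 1 / 2 * m e₁ e₁)]
      linarith [m0 e₁]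
    refine h1.trans ?_
    rw [h2, abs_div, abs_of_pos hEwp]
    have s0 : 0 ≤ √(m e₁ e₁) := Real.sqrt_nonneg _
    have b0 := abs_nonneg (E₁ - Ex)
    calc |(Ew - Ex) - (E₁ - Ex)| / Ew ≤ (|Ew - Ex| + |E₁ - Ex|) / (c₀ / 4) := by
          gcongr
          exact abs_sub _ _
      _ ≤ ((c * M + c * r) * √(m e₁ e₁) + |E₁ - Ex|) / (c₀ / 4) := by gcongr
      _ = (4 / c₀) * ((c * M + c * r) * √(m e₁ e₁) + |E₁ - Ex|) := by field_simp
      _ ≤ (4 / c₀) * ((1 + c * M + c * r) * (|E₁ - Ex| + √(m e₁ e₁))) := by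
          gcongr
          have : 0 ≤ (c * M + c * r) * |E₁ - Ex| := by positivity
          nlinarith
      _ = κ₂ * (|E₁ - Ex| + √(m e₁ e₁)) := by rw [hκ₂]; ring
      _ ≤ _ := by gcongr; linarith

end AbstractScheme

end NSD

namespace NSD

/-! ### Convergence of the abstract scheme: predictor, corrector and bootstrap combined -/

section AbstractScheme

variable {W : Type*} [NormedAddCommGroup W] [NormedSpace ℝ W]

/-- First-order convergence of the prediction–correction scheme, for a sequence `X` of exact
values, predictions `X + e` and corrections `w`. -/
theorem abstract_scheme_error {m A : W →ₗ[ℝ] W →ₗ[ℝ] ℝ} {N : W → W → ℝ} {c M c₀ T Ω : ℝ}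
    (hc : 1 ≤ c) (hM : 0 ≤ M) (hc₀ : 0 < c₀) (hT : 0 < T) (hΩ : 0 ≤ Ω)
    (ms : ∀ x y, m x y = m y x) (m0 : ∀ x, 0 ≤ m x x) (As : ∀ x y, A x y = A y x)
    (A0 : ∀ x, 0 ≤ A x x)
    (hm : ∀ x y, |m x y| ≤ c * ‖x‖ * ‖y‖) (hA : ∀ x y, |A x y| ≤ c * ‖x‖ * ‖y‖)
    (hco : ∀ x, ‖x‖ ^ 2 ≤ c * (m x x + A x x))
    (hN : ∀ x y z, |N x z - N y z| ≤ c * (1 + ‖x‖ + ‖y‖) * ‖x - y‖ * √(√(m z z) * ‖z‖)) :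
    ∃ C > (0 : ℝ), ∃ δ > (0 : ℝ), ∀ Δt : ℝ, 0 < Δt → Δt ≤ δ → ∀ K : ℕ, K * Δt ≤ T →
      ∀ (X e w : ℕ → W) (η ξ E ϖ : ℕ → ℝ) (μ F : ℕ → W → ℝ),
      (∀ j ≤ K, ‖X j‖ ≤ M) → (∀ j ≤ K, c₀ ≤ m (X j) (X j)) →
      (∀ j, 0 ≤ ϖ j) → ∑ j ∈ Finset.range K, ϖ j ≤ Ω → ∑ j ∈ Finset.range K, ϖ j ^ 2 ≤ Ω * Δt →
      (∀ j < K, ‖X (j + 1) - X j‖ ≤ ϖ j) →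
      (∀ j < K, ∀ z, |m (X (j + 1) - X j) z - Δt * μ j z| ≤ Δt * ϖ j * ‖z‖) →
      (∀ j < K, μ j (e (j + 1)) + A (X (j + 1)) (e (j + 1)) + N (X (j + 1)) (e (j + 1))
        = F j (e (j + 1))) →
      (∀ j < K, μ j (X (j + 1)) + A (X (j + 1)) (X (j + 1)) = 0) →
      (∀ j < K, m (X (j + 1) + e (j + 1) - (X j + e j)) (e (j + 1))
        + Δt * (A (X (j + 1) + e (j + 1)) (e (j + 1)) + N (w j) (e (j + 1)))
        = Δt * F j (e (j + 1))) →
      e 0 = 0 → η 0 = 1 → E 0 = 1 / 2 * m (X 0) (X 0) →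
      (∀ j ≤ K, w j = η j • (X j + e j)) → (∀ j < K, η (j + 1) = √(ξ (j + 1))) →
      (∀ j < K, E (j + 1) = ξ (j + 1)
        * (1 / 2 * m (X (j + 1) + e (j + 1)) (X (j + 1) + e (j + 1)))) →
      (∀ j < K, (E (j + 1) - E j) / Δt
        = -(ξ (j + 1) * A (X (j + 1) + e (j + 1)) (X (j + 1) + e (j + 1)))) →
      ∀ j ≤ K, √(m (e j) (e j)) ≤ C * Δt ∧ |E j - 1 / 2 * m (X j) (X j)| ≤ C * Δt ∧
        √(m (w j - X j) (w j - X j)) ≤ C * Δt := by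
  -- ρ ≤ 1 and c ≥ 1 give ‖e‖ ≤ c, so r = c serves in the step lemmas. ρ ≤ c₀ / 4 keeps the discrete
  -- energy positive. The last bound gives |m(X, e)| ≤ c₀ / 4, so that m(X + e, X + e) ≥ c₀ / 2.
  set ρ : ℝ := min (min 1 (c₀ / 4)) ((c₀ / (4 * (c * M + 1) * c)) ^ 2 / c) with hρ
  have hρ0 : 0 < ρ := by positivity
  have hρ1 : ρ ≤ 1 := (min_le_left _ _).trans (min_le_left _ _)
  have hρc : ρ ≤ c₀ / 4 := (min_le_left _ _).trans (min_le_right _ _)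
  have hρd : ρ ≤ (c₀ / (4 * (c * M + 1) * c)) ^ 2 / c := min_le_right _ _
  obtain ⟨Cp, hCp, Hp⟩ := predictor_step hc hM (zero_le_one.trans hc) ms m0 A0 hco hN
  obtain ⟨Cc, hCc, Hc⟩ := corrector_step hc hM (zero_le_one.trans hc) hc₀ ms m0 As A0 hm hA hco
  obtain ⟨C, hC, δ, hδ, H⟩ := bootstrap (c := Cp + Cc) (by positivity) hT hΩ hρ0
  have hCM : 0 ≤ √(8 * C ^ 2 + 2 * (C ^ 2 * (c * M * M))) := Real.sqrt_nonneg _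
  refine ⟨C + √(8 * C ^ 2 + 2 * (C ^ 2 * (c * M * M))), by positivity,
    min δ (1 / C), by positivity, ?_⟩
  intro Δt hΔ hδ' K hK X e w η ξ E ϖ μ F hXM hXE hϖ hϖ1 hϖ2 hXX htr hex hen hsch he0 hη0 hE0 hw hηξ
    hEξ hrel
  rw [le_min_iff] at hδ'
  have hsmallnorm : ∀ x, m x x + A x x ≤ ρ → ‖x‖ ≤ c ∧ ‖x‖ ≤ c₀ / (4 * (c * M + 1) * c) := by
    intro x hx
    have h1 := hco x
    constructor
    · refine abs_le_of_sq_le_sq' ?_ (by positivity) |>.2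
      nlinarith [mul_le_mul_of_nonneg_left (hx.trans hρ1) (zero_le_one.trans hc)]
    · refine abs_le_of_sq_le_sq' ?_ (by positivity) |>.2
      refine h1.trans ?_
      have := hx.trans hρd
      rw [le_div_iff₀ (by positivity)] at this
      linarith
  have hcorr : ∀ j < K, |E j - 1 / 2 * m (X j) (X j)| ≤ ρ →
      m (e (j + 1)) (e (j + 1)) + A (e (j + 1)) (e (j + 1)) ≤ ρ →
      |E (j + 1) - 1 / 2 * m (X (j + 1)) (X (j + 1))| ≤ |E j - 1 / 2 * m (X j) (X j)|
        + Cc * (Δt * √(m (e (j + 1)) (e (j + 1)) + A (e (j + 1)) (e (j + 1)))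
          + Δt * ϖ j + ϖ j ^ 2) ∧
      |1 - √(ξ (j + 1))| ≤ Cc * (|E (j + 1) - 1 / 2 * m (X (j + 1)) (X (j + 1))|
        + √(m (e (j + 1)) (e (j + 1)))) := by
    intro j hj hb hq
    obtain ⟨h1, h2⟩ := hsmallnorm _ hq
    have hE1 := hXE (j + 1) hj
    refine Hc Δt (ϖ j) (ξ (j + 1)) (E j) (E (j + 1)) (μ j (X (j + 1))) (X j) (X (j + 1)) (e (j + 1))
      hΔ h1 (hXM _ hj) (hXX j hj) hE1 ?_ ?_ (htr j hj _) (hen j hj) (hEξ j hj) (hrel j hj)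
    · have h3 := hXE j hj.le
      have h4 := (abs_le.1 hb).1
      linarith
    · have e1 : m (X (j + 1) + e (j + 1)) (X (j + 1) + e (j + 1))
          = m (X (j + 1)) (X (j + 1)) + 2 * m (X (j + 1)) (e (j + 1))
            + m (e (j + 1)) (e (j + 1)) := by
        have := ms (e (j + 1)) (X (j + 1))
        simp only [map_add, LinearMap.add_apply]
        linarith
      have h3 : |m (X (j + 1)) (e (j + 1))| ≤ c₀ / 4 := by
        refine (hm _ _).trans ?_
        calc c * ‖X (j + 1)‖ * ‖e (j + 1)‖ ≤ c * M * (c₀ / (4 * (c * M + 1) * c)) := by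
              gcongr
              exact hXM _ hj
          _ ≤ ((c * M + 1) * c) * (c₀ / (4 * (c * M + 1) * c)) := by
              refine mul_le_mul_of_nonneg_right ?_ (by positivity)
              nlinarith [mul_nonneg (sub_nonneg.2 hc) (mul_nonneg (zero_le_one.trans hc) hM)]
          _ = c₀ / 4 := by field_simp
      have h4 := (abs_le.1 h3).1
      have h5 := m0 (e (j + 1))
      rw [e1]
      linarith
  have hη1 : ∀ j < K, |1 - η (j + 1)| = |1 - √(ξ (j + 1))| := fun j hj => by rw [hηξ j hj]
  have main := H Δt hΔ hδ'.1 K hK (fun j => m (e j) (e j)) (fun j => A (e j) (e j))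
    (fun j => |E j - 1 / 2 * m (X j) (X j)|) (fun j => |1 - η j|) ϖ (fun j => m0 _)
    (fun j => A0 _) (fun j => abs_nonneg _) (fun j => abs_nonneg _) hϖ (by simp [he0])
    (by simp [he0]) (by simp [hE0]) (by simp [hη0]) hϖ1 hϖ2 ?_ ?_ ?_
  · intro j hj
    obtain ⟨h1, h2, h3⟩ := main j hj
    refine ⟨h1.trans ?_, h2.trans ?_, ?_⟩
    · gcongr; linarith
    · gcongr; linarith
    · have hθ1 : |1 - η j| ≤ 1 := by
        refine h3.trans ?_
        have := hδ'.2
        rw [le_div_iff₀ hC] at this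
        linarith
      have hη2 : |η j| ≤ 2 := by
        have := abs_le.1 hθ1
        rw [abs_le]; constructor <;> linarith
      -- The correction differs from the exact value by the scaled prediction error and by the
      -- relaxation error times X, both of first order.
      have e1 : w j - X j = η j • e j + (η j - 1) • X j := by rw [hw j hj]; module
      have h4 : m (w j - X j) (w j - X j)
          ≤ (8 * C ^ 2 + 2 * (C ^ 2 * (c * M * M))) * Δt ^ 2 := by
        rw [e1]
        refine (bilin_add_le m0 _ _).trans ?_
        simp only [map_smul, LinearMap.smul_apply, smul_eq_mul]
        have k1 : m (e j) (e j) ≤ (C * Δt) ^ 2 := by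
          rw [← Real.sq_sqrt (m0 (e j))]
          gcongr
        have k2 : m (X j) (X j) ≤ c * M * M :=
          (le_abs_self _).trans ((hm _ _).trans (by gcongr <;> exact hXM j hj))
        have k3 : η j * η j ≤ 4 := by
          rw [← abs_mul_abs_self]
          nlinarith [abs_nonneg (η j)]
        have k4 : (η j - 1) * (η j - 1) ≤ (C * Δt) ^ 2 := by
          rw [← abs_mul_abs_self, abs_sub_comm, ← sq]
          gcongr
        have l1 : (η j * η j) * m (e j) (e j) ≤ 4 * (C * Δt) ^ 2 :=
          mul_le_mul k3 k1 (m0 _) (by norm_num)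
        have l2 : ((η j - 1) * (η j - 1)) * m (X j) (X j) ≤ (C * Δt) ^ 2 * (c * M * M) :=
          mul_le_mul k4 k2 (m0 _) (by positivity)
        linarith
      calc √(m (w j - X j) (w j - X j))
          ≤ √((8 * C ^ 2 + 2 * (C ^ 2 * (c * M * M))) * Δt ^ 2) := Real.sqrt_le_sqrt h4
        _ = √(8 * C ^ 2 + 2 * (C ^ 2 * (c * M * M))) * Δt := by
            rw [Real.sqrt_mul (by positivity), Real.sqrt_sq hΔ.le]
        _ ≤ _ := by gcongr; linarith
  · intro j hj hq hθ
    refine (Hp Δt (ϖ j) (η j) (μ j (e (j + 1))) (F j (e (j + 1))) (X j) (X (j + 1)) (e j)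
      (e (j + 1)) (w j) hΔ.le (hw j hj.le) hθ (hsmallnorm _ hq).1 (hXM _ hj.le) (hXM _ hj)
      (hXX j hj) (htr j hj _) (hsch j hj) (hex j hj)).trans ?_
    have := m0 (e j)
    have := m0 (e (j + 1))
    gcongr
    linarith
  · intro j hj hb hq
    refine (hcorr j hj hb hq).1.trans ?_
    have := hϖ j
    gcongr
    linarith
  · intro j hj hb hq
    simp only [hη1 j hj]
    refine (hcorr j hj hb hq).2.trans ?_
    gcongr
    linarith

end AbstractScheme

end NSD

noncomputable section

namespace NSD

/-! ### One-dimensional estimates along segments -/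

/-- For every s the fundamental theorem of calculus bounds the value at 0 by |g s| plus the integral
of |g'|; averaging over s in (0, s₀) gives the claim. -/
theorem enorm_le_lintegral_segment {g : ℝ → ℝ} (hg : ContDiff ℝ 1 g) {s₀ : ℝ} (hs : 0 < s₀) :
    ‖g 0‖ₑ ≤ ∫⁻ s in Ioo 0 s₀, (ENNReal.ofReal s₀⁻¹ * ‖g s‖ₑ + ‖deriv g s‖ₑ) := by
  have hgm : Measurable fun s => ‖g s‖ₑ := hg.continuous.measurable.enorm
  have h1 : ∀ s ∈ Ioo 0 s₀, ‖g 0‖ₑ ≤ ‖g s‖ₑ + ∫⁻ τ in Ioo 0 s₀, ‖deriv g τ‖ₑ := by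
    intro s hs'
    have e : g 0 = g s - ∫ τ in (0 : ℝ)..s, deriv g τ := by
      rw [intervalIntegral.integral_deriv_eq_sub (fun x _ => hg.differentiable (by simp) x)
        ((hg.continuous_deriv (by simp)).intervalIntegrable _ _)]
      ring
    rw [e]
    refine enorm_sub_le.trans ?_
    gcongr
    rw [intervalIntegral.integral_of_le hs'.1.le, integral_Ioc_eq_integral_Ioo]
    refine (enorm_integral_le_lintegral_enorm _).trans ?_
    exact lintegral_mono_set (Ioo_subset_Ioo_right hs'.2.le)
  have h2 : ENNReal.ofReal s₀ * ‖g 0‖ₑ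
      ≤ ∫⁻ s in Ioo 0 s₀, (‖g s‖ₑ + ∫⁻ τ in Ioo 0 s₀, ‖deriv g τ‖ₑ) := by
    calc ENNReal.ofReal s₀ * ‖g 0‖ₑ = ∫⁻ s in Ioo 0 s₀, ‖g 0‖ₑ := by
          rw [setLIntegral_const, Real.volume_Ioo, sub_zero, mul_comm]
      _ ≤ _ := setLIntegral_mono' measurableSet_Ioo h1
  rw [lintegral_add_left hgm, setLIntegral_const, Real.volume_Ioo, sub_zero] at h2
  rw [lintegral_add_left (hgm.const_mul _), lintegral_const_mul _ hgm]
  have h0 : ENNReal.ofReal s₀⁻¹ * ENNReal.ofReal s₀ = 1 := by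
    rw [← ENNReal.ofReal_mul (by positivity), inv_mul_cancel₀ hs.ne', ENNReal.ofReal_one]
  calc ‖g 0‖ₑ = ENNReal.ofReal s₀⁻¹ * (ENNReal.ofReal s₀ * ‖g 0‖ₑ) := by
        rw [← mul_assoc, h0, one_mul]
    _ ≤ _ := mul_le_mul_right h2 _
    _ = _ := by
        rw [mul_add, mul_comm (∫⁻ τ in Ioo 0 s₀, ‖deriv g τ‖ₑ), ← mul_assoc _ (ENNReal.ofReal s₀),
          h0, one_mul]

/-- The density `‖f‖ + ‖Df‖` on `Ω`, extended by zero. -/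
def sobolevDensity (Ω : Set Plane) (f : Plane → ℝ) : Plane → ℝ≥0∞ :=
  Ω.indicator fun z => ‖f z‖ₑ + ‖fderiv ℝ f z‖ₑ

theorem measurable_sobolevDensity {Ω : Set Plane} (hΩ : IsOpen Ω) {f : Plane → ℝ}
    (hf : ContDiff ℝ 1 f) : Measurable (sobolevDensity Ω f) :=
  (hf.continuous.measurable.enorm.add
    (hf.continuous_fderiv (by simp)).measurable.enorm).indicator hΩ.measurableSet

theorem lintegral_sobolevDensity {Ω : Set Plane} (hΩ : IsOpen Ω) (f : Plane → ℝ) :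
    ∫⁻ z, sobolevDensity Ω f z = ∫⁻ z in Ω, (‖f z‖ₑ + ‖fderiv ℝ f z‖ₑ) :=
  lintegral_indicator hΩ.measurableSet _

/-- A function is controlled by the integral of `sobolevDensity` along a line, if a segment of the
line is inside the domain. -/
theorem enorm_le_lintegral_line {Ω : Set Plane} {f : Plane → ℝ} (hf : ContDiff ℝ 1 f)
    {s₀ : ℝ} (hs : 0 < s₀) {y v : Plane} (hy : ∀ s ∈ Ioo 0 s₀, y + s • v ∈ Ω) :
    ‖f y‖ₑ ≤ (ENNReal.ofReal s₀⁻¹ + ‖v‖ₑ) * ∫⁻ s : ℝ, sobolevDensity Ω f (y + s • v) := by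
  have hline : ContDiff ℝ 1 fun s : ℝ => y + s • v := by fun_prop
  have hg : ContDiff ℝ 1 fun s : ℝ => f (y + s • v) := hf.comp hline
  have h1 := enorm_le_lintegral_segment hg hs
  simp only [zero_smul, add_zero] at h1
  have hd : ∀ s, deriv (fun s : ℝ => f (y + s • v)) s = fderiv ℝ f (y + s • v) v := by
    intro s
    have h2 : HasDerivAt (fun s : ℝ => y + s • v) v s := by
      simpa using ((hasDerivAt_id s).smul_const v).const_add y
    exact ((hf.differentiable (by simp) _).hasFDerivAt.comp_hasDerivAt s h2).deriv
  refine h1.trans ?_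
  rw [← lintegral_const_mul' _ _ (by simp)]
  refine (setLIntegral_mono' measurableSet_Ioo (g := fun s => (ENNReal.ofReal s₀⁻¹ + ‖v‖ₑ) *
    sobolevDensity Ω f (y + s • v)) fun s hs' => ?_).trans (setLIntegral_le_lintegral _ _)
  rw [hd, sobolevDensity, indicator_of_mem (hy s hs'), add_mul, mul_add, mul_add]
  have h3 : ‖fderiv ℝ f (y + s • v) v‖ₑ ≤ ‖v‖ₑ * ‖fderiv ℝ f (y + s • v)‖ₑ := by
    rw [mul_comm]
    exact ContinuousLinearMap.le_opENorm _ _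
  calc _ ≤ ENNReal.ofReal s₀⁻¹ * ‖f (y + s • v)‖ₑ + ‖v‖ₑ * ‖fderiv ℝ f (y + s • v)‖ₑ := by gcongr
    _ ≤ _ := add_le_add le_self_add (le_add_self)

/-- Two line integrals in transversal directions. -/
theorem lintegral_two_lines_le (L : (ℝ × ℝ) ≃L[ℝ] Plane) : ∃ κ : ℝ≥0∞, κ ≠ ⊤ ∧
    ∀ F : Plane → ℝ≥0∞, Measurable F →
      ∫⁻ y, (∫⁻ s : ℝ, F (y + s • L (1, 0))) * (∫⁻ s : ℝ, F (y + s • L (0, 1)))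
        ≤ κ * (∫⁻ y, F y) ^ 2 := by
  have hcont : Continuous L := L.continuous
  have : (Measure.map L (volume : Measure (ℝ × ℝ))).IsAddHaarMeasure :=
    L.isAddHaarMeasure_map _
  -- A linear isomorphism carries Lebesgue measure to a Haar measure, hence to a multiple of
  -- Lebesgue measure; skew directions cost only this factor.
  obtain ⟨c, hc0, hcT, hc⟩ : ∃ c : ℝ≥0∞, c ≠ 0 ∧ c ≠ ⊤ ∧
      Measure.map L (volume : Measure (ℝ × ℝ)) = c • (volume : Measure Plane) :=
    ⟨_, ENNReal.coe_ne_zero.2 (Measure.addHaarScalarFactor_pos_of_isAddHaarMeasure _ _).ne',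
      ENNReal.coe_ne_top, Measure.isAddLeftInvariant_eq_smul _ _⟩
  have key : ∀ G : Plane → ℝ≥0∞, Measurable G → ∫⁻ z : ℝ × ℝ, G (L z) = c * ∫⁻ y, G y := by
    intro G hG
    rw [← lintegral_map hG hcont.measurable, hc, lintegral_smul_measure, smul_eq_mul]
  refine ⟨c, hcT, fun F hF => ?_⟩
  have hm : ∀ v : Plane, Measurable fun y => ∫⁻ s : ℝ, F (y + s • v) := fun v =>
    Measurable.lintegral_prod_right' (f := fun p : Plane × ℝ => F (p.1 + p.2 • v))
      (hF.comp (by fun_prop))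
  have h1 := key _ ((hm (L (1, 0))).mul (hm (L (0, 1))))
  have e1 : ∀ a b s : ℝ, L (a, b) + s • L (1, 0) = L (a + s, b) := fun a b s => by
    rw [← map_smul, ← map_add]; simp
  have e2 : ∀ a b s : ℝ, L (a, b) + s • L (0, 1) = L (a, b + s) := fun a b s => by
    rw [← map_smul, ← map_add]; simp
  have hFL : Measurable fun z : ℝ × ℝ => F (L z) := hF.comp hcont.measurable
  have e3 : ∀ a b : ℝ, ∫⁻ s : ℝ, F (L (a, b) + s • L (1, 0)) = ∫⁻ s : ℝ, F (L (s, b)) := by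
    intro a b
    simp only [e1]
    exact lintegral_add_left_eq_self (fun t => F (L (t, b))) a
  have e4 : ∀ a b : ℝ, ∫⁻ s : ℝ, F (L (a, b) + s • L (0, 1)) = ∫⁻ s : ℝ, F (L (a, s)) := by
    intro a b
    simp only [e2]
    exact lintegral_add_left_eq_self (fun t => F (L (a, t))) b
  have hP : Measurable fun b : ℝ => ∫⁻ s : ℝ, F (L (s, b)) :=
    Measurable.lintegral_prod_right' (f := fun p : ℝ × ℝ => F (L (p.2, p.1)))
      (hFL.comp measurable_swap)
  have hQ : Measurable fun a : ℝ => ∫⁻ s : ℝ, F (L (a, s)) :=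
    Measurable.lintegral_prod_right' (f := fun p : ℝ × ℝ => F (L (p.1, p.2))) hFL
  have i1 : ∫⁻ b : ℝ, ∫⁻ s : ℝ, F (L (s, b)) = c * ∫⁻ y, F y := by
    rw [← key F hF, Measure.volume_eq_prod, lintegral_prod_symm' _ hFL]
  have i2 : ∫⁻ a : ℝ, ∫⁻ s : ℝ, F (L (a, s)) = c * ∫⁻ y, F y := by
    rw [← key F hF, Measure.volume_eq_prod, lintegral_prod _ hFL.aemeasurable]
  -- In the coordinates (a, b) the first line integral depends on b alone and the second on a alone,
  -- so the double integral factorizes.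
  have h2 : ∫⁻ z : ℝ × ℝ, (∫⁻ s : ℝ, F (L z + s • L (1, 0))) * (∫⁻ s : ℝ, F (L z + s • L (0, 1)))
      = (c * ∫⁻ y, F y) * (c * ∫⁻ y, F y) := by
    have : ∀ z : ℝ × ℝ, (∫⁻ s : ℝ, F (L z + s • L (1, 0))) * (∫⁻ s : ℝ, F (L z + s • L (0, 1)))
        = (∫⁻ s : ℝ, F (L (z.1, s))) * ∫⁻ s : ℝ, F (L (s, z.2)) := by
      rintro ⟨a, b⟩
      rw [e3, e4, mul_comm]
    simp only [this]
    rw [Measure.volume_eq_prod, lintegral_prod_mul hQ.aemeasurable hP.aemeasurable, i1, i2]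
  have h3 : c * ∫⁻ y, (∫⁻ s : ℝ, F (y + s • L (1, 0))) * (∫⁻ s : ℝ, F (y + s • L (0, 1)))
      = (c * ∫⁻ y, F y) * (c * ∫⁻ y, F y) := h1.symm.trans h2
  refine (ENNReal.mul_le_mul_iff_right hc0 hcT).1 ?_
  rw [h3]
  exact le_of_eq (by ring)

end NSD

end

noncomputable section

namespace NSD

/-! ### Graph coordinates -/

/-- Cartesian coordinates in the orthonormal frame given by a linear isometry. -/
def chart (e : Plane ≃ₗᵢ[ℝ] Plane) : (ℝ × ℝ) ≃L[ℝ] Plane :=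
  (ContinuousLinearEquiv.finTwoArrow ℝ ℝ).symm.trans
    ((EuclideanSpace.equiv (Fin 2) ℝ).symm.trans e.symm.toContinuousLinearEquiv)

variable (e : Plane ≃ₗᵢ[ℝ] Plane)

theorem chart_apply (z : ℝ × ℝ) : chart e z = e.symm !₂[z.1, z.2] := rfl

@[simp] theorem chart_fst (z : ℝ × ℝ) : e (chart e z) 0 = z.1 := by simp [chart_apply]

@[simp] theorem chart_snd (z : ℝ × ℝ) : e (chart e z) 1 = z.2 := by simp [chart_apply]

theorem chart_coords (y : Plane) : chart e (e y 0, e y 1) = y := by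
  rw [chart_apply, LinearIsometryEquiv.symm_apply_eq]
  ext i
  fin_cases i <;> simp

theorem norm_chart_sq (z : ℝ × ℝ) : ‖chart e z‖ ^ 2 = z.1 ^ 2 + z.2 ^ 2 := by
  rw [chart_apply, LinearIsometryEquiv.norm_map, EuclideanSpace.norm_sq_eq]
  simp

theorem norm_chart_le (z : ℝ × ℝ) : ‖chart e z‖ ≤ |z.1| + |z.2| := by
  refine abs_le_of_sq_le_sq' ?_ (by positivity) |>.2
  rw [norm_chart_sq, ← sq_abs z.1, ← sq_abs z.2]
  nlinarith [mul_nonneg (abs_nonneg z.1) (abs_nonneg z.2)]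

theorem inner_chart (z w : ℝ × ℝ) : inner ℝ (chart e z) (chart e w) = z.1 * w.1 + z.2 * w.2 := by
  rw [chart_apply, chart_apply, LinearIsometryEquiv.inner_map_map]
  simp [PiLp.inner_apply, mul_comm]

theorem measurePreserving_chart : MeasurePreserving (chart e) := by
  have h1 : MeasurePreserving (MeasurableEquiv.finTwoArrow (α := ℝ)).symm :=
    (volume_preserving_finTwoArrow ℝ).symm _
  have h2 := PiLp.volume_preserving_toLp (Fin 2)
  have h3 := e.symm.measurePreserving
  exact h3.comp (h2.comp h1)

theorem continuous_coord (i : Fin 2) : Continuous fun y : Plane => e y i := by fun_prop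

variable {e}

theorem coord_add_smul_chart (y : Plane) (s : ℝ) (z : ℝ × ℝ) :
    e (y + s • chart e z) 0 = e y 0 + s * z.1 ∧ e (y + s • chart e z) 1 = e y 1 + s * z.2 := by
  constructor <;> simp

theorem dist_add_smul_lt {x₀ y v : Plane} {r s c : ℝ} (hy : y ∈ Metric.ball x₀ (r / 2))
    (hv : ‖v‖ ≤ c) (hs : 0 ≤ s) (hsc : s * c ≤ r / 2) : y + s • v ∈ Metric.ball x₀ r := by
  rw [Metric.mem_ball, dist_eq_norm] at *
  calc ‖y + s • v - x₀‖ = ‖(y - x₀) + s • v‖ := by congr 1; abel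
    _ ≤ ‖y - x₀‖ + ‖s • v‖ := norm_add_le _ _
    _ < r / 2 + s * c := by
        refine add_lt_add_of_lt_of_le hy ?_
        rw [norm_smul, Real.norm_of_nonneg hs]
        gcongr
    _ ≤ r := by linarith

/-- `Ω` is, in the ball of radius `r` around `x₀`, the region above the graph of a Lipschitz
function in the frame `e`. -/
structure IsLocalGraph (Ω : Set Plane) (x₀ : Plane) (r : ℝ) (e : Plane ≃ₗᵢ[ℝ] Plane) (L : NNReal)
    (h : ℝ → ℝ) : Prop where
  pos : 0 < r
  lip : LipschitzWith L h
  mem_iff : ∀ y ∈ Metric.ball x₀ r, (y ∈ Ω ↔ h (e y 0) < e y 1)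

namespace IsLocalGraph

variable {Ω : Set Plane} {x₀ : Plane} {r : ℝ} {L : NNReal} {h : ℝ → ℝ}

/-- Starting in the ball of half the radius leaves room to go up by r / 2 before the description of
Ω as an epigraph stops being valid. Points of the graph itself are allowed, as the trace inequality
needs. -/
theorem mem_of_half (H : IsLocalGraph Ω x₀ r e L h) {y : Plane}
    (hy : y ∈ Metric.ball x₀ (r / 2)) (hh : h (e y 0) ≤ e y 1) {s : ℝ} (hs : s ∈ Ioo 0 (r / 2)) :
    y + s • chart e (0, 1) ∈ Ω := by
  have hn : ‖chart e (0, 1)‖ ≤ 1 := by simpa using norm_chart_le e (0, 1)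
  rw [H.mem_iff _ (dist_add_smul_lt hy hn hs.1.le (by linarith [hs.2])),
    (coord_add_smul_chart y s _).1, (coord_add_smul_chart y s _).2]
  simp only [mul_zero, add_zero, mul_one]
  linarith [hs.1]

/-- Points strictly below the graph have a neighbourhood that misses Ω, and points on the graph are
limits of points straight above them. -/
theorem mem_frontier_iff (H : IsLocalGraph Ω x₀ r e L h) (hΩ : IsOpen Ω) {y : Plane}
    (hy : y ∈ Metric.ball x₀ r) : y ∈ frontier Ω ↔ h (e y 0) = e y 1 := by
  have hc0 : Continuous fun y : Plane => h (e y 0) := H.lip.continuous.comp (continuous_coord e 0)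
  have hc1 : Continuous fun y : Plane => e y 1 := continuous_coord e 1
  rw [hΩ.frontier_eq, Set.mem_sdiff, H.mem_iff y hy]
  constructor
  · rintro ⟨h1, h2⟩
    refine le_antisymm ?_ (not_lt.1 h2)
    by_contra hlt
    push Not at hlt
    have hU : IsOpen ({z : Plane | e z 1 < h (e z 0)} ∩ Metric.ball x₀ r) :=
      (isOpen_lt hc1 hc0).inter Metric.isOpen_ball
    obtain ⟨z, ⟨hz1, hz2⟩, hz3⟩ := mem_closure_iff.1 h1 _ hU ⟨hlt, hy⟩
    exact lt_asymm hz1 ((H.mem_iff z hz2).1 hz3)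
  · intro heq
    refine ⟨?_, heq.not_lt⟩
    have hlim : Tendsto (fun s : ℝ => y + s • chart e (0, 1)) (𝓝[>] 0) (𝓝 y) := by
      have : Continuous fun s : ℝ => y + s • chart e (0, 1) := by fun_prop
      have h1 := this.tendsto 0
      simp only [zero_smul, add_zero] at h1
      exact h1.mono_left nhdsWithin_le_nhds
    refine mem_closure_of_tendsto hlim ?_
    filter_upwards [hlim.eventually (Metric.isOpen_ball.mem_nhds hy), self_mem_nhdsWithin]
      with s hs hs0
    rw [H.mem_iff _ hs, (coord_add_smul_chart y s _).1, (coord_add_smul_chart y s _).2]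
    simp only [mul_zero, add_zero, mul_one]
    have : (0 : ℝ) < s := hs0
    linarith

end IsLocalGraph

theorem IsBoundedLipschitz.exists_localGraph {Ω : Set Plane} (hΩ : IsBoundedLipschitz Ω)
    {x : Plane} (hx : x ∈ frontier Ω) :
    ∃ (r : ℝ) (e : Plane ≃ₗᵢ[ℝ] Plane) (L : NNReal) (h : ℝ → ℝ), IsLocalGraph Ω x r e L h := by
  obtain ⟨r, hr, e, L, h, hL, H⟩ := hΩ.local_graph x hx
  exact ⟨r, e, L, h, ⟨hr, hL, H⟩⟩

theorem IsBoundedLipschitz.isCompact_closure {Ω : Set Plane} (hΩ : IsBoundedLipschitz Ω) :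
    IsCompact (closure Ω) := hΩ.isBounded.isCompact_closure

theorem IsBoundedLipschitz.isCompact_frontier {Ω : Set Plane} (hΩ : IsBoundedLipschitz Ω) :
    IsCompact (frontier Ω) :=
  hΩ.isCompact_closure.of_isClosed_subset isClosed_frontier frontier_subset_closure

/-- The linear map sending the coordinate vectors to `(a, 1)` and `(-a, 1)`. -/
def shearEquiv (a : ℝ) (ha : a ≠ 0) : (ℝ × ℝ) ≃L[ℝ] (ℝ × ℝ) :=
  LinearEquiv.toContinuousLinearEquiv
    { toFun := fun z => (a * z.1 - a * z.2, z.1 + z.2)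
      invFun := fun z => ((z.2 + z.1 / a) / 2, (z.2 - z.1 / a) / 2)
      map_add' := fun z w => by ext <;> simp <;> ring
      map_smul' := fun c z => by ext <;> simp <;> ring
      left_inv := fun z => by ext <;> simp <;> field_simp <;> ring
      right_inv := fun z => by ext <;> simp <;> field_simp <;> ring }

theorem shearEquiv_apply (a : ℝ) (ha : a ≠ 0) (z : ℝ × ℝ) :
    shearEquiv a ha z = (a * z.1 - a * z.2, z.1 + z.2) := rfl

/-- Near every point of the closure, two transversal segments at every point are inside `Ω`. -/
theorem IsBoundedLipschitz.exists_cone {Ω : Set Plane} (hΩ : IsBoundedLipschitz Ω)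
    {x : Plane} (hx : x ∈ closure Ω) : ∃ r > (0 : ℝ), ∃ s₀ > (0 : ℝ), ∃ T : (ℝ × ℝ) ≃L[ℝ] Plane,
      ∀ y ∈ Ω ∩ Metric.ball x r, ∀ s ∈ Ioo 0 s₀, y + s • T (1, 0) ∈ Ω ∧ y + s • T (0, 1) ∈ Ω := by
  by_cases hxΩ : x ∈ Ω
  · obtain ⟨r, hr, hball⟩ := Metric.isOpen_iff.1 hΩ.isOpen x hxΩ
    refine ⟨r / 2, by positivity, r / 2, by positivity, chart (LinearIsometryEquiv.refl ℝ _), ?_⟩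
    rintro y ⟨_, hy⟩ s ⟨hs0, hs1⟩
    constructor
    · refine hball (dist_add_smul_lt hy (c := 1) ?_ hs0.le (by linarith))
      simpa using norm_chart_le (LinearIsometryEquiv.refl ℝ _) (1, 0)
    · refine hball (dist_add_smul_lt hy (c := 1) ?_ hs0.le (by linarith))
      simpa using norm_chart_le (LinearIsometryEquiv.refl ℝ _) (0, 1)
  · have hxf : x ∈ frontier Ω := by rw [hΩ.isOpen.frontier_eq]; exact ⟨hx, hxΩ⟩
    obtain ⟨r, e, L, h, H⟩ := hΩ.exists_localGraph hxf
    have hr := H.pos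
    -- The directions (±a, 1) have slope L + 1 in absolute value, steeper than the graph, so both
    -- point into the epigraph from every point of it.
    set a : ℝ := 1 / (L + 1) with ha
    have ha0 : 0 < a := by positivity
    have haL : L * a < 1 := by
      rw [ha, mul_one_div, div_lt_one (by positivity)]
      linarith
    have ha1 : a ≤ 1 := by
      rw [ha, div_le_one (by positivity)]
      linarith [L.coe_nonneg]
    refine ⟨r / 2, by positivity, r / 4, by positivity, (shearEquiv a ha0.ne').trans (chart e), ?_⟩
    have key : ∀ b : ℝ, |b| = a → ∀ y ∈ Ω ∩ Metric.ball x (r / 2), ∀ s ∈ Ioo 0 (r / 4),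
        y + s • chart e (b, 1) ∈ Ω := by
      rintro b hb y ⟨hyΩ, hy⟩ s ⟨hs0, hs1⟩
      have hyr : y ∈ Metric.ball x r := Metric.ball_subset_ball (by linarith) hy
      have hn : ‖chart e (b, 1)‖ ≤ 2 := by
        refine (norm_chart_le e (b, 1)).trans ?_
        simp only [hb, abs_one]
        linarith
      rw [H.mem_iff _ (dist_add_smul_lt hy hn hs0.le (by linarith)),
        (coord_add_smul_chart y s _).1, (coord_add_smul_chart y s _).2]
      have h1 := (H.mem_iff y hyr).1 hyΩ
      have h2 := H.lip.dist_le_mul (e y 0 + s * b) (e y 0)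
      rw [Real.dist_eq, Real.dist_eq, add_sub_cancel_left, abs_mul, abs_of_pos hs0, hb] at h2
      have h3 := (abs_le.1 h2).2
      simp only [mul_one]
      nlinarith
    intro y hy s hs
    simp only [ContinuousLinearEquiv.trans_apply, shearEquiv_apply]
    constructor
    · simpa using key a (abs_of_pos ha0) y hy s hs
    · simpa using key (-a) (by rw [abs_neg, abs_of_pos ha0]) y hy s hs

/-! ### Gagliardo–Nirenberg and trace inequalities for smooth functions -/

/-- Gagliardo's argument without an extension operator. At each point |f|² is at most the product of
two line integrals along segments that the cone property keeps inside Ω, and Fubini in these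
directions yields the square of the area integral. Compactness of the closure leaves finitely many
cones. -/
theorem IsBoundedLipschitz.exists_gagliardo {Ω : Set Plane} (hΩ : IsBoundedLipschitz Ω) :
    ∃ C : ℝ≥0∞, C ≠ ⊤ ∧ ∀ f : Plane → ℝ, ContDiff ℝ 1 f →
      ∫⁻ y in Ω, ‖f y‖ₑ ^ 2 ≤ C * (∫⁻ z in Ω, (‖f z‖ₑ + ‖fderiv ℝ f z‖ₑ)) ^ 2 := by
  suffices ∃ C : ℝ≥0∞, C ≠ ⊤ ∧ ∀ f : Plane → ℝ, ContDiff ℝ 1 f →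
      ∫⁻ y in Ω ∩ closure Ω, ‖f y‖ₑ ^ 2 ≤ C * (∫⁻ z in Ω, (‖f z‖ₑ + ‖fderiv ℝ f z‖ₑ)) ^ 2 by
    rwa [inter_eq_left.2 subset_closure] at this
  refine hΩ.isCompact_closure.induction_on (p := fun S => ∃ C : ℝ≥0∞, C ≠ ⊤ ∧
    ∀ f : Plane → ℝ, ContDiff ℝ 1 f → ∫⁻ y in Ω ∩ S, ‖f y‖ₑ ^ 2
      ≤ C * (∫⁻ z in Ω, (‖f z‖ₑ + ‖fderiv ℝ f z‖ₑ)) ^ 2) ?_ ?_ ?_ ?_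
  · exact ⟨0, by simp, fun f _ => by simp⟩
  · rintro S S' hS ⟨C, hC, H⟩
    exact ⟨C, hC, fun f hf =>
      (lintegral_mono_set (inter_subset_inter_right _ hS)).trans (H f hf)⟩
  · rintro S S' ⟨C, hC, H⟩ ⟨C', hC', H'⟩
    refine ⟨C + C', by simp [hC, hC'], fun f hf => ?_⟩
    rw [inter_union_distrib_left, add_mul]
    exact (lintegral_union_le _ _ _).trans (add_le_add (H f hf) (H' f hf))
  · intro x hx
    obtain ⟨r, hr, s₀, hs₀, T, H⟩ := hΩ.exists_cone hx
    obtain ⟨κ, hκ, hκT⟩ := lintegral_two_lines_le T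
    refine ⟨Metric.ball x r, mem_nhdsWithin_of_mem_nhds (Metric.ball_mem_nhds x hr),
      (ENNReal.ofReal s₀⁻¹ + ‖T (1, 0)‖ₑ) * (ENNReal.ofReal s₀⁻¹ + ‖T (0, 1)‖ₑ) * κ,
      by finiteness, fun f hf => ?_⟩
    have hm : MeasurableSet (Ω ∩ Metric.ball x r) :=
      hΩ.isOpen.measurableSet.inter measurableSet_ball
    have hF := measurable_sobolevDensity hΩ.isOpen hf
    rw [← lintegral_sobolevDensity hΩ.isOpen f, mul_assoc]
    calc ∫⁻ y in Ω ∩ Metric.ball x r, ‖f y‖ₑ ^ 2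
        ≤ ∫⁻ y in Ω ∩ Metric.ball x r,
          (ENNReal.ofReal s₀⁻¹ + ‖T (1, 0)‖ₑ) * (ENNReal.ofReal s₀⁻¹ + ‖T (0, 1)‖ₑ) *
          ((∫⁻ s : ℝ, sobolevDensity Ω f (y + s • T (1, 0))) *
            ∫⁻ s : ℝ, sobolevDensity Ω f (y + s • T (0, 1))) := by
          refine setLIntegral_mono' hm fun y hy => ?_
          rw [sq]
          refine (mul_le_mul' (enorm_le_lintegral_line hf hs₀ fun s hs => (H y hy s hs).1)
            (enorm_le_lintegral_line hf hs₀ fun s hs => (H y hy s hs).2)).trans (le_of_eq ?_)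
          ring
      _ ≤ ∫⁻ y, (ENNReal.ofReal s₀⁻¹ + ‖T (1, 0)‖ₑ) * (ENNReal.ofReal s₀⁻¹ + ‖T (0, 1)‖ₑ) *
          ((∫⁻ s : ℝ, sobolevDensity Ω f (y + s • T (1, 0))) *
            ∫⁻ s : ℝ, sobolevDensity Ω f (y + s • T (0, 1))) := setLIntegral_le_lintegral _ _
      _ = (ENNReal.ofReal s₀⁻¹ + ‖T (1, 0)‖ₑ) * (ENNReal.ofReal s₀⁻¹ + ‖T (0, 1)‖ₑ) *
          ∫⁻ y, ((∫⁻ s : ℝ, sobolevDensity Ω f (y + s • T (1, 0))) *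
            ∫⁻ s : ℝ, sobolevDensity Ω f (y + s • T (0, 1))) :=
          lintegral_const_mul' _ _ (by finiteness)
      _ ≤ _ := by gcongr; exact hκT _ hF

end NSD

end

noncomputable section

namespace NSD

/-! ### Arc length on a Lipschitz graph -/

/-- The parametrization of a graph in the frame `e`. -/
def graphMap (e : Plane ≃ₗᵢ[ℝ] Plane) (h : ℝ → ℝ) (x : ℝ) : Plane := chart e (x, h x)

/-- The line element of a graph. -/
def lineElement (h : ℝ → ℝ) (x : ℝ) : ℝ := √(1 + deriv h x ^ 2)

theorem measurable_lineElement (h : ℝ → ℝ) : Measurable (lineElement h) :=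
  ((measurable_const.add ((measurable_deriv h).pow_const 2))).sqrt

theorem one_le_lineElement (h : ℝ → ℝ) (x : ℝ) : 1 ≤ lineElement h x := by
  rw [lineElement, Real.one_le_sqrt]
  nlinarith [sq_nonneg (deriv h x)]

/-- Rationalize the difference: the quotient |a + b| / (√(1 + a²) + √(1 + b²)) is at most 1. An
error in the slope of a graph thus gives at most the same error in its line element. -/
theorem abs_sqrt_one_add_sq_sub_le (a b : ℝ) : |√(1 + a ^ 2) - √(1 + b ^ 2)| ≤ |a - b| := by
  have ha : 0 < √(1 + a ^ 2) := Real.sqrt_pos.2 (by positivity)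
  have hb : 0 < √(1 + b ^ 2) := Real.sqrt_pos.2 (by positivity)
  have ha2 := Real.sq_sqrt (by positivity : 0 ≤ 1 + a ^ 2)
  have hb2 := Real.sq_sqrt (by positivity : 0 ≤ 1 + b ^ 2)
  have h1 : (√(1 + a ^ 2) - √(1 + b ^ 2)) * (√(1 + a ^ 2) + √(1 + b ^ 2))
      = (a - b) * (a + b) := by nlinarith
  have h2 : |a + b| ≤ √(1 + a ^ 2) + √(1 + b ^ 2) := by
    refine (abs_add_le _ _).trans (add_le_add ?_ ?_)
    · exact Real.abs_le_sqrt (by linarith)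
    · exact Real.abs_le_sqrt (by linarith)
  have h3 : |√(1 + a ^ 2) - √(1 + b ^ 2)| * (√(1 + a ^ 2) + √(1 + b ^ 2))
      ≤ |a - b| * (√(1 + a ^ 2) + √(1 + b ^ 2)) := by
    rw [← abs_of_pos (by positivity : 0 < √(1 + a ^ 2) + √(1 + b ^ 2)), ← abs_mul, h1, abs_mul,
      abs_of_pos (by positivity : 0 < √(1 + a ^ 2) + √(1 + b ^ 2))]
    gcongr
  exact le_of_mul_le_mul_right h3 (by positivity)

variable {e : Plane ≃ₗᵢ[ℝ] Plane} {h : ℝ → ℝ} {L : NNReal}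

theorem lineElement_le (hL : LipschitzWith L h) (x : ℝ) : lineElement h x ≤ 1 + L := by
  have h1 : ‖deriv h x‖ ≤ L := norm_deriv_le_of_lipschitz hL
  have h2 := abs_sqrt_one_add_sq_sub_le (deriv h x) 0
  rw [Real.norm_eq_abs] at h1
  simp only [ne_eq, OfNat.ofNat_ne_zero, not_false_eq_true, zero_pow, add_zero, Real.sqrt_one,
    sub_zero] at h2
  have := (abs_le.1 h2).2
  rw [lineElement]
  linarith

theorem coord_graphMap (x : ℝ) : e (graphMap e h x) 0 = x := by simp [graphMap]

theorem coord_graphMap_one (x : ℝ) : e (graphMap e h x) 1 = h x := by simp [graphMap]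

theorem mem_range_graphMap_iff {y : Plane} : y ∈ range (graphMap e h) ↔ h (e y 0) = e y 1 := by
  constructor
  · rintro ⟨x, rfl⟩
    rw [coord_graphMap, coord_graphMap_one]
  · intro hy
    refine ⟨e y 0, ?_⟩
    rw [graphMap, hy, chart_coords]

theorem graphMap_injective : Function.Injective (graphMap e h) :=
  Function.LeftInverse.injective (g := fun y => e y 0) coord_graphMap

/-- A chord of the graph is compared with the chord of a line of slope c, whose length is √(1 + c²)
|x - y|; the triangle inequality is used in both directions. -/
theorem norm_graphMap_sub_le (x y c : ℝ) :
    ‖graphMap e h x - graphMap e h y‖ ≤ √(1 + c ^ 2) * |x - y| + |h x - h y - c * (x - y)| ∧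
    √(1 + c ^ 2) * |x - y| ≤ ‖graphMap e h x - graphMap e h y‖ + |h x - h y - c * (x - y)| := by
  have e1 : graphMap e h x - graphMap e h y = chart e ((x - y), c * (x - y))
      + chart e (0, h x - h y - c * (x - y)) := by
    rw [graphMap, graphMap, ← map_sub, ← map_add]
    congr 1
    ext <;> simp
  have n1 : ‖chart e ((x - y), c * (x - y))‖ = √(1 + c ^ 2) * |x - y| := by
    rw [← Real.sqrt_sq (norm_nonneg _), norm_chart_sq, ← Real.sqrt_sq_eq_abs,
      ← Real.sqrt_mul (by positivity)]
    congr 1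
    ring
  have n2 : ‖chart e (0, h x - h y - c * (x - y))‖ = |h x - h y - c * (x - y)| := by
    rw [← Real.sqrt_sq (norm_nonneg _), norm_chart_sq, ← Real.sqrt_sq_eq_abs]
    simp
  constructor
  · rw [e1, ← n1, ← n2]
    exact norm_add_le _ _
  · have e2 : chart e ((x - y), c * (x - y)) = (graphMap e h x - graphMap e h y)
        - chart e (0, h x - h y - c * (x - y)) := by rw [e1]; abel
    rw [← n1, ← n2, e2]
    exact norm_sub_le _ _

theorem lipschitzWith_graphMap (hL : LipschitzWith L h) : LipschitzWith (1 + L) (graphMap e h) := by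
  refine LipschitzWith.of_dist_le_mul fun x y => ?_
  have h1 := (norm_graphMap_sub_le (e := e) (h := h) x y 0).1
  have h2 := hL.dist_le_mul x y
  rw [Real.dist_eq, Real.dist_eq] at h2
  rw [dist_eq_norm, Real.dist_eq]
  simp only [ne_eq, OfNat.ofNat_ne_zero, not_false_eq_true, zero_pow, add_zero, Real.sqrt_one,
    one_mul, zero_mul, sub_zero] at h1
  push_cast
  linarith

theorem measurableEmbedding_graphMap (hL : LipschitzWith L h) :
    MeasurableEmbedding (graphMap e h) :=
  (lipschitzWith_graphMap hL).continuous.measurableEmbedding graphMap_injective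

/-- Comparison of arc length and Lebesgue measure on a set where the graph is almost straight. -/
theorem hausdorff_image_piece {B : Set ℝ} {c ε : ℝ} (hε : 0 < ε) (hε1 : ε < 1)
    (hB : ∀ x ∈ B, ∀ y ∈ B, |h x - h y - c * (x - y)| ≤ ε * |x - y|) :
    (Measure.hausdorffMeasure 1 : Measure Plane) (graphMap e h '' B)
      ≤ ENNReal.ofReal (√(1 + c ^ 2) + ε) * volume B ∧
    ENNReal.ofReal (√(1 + c ^ 2) - ε) * volume B
      ≤ (Measure.hausdorffMeasure 1 : Measure Plane) (graphMap e h '' B) := by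
  have hs : 1 ≤ √(1 + c ^ 2) := by
    rw [Real.one_le_sqrt]; nlinarith [sq_nonneg c]
  constructor
  · have h1 : LipschitzOnWith (Real.toNNReal (√(1 + c ^ 2) + ε)) (graphMap e h) B := by
      refine LipschitzOnWith.of_dist_le_mul fun x hx y hy => ?_
      rw [dist_eq_norm, Real.dist_eq, Real.coe_toNNReal _ (by positivity)]
      have := (norm_graphMap_sub_le (e := e) (h := h) x y c).1
      have := hB x hx y hy
      linarith
    have h2 := h1.hausdorffMeasure_image_le zero_le_one
    rwa [hausdorffMeasure_real, ENNReal.rpow_one] at h2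
  · have hpos : 0 < √(1 + c ^ 2) - ε := by linarith
    -- The lower bound is the Lipschitz bound for Hausdorff measure applied to the inverse of the
    -- parametrization, the first coordinate.
    have h1 : LipschitzOnWith (Real.toNNReal (√(1 + c ^ 2) - ε)⁻¹) (fun y : Plane => e y 0)
        (graphMap e h '' B) := by
      refine LipschitzOnWith.of_dist_le_mul ?_
      rintro _ ⟨x, hx, rfl⟩ _ ⟨y, hy, rfl⟩
      rw [dist_eq_norm (graphMap e h x), Real.dist_eq, Real.coe_toNNReal _ (by positivity),
        coord_graphMap, coord_graphMap, inv_mul_eq_div, le_div_iff₀ hpos]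
      have := (norm_graphMap_sub_le (e := e) (h := h) x y c).2
      have := hB x hx y hy
      linarith
    have h2 := h1.hausdorffMeasure_image_le zero_le_one
    have e1 : (fun y : Plane => e y 0) '' (graphMap e h '' B) = B := by
      rw [image_image]
      simp only [coord_graphMap, image_id']
    rw [hausdorffMeasure_real, ENNReal.rpow_one, e1] at h2
    calc ENNReal.ofReal (√(1 + c ^ 2) - ε) * volume B
        ≤ ENNReal.ofReal (√(1 + c ^ 2) - ε) * (ENNReal.ofReal (√(1 + c ^ 2) - ε)⁻¹ *
          (Measure.hausdorffMeasure 1 : Measure Plane) (graphMap e h '' B)) := by gcongr; exact h2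
      _ = _ := by
          rw [← mul_assoc, ← ENNReal.ofReal_mul hpos.le, mul_inv_cancel₀ hpos.ne',
            ENNReal.ofReal_one, one_mul]

/-- Arc length of the part of a Lipschitz graph over a measurable set. -/
theorem hausdorff_image_graphMap_aux (hL : LipschitzWith L h) {A : Set ℝ} (hA : MeasurableSet A)
    {ε : NNReal} (hε : 0 < ε) (hε1 : ε < 1) :
    (Measure.hausdorffMeasure 1 : Measure Plane) (graphMap e h '' A)
      ≤ (∫⁻ x in A, ENNReal.ofReal (lineElement h x)) + 2 * ε * volume A ∧
    ∫⁻ x in A, ENNReal.ofReal (lineElement h x)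
      ≤ (Measure.hausdorffMeasure 1 : Measure Plane) (graphMap e h '' A) + 2 * ε * volume A := by
  set D : Set ℝ := {x | DifferentiableAt ℝ h x} with hD
  have hDm : MeasurableSet D := measurableSet_of_differentiableAt ℝ h
  -- The differentiability points, of full measure by Rademacher's theorem, split into countably
  -- many pieces on which h is ε-close to a linear map.
  obtain ⟨t, c, htd, htm, htD, happ, -⟩ :=
    exists_partition_approximatesLinearOn_of_hasFDerivWithinAt h D (fun x => fderiv ℝ h x)
      (fun x hx => (DifferentiableAt.hasFDerivAt hx).hasFDerivWithinAt) (fun _ => ε)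
      (fun _ => hε.ne')
  set S : ℕ → Set ℝ := fun n => A ∩ (D ∩ t n) with hS
  have hSm : ∀ n, MeasurableSet (S n) := fun n => hA.inter (hDm.inter (htm n))
  have hSd : Pairwise (Function.onFun Disjoint S) := fun i j hij =>
    (htd hij).mono (fun x hx => hx.2.2) (fun x hx => hx.2.2)
  -- Pulled back to the line, arc length is a measure, so it can be summed over the pieces; it
  -- ignores Lebesgue null sets because the parametrization is Lipschitz.
  set ν : Measure ℝ := Measure.comap (graphMap e h) (Measure.hausdorffMeasure 1 : Measure Plane)
    with hν
  have hνa : ∀ B, ν B = (Measure.hausdorffMeasure 1 : Measure Plane) (graphMap e h '' B) :=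
    fun B => (measurableEmbedding_graphMap hL).comap_apply _ _
  have hνac : ∀ B, volume B = 0 → ν B = 0 := by
    intro B hB
    rw [hνa]
    have h2 := (lipschitzWith_graphMap (e := e) hL).hausdorffMeasure_image_le zero_le_one B
    rw [hausdorffMeasure_real, hB, mul_zero] at h2
    exact le_antisymm h2 bot_le
  have hnull : volume (A \ ⋃ n, S n) = 0 := by
    refine measure_mono_null (t := Dᶜ) ?_ hL.ae_differentiableAt_real
    rintro x ⟨hxA, hx⟩ hxD
    obtain ⟨n, hn⟩ := mem_iUnion.1 (htD hxD)
    exact hx (mem_iUnion.2 ⟨n, hxA, hxD, hn⟩)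
  have hsub : ⋃ n, S n ⊆ A := iUnion_subset fun n => inter_subset_left
  have hae : (⋃ n, S n : Set ℝ) =ᵐ[volume] A := by
    refine (ae_eq_set.2 ⟨?_, hnull⟩)
    rw [sdiff_eq_empty.2 hsub, measure_empty]
  have haeν : (⋃ n, S n : Set ℝ) =ᵐ[ν] A := by
    refine (ae_eq_set.2 ⟨?_, hνac _ hnull⟩)
    rw [sdiff_eq_empty.2 hsub, measure_empty]
  have sν : ν A = ∑' n, ν (S n) := by
    rw [← measure_congr haeν, measure_iUnion hSd hSm]
  have sV : volume A = ∑' n, volume (S n) := by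
    rw [← measure_congr hae, measure_iUnion hSd hSm]
  have sI : ∫⁻ x in A, ENNReal.ofReal (lineElement h x)
      = ∑' n, ∫⁻ x in S n, ENNReal.ofReal (lineElement h x) := by
    rw [← setLIntegral_congr hae, lintegral_iUnion hSm hSd]
  -- One ε comes from comparing the piece with a straight segment, the other from comparing the
  -- derivative with the slope of that segment.
  have hpiece : ∀ n, ν (S n) ≤ (∫⁻ x in S n, ENNReal.ofReal (lineElement h x))
      + 2 * ε * volume (S n) ∧
      ∫⁻ x in S n, ENNReal.ofReal (lineElement h x) ≤ ν (S n) + 2 * ε * volume (S n) := by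
    intro n
    have hεr : (0 : ℝ) < ε := hε
    have hεr1 : (ε : ℝ) < 1 := hε1
    set a : ℝ := c n 1 with ha
    have hca : ∀ s, c n s = a * s := fun s => by
      rw [ha, mul_comm, ← smul_eq_mul, ← map_smul]; simp
    have hp := hausdorff_image_piece (e := e) (h := h) (B := S n) (c := a) hεr hεr1 (by
      intro x hx y hy
      have := happ n x hx.2 y hy.2
      rwa [hca, Real.norm_eq_abs, Real.norm_eq_abs] at this)
    rw [← hνa] at hp
    have hd : ∀ᵐ x ∂(volume.restrict (S n)), |lineElement h x - √(1 + a ^ 2)| ≤ ε := by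
      have h1 := ((happ n).mono_set (inter_subset_right : S n ⊆ D ∩ t n)).norm_fderiv_sub_le
        volume (hSm n) (fun x => fderiv ℝ h x)
        (fun x hx => (DifferentiableAt.hasFDerivAt hx.2.1).hasFDerivWithinAt)
      filter_upwards [h1] with x hx
      refine (abs_sqrt_one_add_sq_sub_le _ _).trans ?_
      have h2 : deriv h x - a = (fderiv ℝ h x - c n) 1 := by
        rw [_root_.sub_apply, ← ha, fderiv_apply_one_eq_deriv]
      rw [h2, ← Real.norm_eq_abs]
      refine (ContinuousLinearMap.le_opNorm _ _).trans ?_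
      rw [norm_one, mul_one]
      exact hx
    have h2ε : ENNReal.ofReal (2 * ε) = 2 * ε := by
      rw [ENNReal.ofReal_mul (by norm_num), ENNReal.ofReal_coe_nnreal]; simp
    have hs : 1 ≤ √(1 + a ^ 2) := by
      rw [Real.one_le_sqrt]; nlinarith [sq_nonneg a]
    constructor
    · refine hp.1.trans ?_
      rw [← h2ε, ← setLIntegral_const, ← setLIntegral_const,
        ← lintegral_add_right _ measurable_const]
      refine lintegral_mono_ae ?_
      filter_upwards [hd] with x hx
      rw [← ENNReal.ofReal_add (zero_le_one.trans (one_le_lineElement h x)) (by positivity)]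
      refine ENNReal.ofReal_le_ofReal ?_
      linarith [(abs_le.1 hx).1]
    · calc ∫⁻ x in S n, ENNReal.ofReal (lineElement h x)
          ≤ ∫⁻ x in S n, ENNReal.ofReal ((√(1 + a ^ 2) - ε) + 2 * ε) := by
            refine lintegral_mono_ae ?_
            filter_upwards [hd] with x hx
            refine ENNReal.ofReal_le_ofReal ?_
            linarith [(abs_le.1 hx).2]
        _ = ENNReal.ofReal (√(1 + a ^ 2) - ε) * volume (S n) + 2 * ε * volume (S n) := by
            rw [setLIntegral_const, ENNReal.ofReal_add (by linarith) (by positivity), add_mul, h2ε]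
        _ ≤ _ := by gcongr; exact hp.2
  rw [← hνa, sν, sV, sI, ← ENNReal.tsum_mul_left, ← ENNReal.tsum_add, ← ENNReal.tsum_add]
  exact ⟨ENNReal.tsum_le_tsum fun n => (hpiece n).1, ENNReal.tsum_le_tsum fun n => (hpiece n).2⟩

/-- Let ε = 1 / (n + 2) tend to zero in the preceding two-sided estimate; finiteness of the measure
of A makes the error term vanish. -/
theorem hausdorff_image_graphMap (hL : LipschitzWith L h) {A : Set ℝ} (hA : MeasurableSet A)
    (hfin : volume A ≠ ⊤) :
    (Measure.hausdorffMeasure 1 : Measure Plane) (graphMap e h '' A)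
      = ∫⁻ x in A, ENNReal.ofReal (lineElement h x) := by
  have hlim : ∀ a : ℝ≥0∞, Tendsto (fun n : ℕ => a + 2 * (((1 : NNReal) / (n + 2) : NNReal) : ℝ≥0∞)
      * volume A) atTop (𝓝 a) := by
    intro a
    have h0 : Tendsto (fun n : ℕ => ((1 : NNReal) / (n + 2) : NNReal)) atTop (𝓝 0) := by
      have := (tendsto_one_div_add_atTop_nhds_zero_nat (𝕜 := NNReal)).comp (tendsto_add_atTop_nat 1)
      refine this.congr fun n => ?_
      simp only [Function.comp]
      push_cast
      congr 1
      ring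
    have h1 : Tendsto (fun n : ℕ => (((1 : NNReal) / (n + 2) : NNReal) : ℝ≥0∞)) atTop (𝓝 0) := by
      have := ENNReal.tendsto_coe.2 h0
      rwa [ENNReal.coe_zero] at this
    have h2 := ENNReal.Tendsto.mul_const (b := volume A)
      (ENNReal.Tendsto.const_mul (a := 2) h1 (by simp)) (Or.inr hfin)
    simpa using tendsto_const_nhds.add h2
  have hlt : ∀ n : ℕ, ((1 : NNReal) / (n + 2)) < 1 := fun n => by
    rw [div_lt_one (by positivity)]
    have : (0 : NNReal) ≤ n := bot_le
    calc (1 : NNReal) < 2 := by norm_num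
      _ ≤ n + 2 := by simp
  refine le_antisymm (ge_of_tendsto' (hlim _) fun n => ?_) (ge_of_tendsto' (hlim _) fun n => ?_)
  · exact (hausdorff_image_graphMap_aux hL hA (by positivity) (hlt n)).1
  · exact (hausdorff_image_graphMap_aux hL hA (by positivity) (hlt n)).2

/-- Arc length on a Lipschitz graph is the line element times Lebesgue measure. -/
theorem hausdorff_restrict_range_graphMap (hL : LipschitzWith L h) :
    (Measure.hausdorffMeasure 1 : Measure Plane).restrict (range (graphMap e h))
      = Measure.map (graphMap e h)
        (volume.withDensity fun x => ENNReal.ofReal (lineElement h x)) := by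
  have hemb := measurableEmbedding_graphMap (e := e) hL
  have hcomap : Measure.comap (graphMap e h) (Measure.hausdorffMeasure 1 : Measure Plane)
      = volume.withDensity fun x => ENNReal.ofReal (lineElement h x) := by
    -- The formula is available for sets of finite length only, so the line is exhausted by bounded
    -- intervals.
    refine Measure.ext_of_iUnion_eq_univ (s := fun n : ℕ => Icc (-(n : ℝ)) n) ?_ fun n => ?_
    · refine eq_univ_of_forall fun x => mem_iUnion.2 ?_
      obtain ⟨n, hn⟩ := exists_nat_ge |x|
      exact ⟨n, abs_le.1 hn⟩
    · ext B hB
      rw [Measure.restrict_apply hB, Measure.restrict_apply hB, hemb.comap_apply,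
        withDensity_apply _ (hB.inter measurableSet_Icc),
        hausdorff_image_graphMap hL (hB.inter measurableSet_Icc)]
      exact ((measure_mono inter_subset_right).trans_lt measure_Icc_lt_top).ne
  rw [← hcomap, hemb.map_comap]

end NSD

end

noncomputable section

namespace NSD

/-! ### The boundary measure and the normal field in graph coordinates -/

variable {e : Plane ≃ₗᵢ[ℝ] Plane}

/-- The downward unit normal of a graph. -/
def graphNormal (e : Plane ≃ₗᵢ[ℝ] Plane) (h : ℝ → ℝ) (x : ℝ) : Plane :=
  chart e ((lineElement h x)⁻¹ * deriv h x, -(lineElement h x)⁻¹)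

theorem measurable_graphNormal (e : Plane ≃ₗᵢ[ℝ] Plane) (h : ℝ → ℝ) :
    Measurable (graphNormal e h) :=
  (chart e).continuous.measurable.comp
    (((measurable_lineElement h).inv.mul (measurable_deriv h)).prodMk
      (measurable_lineElement h).inv.neg)

namespace IsLocalGraph

variable {Ω : Set Plane} {x₀ : Plane} {r : ℝ} {L : NNReal} {h : ℝ → ℝ}

/-- Inside the ball the boundary of Ω and the graph are the same set, so boundary integrals become
integrals over the line with the line element as weight. -/
theorem bdryMeasure_restrict (H : IsLocalGraph Ω x₀ r e L h) (hΩ : IsOpen Ω) {S : Set Plane}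
    (hS : MeasurableSet S) (hSr : S ⊆ Metric.ball x₀ r) :
    (bdryMeasure Ω).restrict S = ((volume.withDensity fun x => ENNReal.ofReal (lineElement h x)
      ).restrict (graphMap e h ⁻¹' S)).map (graphMap e h) := by
  rw [← (measurableEmbedding_graphMap H.lip).restrict_map,
    ← hausdorff_restrict_range_graphMap H.lip, bdryMeasure,
    Measure.restrict_restrict hS, Measure.restrict_restrict hS]
  congr 1
  ext y
  refine and_congr_right fun hy => ?_
  rw [H.mem_frontier_iff hΩ (hSr hy), mem_range_graphMap_iff]

/-- Differentiability says that near x the graph leaves its tangent by at most ε times the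
horizontal distance, which is the two-cone condition for the normal. Since the line element is at
least one, normalizing the vector does not spoil ε. -/
theorem isOutwardUnitNormal (H : IsLocalGraph Ω x₀ r e L h) {x : ℝ}
    (hx : graphMap e h x ∈ Metric.ball x₀ r) (hd : DifferentiableAt ℝ h x) :
    IsOutwardUnitNormal Ω (graphMap e h x) (graphNormal e h x) := by
  have hJ := one_le_lineElement h x
  have hJ0 : 0 < lineElement h x := by linarith
  have hJ2 : lineElement h x ^ 2 = 1 + deriv h x ^ 2 := Real.sq_sqrt (by positivity)
  constructor
  · rw [← Real.sqrt_sq (norm_nonneg _), graphNormal, norm_chart_sq, Real.sqrt_eq_one]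
    field_simp
    linarith
  · intro ε hε
    have h1 : ∀ᶠ z in 𝓝 x, ‖h z - h x - (z - x) * deriv h x‖ ≤ ε * ‖z - x‖ := by
      simpa using (hasDerivAt_iff_isLittleO.1 hd.hasDerivAt).def hε
    have h2 : ∀ᶠ y in 𝓝 (graphMap e h x), y ∈ Metric.ball x₀ r ∧
        |h (e y 0) - h x - (e y 0 - x) * deriv h x| ≤ ε * |e y 0 - x| := by
      have hc : Tendsto (fun y : Plane => e y 0) (𝓝 (graphMap e h x)) (𝓝 x) := by
        have := (continuous_coord e 0).tendsto (graphMap e h x)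
        rwa [coord_graphMap] at this
      exact (Metric.isOpen_ball.eventually_mem hx).and (hc.eventually h1)
    obtain ⟨δ, hδ, hball⟩ := Metric.eventually_nhds_iff_ball.1 h2
    refine ⟨δ, hδ, fun y hy => ?_⟩
    obtain ⟨hyr, hyd⟩ := hball y hy
    have e1 : y - graphMap e h x = chart e (e y 0 - x, e y 1 - h x) := by
      nth_rewrite 1 [← chart_coords e y]
      rw [graphMap, ← map_sub]
      rfl
    have e2 : inner ℝ (y - graphMap e h x) (graphNormal e h x)
        = ((e y 0 - x) * deriv h x - (e y 1 - h x)) / lineElement h x := by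
      rw [e1, graphNormal, inner_chart]
      field_simp
      ring
    have e3 : |e y 0 - x| ≤ ‖y - graphMap e h x‖ := by
      refine abs_le_of_sq_le_sq ?_ (norm_nonneg _)
      rw [e1, norm_chart_sq]
      nlinarith [sq_nonneg (e y 1 - h x)]
    have e4 : ε * |e y 0 - x| ≤ ε * ‖y - graphMap e h x‖ * lineElement h x := by
      have : 0 ≤ ε * ‖y - graphMap e h x‖ := by positivity
      nlinarith [mul_le_mul_of_nonneg_left e3 hε.le]
    obtain ⟨k1, k2⟩ := abs_le.1 hyd
    rw [e2, H.mem_iff y hyr]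
    constructor
    · intro hlt
      rw [lt_div_iff₀ hJ0] at hlt
      linarith
    · intro hlt
      rw [div_lt_iff₀ hJ0] at hlt
      linarith

theorem outwardNormal_graphMap (H : IsLocalGraph Ω x₀ r e L h) {x : ℝ}
    (hx : graphMap e h x ∈ Metric.ball x₀ r) (hd : DifferentiableAt ℝ h x) :
    outwardNormal Ω (graphMap e h x) = graphNormal e h x := by
  have hν := H.isOutwardUnitNormal hx hd
  have hex : ∃ ν, IsOutwardUnitNormal Ω (graphMap e h x) ν := ⟨_, hν⟩
  rw [outwardNormal, dif_pos hex]
  exact hex.choose_spec.unique hν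

/-- The normal field is obtained by choice, so its measurability is not visible from the definition.
Almost everywhere, by Rademacher's theorem, it is the explicit normal of the graph. -/
theorem aemeasurable_outwardNormal (H : IsLocalGraph Ω x₀ r e L h) (hΩ : IsOpen Ω) :
    AEMeasurable (outwardNormal Ω) ((bdryMeasure Ω).restrict (Metric.ball x₀ r)) := by
  refine ⟨fun y => graphNormal e h (e y 0),
    (measurable_graphNormal e h).comp (continuous_coord e 0).measurable, ?_⟩
  rw [H.bdryMeasure_restrict hΩ measurableSet_ball subset_rfl]
  refine (measurableEmbedding_graphMap H.lip).ae_map_iff.2 ?_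
  have hm := (measurableEmbedding_graphMap (e := e) H.lip).measurable
    (measurableSet_ball (x := x₀) (ε := r))
  refine (ae_restrict_iff' hm).2 ?_
  refine (withDensity_absolutelyContinuous _ _).ae_le ?_
  filter_upwards [H.lip.ae_differentiableAt_real] with x hx hxb
  rw [coord_graphMap]
  exact H.outwardNormal_graphMap hxb hx

end IsLocalGraph

theorem norm_outwardNormal_le (Ω : Set Plane) (x : Plane) : ‖outwardNormal Ω x‖ ≤ 1 := by
  rw [outwardNormal]
  split_ifs with h
  · exact h.choose_spec.1.le
  · simp

theorem bdryMeasure_restrict_frontier (Ω : Set Plane) :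
    (bdryMeasure Ω).restrict (frontier Ω) = bdryMeasure Ω := by
  rw [bdryMeasure, Measure.restrict_restrict isClosed_frontier.measurableSet, inter_self]

theorem IsBoundedLipschitz.aemeasurable_outwardNormal {Ω : Set Plane}
    (hΩ : IsBoundedLipschitz Ω) : AEMeasurable (outwardNormal Ω) (bdryMeasure Ω) := by
  rw [← bdryMeasure_restrict_frontier]
  refine hΩ.isCompact_frontier.induction_on
    (p := fun S => AEMeasurable (outwardNormal Ω) ((bdryMeasure Ω).restrict S)) ?_ ?_ ?_ ?_
  · simp
  · intro S S' hS h
    exact h.mono_measure (Measure.restrict_mono hS le_rfl)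
  · intro S S' h h'
    exact aemeasurable_union_iff.2 ⟨h, h'⟩
  · intro x hx
    obtain ⟨r, e, L, h, H⟩ := hΩ.exists_localGraph hx
    exact ⟨_, mem_nhdsWithin_of_mem_nhds (Metric.ball_mem_nhds x H.pos),
      H.aemeasurable_outwardNormal hΩ.isOpen⟩

theorem IsBoundedLipschitz.aemeasurable_unitTangent {Ω : Set Plane}
    (hΩ : IsBoundedLipschitz Ω) : AEMeasurable (unitTangent Ω) (bdryMeasure Ω) := by
  have h : Continuous fun n : Plane => (!₂[-(n 1), n 0] : Plane) := by fun_prop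
  exact h.measurable.comp_aemeasurable hΩ.aemeasurable_outwardNormal

theorem norm_unitTangent_le (Ω : Set Plane) (x : Plane) : ‖unitTangent Ω x‖ ≤ 1 := by
  have h : ‖unitTangent Ω x‖ = ‖outwardNormal Ω x‖ := by
    rw [EuclideanSpace.norm_eq, EuclideanSpace.norm_eq]
    simp [unitTangent, add_comm]
  rw [h]
  exact norm_outwardNormal_le Ω x

/-- Each boundary value is controlled by an integral along the segment going straight up into Ω.
Integrating over the base, with the line element at most 1 + L, turns this into an area integral;
finitely many charts cover the boundary. -/
theorem IsBoundedLipschitz.exists_trace_ineq {Ω : Set Plane} (hΩ : IsBoundedLipschitz Ω) :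
    ∃ C : ℝ≥0∞, C ≠ ⊤ ∧ ∀ f : Plane → ℝ, ContDiff ℝ 1 f →
      ∫⁻ y, ‖f y‖ₑ ∂(bdryMeasure Ω) ≤ C * ∫⁻ z in Ω, (‖f z‖ₑ + ‖fderiv ℝ f z‖ₑ) := by
  rw [← bdryMeasure_restrict_frontier]
  refine hΩ.isCompact_frontier.induction_on (p := fun S => ∃ C : ℝ≥0∞, C ≠ ⊤ ∧
    ∀ f : Plane → ℝ, ContDiff ℝ 1 f → ∫⁻ y in S, ‖f y‖ₑ ∂(bdryMeasure Ω)
      ≤ C * ∫⁻ z in Ω, (‖f z‖ₑ + ‖fderiv ℝ f z‖ₑ)) ?_ ?_ ?_ ?_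
  · exact ⟨0, by simp, fun f _ => by simp⟩
  · rintro S S' hS ⟨C, hC, H⟩
    exact ⟨C, hC, fun f hf => (lintegral_mono_set hS).trans (H f hf)⟩
  · rintro S S' ⟨C, hC, H⟩ ⟨C', hC', H'⟩
    refine ⟨C + C', by simp [hC, hC'], fun f hf => ?_⟩
    rw [add_mul]
    exact (lintegral_union_le _ _ _).trans (add_le_add (H f hf) (H' f hf))
  · intro x hx
    obtain ⟨r, e, L, h, H⟩ := hΩ.exists_localGraph hx
    have hr := H.pos
    set κ : ℝ≥0∞ := ENNReal.ofReal (r / 2)⁻¹ + ‖chart e (0, 1)‖ₑ with hκ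
    have hκT : κ ≠ ⊤ := by finiteness
    refine ⟨Metric.ball x (r / 2), mem_nhdsWithin_of_mem_nhds (Metric.ball_mem_nhds x (by linarith)),
      ENNReal.ofReal (1 + L) * κ, by finiteness, fun f hf => ?_⟩
    have hemb := measurableEmbedding_graphMap (e := e) H.lip
    have hF := measurable_sobolevDensity hΩ.isOpen hf
    have hFc : Measurable fun z : ℝ × ℝ => sobolevDensity Ω f (chart e z) :=
      hF.comp (chart e).continuous.measurable
    have hm : MeasurableSet (graphMap e h ⁻¹' Metric.ball x (r / 2)) :=
      hemb.measurable measurableSet_ball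
    have hfm : Measurable fun t => ‖f (graphMap e h t)‖ₑ :=
      (hf.continuous.comp (lipschitzWith_graphMap H.lip).continuous).measurable.enorm
    rw [H.bdryMeasure_restrict hΩ.isOpen measurableSet_ball (Metric.ball_subset_ball (by linarith)),
      hemb.lintegral_map, restrict_withDensity hm, lintegral_withDensity_eq_lintegral_mul _
        (measurable_lineElement h).ennreal_ofReal
        hfm,
      ← lintegral_sobolevDensity hΩ.isOpen]
    have hlin : ∀ t : ℝ, graphMap e h t ∈ Metric.ball x (r / 2) →
        ‖f (graphMap e h t)‖ₑ ≤ κ * ∫⁻ s : ℝ, sobolevDensity Ω f (chart e (t, s)) := by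
      intro t ht
      refine (enorm_le_lintegral_line hf (half_pos hr) (v := chart e (0, 1)) fun s hs =>
        H.mem_of_half ht (by rw [coord_graphMap, coord_graphMap_one]) hs).trans (le_of_eq ?_)
      congr 1
      have e1 : ∀ s : ℝ, graphMap e h t + s • chart e (0, 1) = chart e (t, h t + s) := fun s => by
        rw [graphMap, ← map_smul, ← map_add]; simp
      simp only [e1]
      exact lintegral_add_left_eq_self (fun u => sobolevDensity Ω f (chart e (t, u))) (h t)
    calc ∫⁻ t in graphMap e h ⁻¹' Metric.ball x (r / 2), ((fun t => ENNReal.ofReal (lineElement h t))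
          * fun t => ‖f (graphMap e h t)‖ₑ) t
        ≤ ∫⁻ t in graphMap e h ⁻¹' Metric.ball x (r / 2), ENNReal.ofReal (1 + L) * κ *
          ∫⁻ s : ℝ, sobolevDensity Ω f (chart e (t, s)) := by
          refine setLIntegral_mono' hm fun t ht => ?_
          rw [Pi.mul_apply, mul_assoc]
          exact mul_le_mul' (ENNReal.ofReal_le_ofReal (lineElement_le H.lip t)) (hlin t ht)
      _ ≤ ∫⁻ t, ENNReal.ofReal (1 + L) * κ *
          ∫⁻ s : ℝ, sobolevDensity Ω f (chart e (t, s)) := setLIntegral_le_lintegral _ _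
      _ = ENNReal.ofReal (1 + L) * κ * ∫⁻ t, ∫⁻ s : ℝ, sobolevDensity Ω f (chart e (t, s)) :=
          lintegral_const_mul' _ _ (by finiteness)
      _ = _ := by
          rw [← lintegral_prod (fun z : ℝ × ℝ => sobolevDensity Ω f (chart e z)) hFc.aemeasurable,
            ← Measure.volume_eq_prod, (measurePreserving_chart e).lintegral_comp hF]

end NSD

end

noncomputable section

namespace NSD

/-! ### The divergence theorem above a Lipschitz graph -/

/-- Integration by parts for Lipschitz functions, against the constant 1. -/
theorem integral_deriv_eq_zero_of_lipschitz {k : ℝ → ℝ} {K : NNReal} (hk : LipschitzWith K k)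
    (hc : HasCompactSupport k) : ∫ x, deriv k x = 0 := by
  have h1 := LipschitzWith.integral_lineDeriv_mul_eq (μ := (volume : Measure ℝ))
    (LipschitzWith.const (1 : ℝ)) hk hc (-1)
  have h2 : ∀ x : ℝ, lineDeriv ℝ (fun _ : ℝ => (1 : ℝ)) x (-1) = 0 := fun x => by
    simp [lineDeriv]
  have h3 : ∀ x : ℝ, lineDeriv ℝ k x 1 = deriv k x := fun x => by
    simp only [lineDeriv, smul_eq_mul, mul_one]
    rw [deriv_comp_const_add, add_zero]
  simp only [h2, neg_neg, h3, zero_mul, integral_zero, mul_one] at h1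
  exact h1.symm

section HalfPlane

variable {G : ℝ × ℝ → ℝ} {h : ℝ → ℝ} {L : NNReal}

/-- The shear that maps the upper half plane to the region above a graph. -/
theorem continuous_shear (hL : LipschitzWith L h) :
    Continuous fun z : ℝ × ℝ => (z.1, h z.1 + z.2) := by
  have := hL.continuous
  fun_prop

theorem integrable_shear {g : ℝ × ℝ → ℝ} (hg : Continuous g) (hc : HasCompactSupport g)
    (hL : LipschitzWith L h) : Integrable fun z : ℝ × ℝ => g (z.1, h z.1 + z.2) := by
  refine (hg.comp (continuous_shear hL)).integrable_of_hasCompactSupport ?_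
  have hco := hL.continuous
  let E : (ℝ × ℝ) ≃ₜ (ℝ × ℝ) :=
    { toFun := fun z => (z.1, h z.1 + z.2)
      invFun := fun z => (z.1, z.2 - h z.1)
      left_inv := fun z => by ext <;> simp
      right_inv := fun z => by ext <;> simp
      continuous_toFun := continuous_shear hL
      continuous_invFun := by fun_prop }
  exact hc.comp_homeomorph E

theorem integral_above_vertical (hG : ContDiff ℝ 1 G) (hc : HasCompactSupport G) (x s : ℝ) :
    ∫ t in Ioi (0 : ℝ), fderiv ℝ G (x, s + t) (0, 1) = -G (x, s) := by
  have hk : ContDiff ℝ 1 fun t : ℝ => G (x, s + t) :=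
    hG.comp (contDiff_const.prodMk (contDiff_const.add contDiff_id))
  have hkc : HasCompactSupport fun t : ℝ => G (x, s + t) := by
    refine hc.comp_isClosedEmbedding (g := fun t : ℝ => (x, s + t)) ?_
    exact Function.LeftInverse.isClosedEmbedding (f := fun z : ℝ × ℝ => z.2 - s)
      (fun t => by simp) (by fun_prop) (by fun_prop)
  have hd : ∀ t, deriv (fun t : ℝ => G (x, s + t)) t = fderiv ℝ G (x, s + t) (0, 1) := fun t => by
    have h2 : HasDerivAt (fun t : ℝ => (x, s + t)) ((0 : ℝ), (1 : ℝ)) t :=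
      (hasDerivAt_const t x).prodMk ((hasDerivAt_id t).const_add s)
    exact ((hG.differentiable (by simp) _).hasFDerivAt.comp_hasDerivAt t h2).deriv
  have := hkc.integral_Ioi_deriv_eq hk 0
  simpa [hd] using this

theorem continuous_fderiv_apply_const {E : Type*} [NormedAddCommGroup E] [NormedSpace ℝ E]
    {g : E → ℝ} (hg : ContDiff ℝ 1 g) (v : E) : Continuous fun z => fderiv ℝ g z v :=
  (hg.continuous_fderiv (by simp)).clm_apply continuous_const

/-- Along a vertical translate of the graph, G is a compactly supported Lipschitz function of x, so
its total derivative integrates to zero; the a.e. chain rule splits that derivative into the two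
terms. -/
theorem integral_shear_horizontal (hG : ContDiff ℝ 1 G) (hc : HasCompactSupport G)
    (hL : LipschitzWith L h) (t : ℝ) :
    ∫ x, fderiv ℝ G (x, h x + t) (1, 0) = -∫ x, deriv h x * fderiv ℝ G (x, h x + t) (0, 1) := by
  obtain ⟨K, hK⟩ := hG.lipschitzWith_of_hasCompactSupport hc (by simp)
  have hl : LipschitzWith (max 1 (L + 0)) fun x : ℝ => (x, h x + t) :=
    LipschitzWith.id.prodMk (hL.add (LipschitzWith.const t))
  have hcl : IsClosedEmbedding fun x : ℝ => (x, h x + t) := by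
    exact Function.LeftInverse.isClosedEmbedding (f := Prod.fst) (fun x => rfl)
      continuous_fst hl.continuous
  have hz := integral_deriv_eq_zero_of_lipschitz (hK.comp hl) (hc.comp_isClosedEmbedding hcl)
  have hae : (fun x => deriv (G ∘ fun x : ℝ => (x, h x + t)) x) =ᵐ[volume]
      fun x => fderiv ℝ G (x, h x + t) (1, 0) + deriv h x * fderiv ℝ G (x, h x + t) (0, 1) := by
    filter_upwards [hL.ae_differentiableAt_real] with x hx
    have h2 : HasDerivAt (fun x : ℝ => (x, h x + t)) ((1 : ℝ), deriv h x) x :=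
      (hasDerivAt_id x).prodMk (hx.hasDerivAt.add_const t)
    rw [((hG.differentiable (by simp) _).hasFDerivAt.comp_hasDerivAt x h2).deriv]
    have : ((1 : ℝ), deriv h x) = (1, 0) + deriv h x • ((0 : ℝ), (1 : ℝ)) := by ext <;> simp
    rw [this, map_add, map_smul, smul_eq_mul]
  have hi : ∀ v : ℝ × ℝ, Integrable fun x => fderiv ℝ G (x, h x + t) v := fun v =>
    ((continuous_fderiv_apply_const hG v).comp hl.continuous).integrable_of_hasCompactSupport
      ((hc.fderiv_apply ℝ v).comp_isClosedEmbedding hcl)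
  have hi2 : Integrable fun x => deriv h x * fderiv ℝ G (x, h x + t) (0, 1) := by
    refine (hi (0, 1)).bdd_mul (c := L) (measurable_deriv h).aestronglyMeasurable ?_
    exact Eventually.of_forall fun x => norm_deriv_le_of_lipschitz hL
  rw [integral_congr_ae hae, integral_add (hi _) hi2] at hz
  linarith

/-- The divergence theorem above a Lipschitz graph, in Cartesian coordinates. -/
theorem integral_above_graph (hG : ContDiff ℝ 1 G) (hc : HasCompactSupport G)
    (hL : LipschitzWith L h) (a b : ℝ) :
    ∫ z in {z : ℝ × ℝ | h z.1 < z.2}, fderiv ℝ G z (a, b)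
      = ∫ x, G (x, h x) * (a * deriv h x - b) := by
  have hcd : ∀ v, HasCompactSupport fun z => fderiv ℝ G z v := fun v => hc.fderiv_apply ℝ v
  have hint : ∀ v, Integrable fun z : ℝ × ℝ => fderiv ℝ G (z.1, h z.1 + z.2) v := fun v =>
    integrable_shear (continuous_fderiv_apply_const hG v) (hcd v) hL
  have hprod : (volume : Measure ℝ).prod (volume.restrict (Ioi (0 : ℝ)))
      = (volume : Measure (ℝ × ℝ)).restrict (univ ×ˢ Ioi (0 : ℝ)) := by
    rw [Measure.volume_eq_prod, ← Measure.prod_restrict, Measure.restrict_univ]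
  have hintp : ∀ v, Integrable (fun z : ℝ × ℝ => fderiv ℝ G (z.1, h z.1 + z.2) v)
      ((volume : Measure ℝ).prod (volume.restrict (Ioi (0 : ℝ)))) := fun v => by
    rw [hprod]; exact (hint v).restrict
  have hms : MeasurableSet {z : ℝ × ℝ | h z.1 < z.2} :=
    measurableSet_lt (hL.continuous.measurable.comp measurable_fst) measurable_snd
  -- reduction to the half plane
  have hshift : ∀ v, ∫ z in {z : ℝ × ℝ | h z.1 < z.2}, fderiv ℝ G z v
      = ∫ x, ∫ t in Ioi (0 : ℝ), fderiv ℝ G (x, h x + t) v := by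
    intro v
    have hi : Integrable fun z : ℝ × ℝ => fderiv ℝ G z v :=
      (continuous_fderiv_apply_const hG v).integrable_of_hasCompactSupport (hcd v)
    rw [← integral_indicator hms, Measure.volume_eq_prod, integral_prod]
    · refine integral_congr_ae (Eventually.of_forall fun x => ?_)
      simp only
      rw [← integral_indicator measurableSet_Ioi,
        ← integral_add_left_eq_self (μ := (volume : Measure ℝ)) _ (h x)]
      refine integral_congr_ae (Eventually.of_forall fun t => ?_)
      simp only [indicator, mem_ofPred_eq, mem_Ioi, lt_add_iff_pos_right]
    · rw [← Measure.volume_eq_prod]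
      exact hi.indicator hms
  have hvert : ∫ z in {z : ℝ × ℝ | h z.1 < z.2}, fderiv ℝ G z (0, 1) = -∫ x, G (x, h x) := by
    rw [hshift]
    simp only [integral_above_vertical hG hc]
    rw [integral_neg]
  -- After Fubini, the horizontal derivative on each translate of the graph is traded for -h' times
  -- the vertical one; swapping the integrals back, the vertical integral produces the boundary
  -- value.
  have hhor : ∫ z in {z : ℝ × ℝ | h z.1 < z.2}, fderiv ℝ G z (1, 0)
      = ∫ x, G (x, h x) * deriv h x := by
    rw [hshift, integral_integral_swap (f := fun x t => fderiv ℝ G (x, h x + t) (1, 0))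
      (hintp (1, 0))]
    simp only [integral_shear_horizontal hG hc hL]
    rw [integral_neg, ← integral_integral_swap
      (f := fun x t => deriv h x * fderiv ℝ G (x, h x + t) (0, 1)), ← integral_neg]
    · refine integral_congr_ae (Eventually.of_forall fun x => ?_)
      simp only
      rw [integral_const_mul, integral_above_vertical hG hc]
      ring
    · refine (hintp (0, 1)).bdd_mul (c := L) (f := fun z : ℝ × ℝ => deriv h z.1)
        ((measurable_deriv h).comp measurable_fst).aestronglyMeasurable ?_
      exact Eventually.of_forall fun x => norm_deriv_le_of_lipschitz hL
  have hlin : ∀ z, fderiv ℝ G z (a, b)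
      = a * fderiv ℝ G z (1, 0) + b * fderiv ℝ G z (0, 1) := fun z => by
    have : (a, b) = a • ((1 : ℝ), (0 : ℝ)) + b • ((0 : ℝ), (1 : ℝ)) := by ext <;> simp
    rw [this, map_add, map_smul, map_smul, smul_eq_mul, smul_eq_mul]
  have hi : ∀ v, Integrable (fun z : ℝ × ℝ => fderiv ℝ G z v)
      (volume.restrict {z : ℝ × ℝ | h z.1 < z.2}) := fun v =>
    ((continuous_fderiv_apply_const hG v).integrable_of_hasCompactSupport (hcd v)).restrict
  have hcl : IsClosedEmbedding fun x : ℝ => (x, h x) := by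
    have hcont : Continuous fun x : ℝ => (x, h x) := continuous_id.prodMk hL.continuous
    exact Function.LeftInverse.isClosedEmbedding (f := Prod.fst) (fun x => rfl)
      continuous_fst hcont
  have hg : Integrable fun x => G (x, h x) :=
    (hG.continuous.comp hcl.continuous).integrable_of_hasCompactSupport
      (hc.comp_isClosedEmbedding hcl)
  have hg2 : Integrable fun x => G (x, h x) * deriv h x := by
    refine (hg.bdd_mul (c := L) (measurable_deriv h).aestronglyMeasurable ?_).congr
      (Eventually.of_forall fun x => mul_comm _ _)
    exact Eventually.of_forall fun x => norm_deriv_le_of_lipschitz hL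
  simp only [hlin]
  rw [integral_add ((hi _).const_mul a) ((hi _).const_mul b), integral_const_mul,
    integral_const_mul, hvert, hhor, mul_neg, ← integral_const_mul, ← integral_const_mul,
    ← sub_eq_add_neg, ← integral_sub (hg2.const_mul a) (hg.const_mul b)]
  refine integral_congr_ae (Eventually.of_forall fun x => ?_)
  simp only
  ring

end HalfPlane

end NSD

end

noncomputable section

namespace NSD

/-! ### The divergence theorem on Lipschitz domains -/

/-- `Ω` satisfies the divergence theorem for the function `f`. -/
def HasDivergenceFormula (Ω : Set Plane) (f : Plane → ℝ) : Prop :=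
  ∀ v : Plane, ∫ y in Ω, fderiv ℝ f y v
    = ∫ y, f y * inner ℝ (outwardNormal Ω y) v ∂(bdryMeasure Ω)

variable {e : Plane ≃ₗᵢ[ℝ] Plane}

theorem fderiv_eq_zero_of_notMem_tsupport {f : Plane → ℝ} {y : Plane} (hy : y ∉ tsupport f) :
    fderiv ℝ f y = 0 := by
  by_contra h
  exact hy (support_fderiv_subset ℝ (by exact h))

/-- As f vanishes outside the ball, Ω may be replaced by the whole epigraph, where the formula is
known in Cartesian coordinates. On the boundary the line element cancels the normalization of the
graph normal. -/
theorem IsLocalGraph.hasDivergenceFormula {Ω : Set Plane} {x₀ : Plane} {r : ℝ} {L : NNReal}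
    {h : ℝ → ℝ} (H : IsLocalGraph Ω x₀ r e L h) (hΩ : IsOpen Ω) {f : Plane → ℝ}
    (hf : ContDiff ℝ 1 f) (hc : HasCompactSupport f) (hs : tsupport f ⊆ Metric.ball x₀ r) :
    HasDivergenceFormula Ω f := by
  intro v
  set a := e v 0 with ha
  set b := e v 1 with hb
  have hv : v = chart e (a, b) := (chart_coords e v).symm
  have hG : ContDiff ℝ 1 fun z : ℝ × ℝ => f (chart e z) := hf.comp (chart e).contDiff
  have hGc : HasCompactSupport fun z : ℝ × ℝ => f (chart e z) :=
    hc.comp_homeomorph (chart e).toHomeomorph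
  have hd : ∀ z : ℝ × ℝ, fderiv ℝ (fun z : ℝ × ℝ => f (chart e z)) z (a, b)
      = fderiv ℝ f (chart e z) v := fun z => by
    rw [hv]
    exact DFunLike.congr_fun ((hf.differentiable (by simp) _).hasFDerivAt.comp z
      (chart e).hasFDerivAt).fderiv (a, b)
  have hlhs : ∫ y in Ω, fderiv ℝ f y v
      = ∫ z in {z : ℝ × ℝ | h z.1 < z.2}, fderiv ℝ (fun z : ℝ × ℝ => f (chart e z)) z (a, b) := by
    have hms : MeasurableSet {z : ℝ × ℝ | h z.1 < z.2} :=
      measurableSet_lt (H.lip.continuous.measurable.comp measurable_fst) measurable_snd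
    rw [← (measurePreserving_chart e).setIntegral_preimage_emb
      (chart e).toHomeomorph.measurableEmbedding,
      ← integral_indicator ((chart e).continuous.measurable hΩ.measurableSet),
      ← integral_indicator hms]
    refine integral_congr_ae (Eventually.of_forall fun z => ?_)
    by_cases hz : chart e z ∈ Metric.ball x₀ r
    · have h1 := H.mem_iff _ hz
      rw [chart_fst, chart_snd] at h1
      by_cases hzΩ : chart e z ∈ Ω
      · rw [indicator_of_mem (by exact hzΩ), indicator_of_mem (by exact h1.1 hzΩ), hd]
      · rw [indicator_of_notMem (by exact hzΩ),
          indicator_of_notMem (by exact fun hlt => hzΩ (h1.2 hlt))]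
    · have h1 : fderiv ℝ f (chart e z) v = 0 := by
        rw [fderiv_eq_zero_of_notMem_tsupport fun hz' => hz (hs hz')]; rfl
      have h2 : ∀ S : Set (ℝ × ℝ), ∀ g : ℝ × ℝ → ℝ, g z = 0 → S.indicator g z = 0 := by
        intro S g hg
        by_cases hz : z ∈ S
        · rw [indicator_of_mem hz, hg]
        · rw [indicator_of_notMem hz]
      rw [h2 _ _ h1, h2 _ _ ((hd z).trans h1)]
  rw [hlhs, integral_above_graph hG hGc H.lip]
  have hemb := measurableEmbedding_graphMap (e := e) H.lip
  have hm := hemb.measurable (measurableSet_ball (x := x₀) (ε := r))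
  have hf0 : ∀ y, y ∉ Metric.ball x₀ r → f y = 0 := fun y hy =>
    image_eq_zero_of_notMem_tsupport fun hy' => hy (hs hy')
  rw [← setIntegral_eq_integral_of_forall_compl_eq_zero (s := Metric.ball x₀ r)
    (f := fun y => f y * inner ℝ (outwardNormal Ω y) v) (fun y hy => by rw [hf0 y hy, zero_mul]),
    H.bdryMeasure_restrict hΩ measurableSet_ball subset_rfl, hemb.integral_map,
    restrict_withDensity hm, integral_withDensity_eq_integral_toReal_smul
      (measurable_lineElement h).ennreal_ofReal (Eventually.of_forall fun _ => by simp),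
    ← setIntegral_eq_integral_of_forall_compl_eq_zero (s := graphMap e h ⁻¹' Metric.ball x₀ r)]
  · refine setIntegral_congr_ae hm ?_
    filter_upwards [H.lip.ae_differentiableAt_real] with x hx hxb
    have hJ : 0 < lineElement h x := lt_of_lt_of_le one_pos (one_le_lineElement h x)
    rw [H.outwardNormal_graphMap hxb hx, ENNReal.toReal_ofReal hJ.le, hv, graphNormal, inner_chart,
      smul_eq_mul, graphMap]
    field_simp
    ring
  · intro x hx
    rw [show f (chart e (x, h x)) = 0 from hf0 _ hx, zero_mul]

theorem HasDivergenceFormula.add {Ω : Set Plane} (hΩ : IsBoundedLipschitz Ω)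
    [IsFiniteMeasure (bdryMeasure Ω)] {f g : Plane → ℝ}
    (hf : ContDiff ℝ 1 f) (hfc : HasCompactSupport f) (hg : ContDiff ℝ 1 g)
    (hgc : HasCompactSupport g)
    (Hf : HasDivergenceFormula Ω f) (Hg : HasDivergenceFormula Ω g) :
    HasDivergenceFormula Ω fun y => f y + g y := by
  intro v
  have hi : ∀ f : Plane → ℝ, ContDiff ℝ 1 f → HasCompactSupport f →
      Integrable (fun y => fderiv ℝ f y v) (volume.restrict Ω) := fun f hf hfc =>
    ((continuous_fderiv_apply_const hf v).integrable_of_hasCompactSupport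
      (hfc.fderiv_apply ℝ v)).restrict
  have hb : ∀ f : Plane → ℝ, ContDiff ℝ 1 f → HasCompactSupport f →
      Integrable (fun y => f y * inner ℝ (outwardNormal Ω y) v) (bdryMeasure Ω) := by
    intro f hf hfc
    obtain ⟨C, hC⟩ := hfc.exists_bound_of_continuous hf.continuous
    refine Integrable.of_bound (C := C * ‖v‖) ?_ ?_
    · exact hf.continuous.aestronglyMeasurable.mul
        (hΩ.aemeasurable_outwardNormal.aestronglyMeasurable.inner aestronglyMeasurable_const)
    · refine Eventually.of_forall fun y => ?_
      rw [norm_mul]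
      refine mul_le_mul (hC y) ((norm_inner_le_norm _ _).trans ?_) (norm_nonneg _)
        ((norm_nonneg _).trans (hC y))
      exact mul_le_of_le_one_left (norm_nonneg _) (norm_outwardNormal_le Ω y)
  have hd : ∀ y, fderiv ℝ (fun y => f y + g y) y v = fderiv ℝ f y v + fderiv ℝ g y v := fun y => by
    rw [fderiv_fun_add (hf.differentiable (by simp) y) (hg.differentiable (by simp) y)]
    rfl
  simp only [hd, add_mul]
  rw [integral_add (hi f hf hfc) (hi g hg hgc), integral_add (hb f hf hfc) (hb g hg hgc), Hf v, Hg v]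

/-- Both sides are zero: f vanishes on the boundary, and the derivative of a compactly supported
function has zero integral over the plane. -/
theorem HasDivergenceFormula.of_tsupport_subset {Ω : Set Plane} (hΩ : IsOpen Ω) {f : Plane → ℝ}
    (hf : ContDiff ℝ 1 f) (hc : HasCompactSupport f) (hs : tsupport f ⊆ Ω) :
    HasDivergenceFormula Ω f := by
  intro v
  have h0 : ∀ y, y ∉ tsupport f → fderiv ℝ f y v = 0 := fun y hy => by
    rw [fderiv_eq_zero_of_notMem_tsupport hy]; rfl
  have h1 : ∫ y in Ω, fderiv ℝ f y v = ∫ y, fderiv ℝ f y v :=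
    setIntegral_eq_integral_of_forall_compl_eq_zero fun y hy => h0 y fun hy' => hy (hs hy')
  have h2 : ∫ y, f y * inner ℝ (outwardNormal Ω y) v ∂(bdryMeasure Ω) = 0 := by
    rw [bdryMeasure]
    refine setIntegral_eq_zero_of_forall_eq_zero fun y hy => ?_
    have : y ∉ tsupport f := fun hy' => by
      rw [hΩ.frontier_eq] at hy
      exact hy.2 (hs hy')
    rw [image_eq_zero_of_notMem_tsupport this, zero_mul]
  rw [h1, h2]
  obtain ⟨K, hK⟩ := hf.lipschitzWith_of_hasCompactSupport hc (by simp)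
  have h3 := LipschitzWith.integral_lineDeriv_mul_eq (μ := (volume : Measure Plane))
    (LipschitzWith.const (1 : ℝ)) hK hc (-v)
  have h4 : ∀ x, lineDeriv ℝ (fun _ : Plane => (1 : ℝ)) x (-v) = 0 := fun x => by simp [lineDeriv]
  have h5 : ∀ x, lineDeriv ℝ f x v = fderiv ℝ f x v := fun x =>
    (hf.differentiable (by simp) x).lineDeriv_eq_fderiv
  simp only [h4, neg_neg, h5, zero_mul, integral_zero, mul_one] at h3
  exact h3.symm

/-- The trace inequality applied to the constant function 1 bounds the length of the boundary by a
multiple of the area. -/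
theorem IsBoundedLipschitz.isFiniteMeasure_bdryMeasure {Ω : Set Plane}
    (hΩ : IsBoundedLipschitz Ω) : IsFiniteMeasure (bdryMeasure Ω) := by
  obtain ⟨C, hC, H⟩ := hΩ.exists_trace_ineq
  have h1 := H (fun _ => 1) contDiff_const
  refine ⟨?_⟩
  simp only [enorm_one, lintegral_const, one_mul] at h1
  refine h1.trans_lt (ENNReal.mul_lt_top hC.lt_top ?_)
  have : ∀ z : Plane, (1 : ℝ≥0∞) + ‖fderiv ℝ (fun _ : Plane => (1 : ℝ)) z‖ₑ = 1 := fun z => by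
    rw [fderiv_fun_const, Pi.zero_apply, enorm_eq_nnnorm, nnnorm_zero, ENNReal.coe_zero, add_zero]
  simp only [this, lintegral_const, Measure.restrict_apply_univ, one_mul]
  exact hΩ.isBounded.measure_lt_top

/-- The divergence theorem on a bounded Lipschitz domain. -/
theorem IsBoundedLipschitz.hasDivergenceFormula {Ω : Set Plane} (hΩ : IsBoundedLipschitz Ω)
    {f : Plane → ℝ} (hf : ContDiff ℝ 1 f) (hc : HasCompactSupport f) :
    HasDivergenceFormula Ω f := by
  have := hΩ.isFiniteMeasure_bdryMeasure
  -- The formula is local: interior points, boundary points and exterior points each have a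
  -- neighbourhood in which it holds for functions supported there.
  have hloc : ∀ x : Plane, ∃ U : Set Plane, IsOpen U ∧ x ∈ U ∧ ∀ g : Plane → ℝ, ContDiff ℝ 1 g →
      HasCompactSupport g → tsupport g ⊆ U → HasDivergenceFormula Ω g := by
    intro x
    by_cases hxΩ : x ∈ Ω
    · exact ⟨Ω, hΩ.isOpen, hxΩ, fun g hg hgc hgs => .of_tsupport_subset hΩ.isOpen hg hgc hgs⟩
    by_cases hxc : x ∈ closure Ω
    · obtain ⟨r, e, L, h, H⟩ := hΩ.exists_localGraph (x := x)
        (by rw [hΩ.isOpen.frontier_eq]; exact ⟨hxc, hxΩ⟩)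
      exact ⟨_, Metric.isOpen_ball, Metric.mem_ball_self H.pos, fun g hg hgc hgs =>
        H.hasDivergenceFormula hΩ.isOpen hg hgc hgs⟩
    · refine ⟨(closure Ω)ᶜ, isClosed_closure.isOpen_compl, hxc, fun g hg hgc hgs v => ?_⟩
      rw [setIntegral_eq_zero_of_forall_eq_zero, bdryMeasure, setIntegral_eq_zero_of_forall_eq_zero]
      · intro y hy
        have : y ∉ tsupport g := fun h => hgs h (frontier_subset_closure hy)
        rw [image_eq_zero_of_notMem_tsupport this, zero_mul]
      · intro y hy
        rw [fderiv_eq_zero_of_notMem_tsupport fun h => hgs h (subset_closure hy)]; rfl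
  choose U hUo hxU hU using hloc
  obtain ⟨t, ht⟩ := hc.elim_finite_subcover U hUo fun x _ => mem_iUnion.2 ⟨x, hxU x⟩
  -- A partition of unity on the support of f, subordinate to finitely many such neighbourhoods,
  -- reduces the formula to the local cases.
  obtain ⟨ρ, hρ⟩ := SmoothPartitionOfUnity.exists_isSubordinate (modelWithCornersSelf ℝ Plane)
    (isClosed_tsupport f) (fun i : t => U i) (fun i => hUo i) (by
      refine ht.trans (iUnion₂_subset fun i hi => ?_)
      exact subset_iUnion (fun i : t => U i) ⟨i, hi⟩)
  have hρc : ∀ i, ContDiff ℝ 1 (ρ i) := fun i => ((ρ i).contMDiff.contDiff).of_le (by simp)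
  have hdec : f = fun y => ∑ i, ρ i y * f y := by
    funext y
    rw [← Finset.sum_mul]
    by_cases hy : y ∈ tsupport f
    · have := ρ.sum_eq_one hy
      rw [finsum_eq_sum_of_fintype] at this
      rw [this, one_mul]
    · rw [image_eq_zero_of_notMem_tsupport hy, mul_zero]
  have hpc : ∀ i, HasCompactSupport fun y => ρ i y * f y := fun i => hc.mul_left
  have hpd : ∀ i, ContDiff ℝ 1 fun y => ρ i y * f y := fun i => (hρc i).mul hf
  have hpiece : ∀ i, HasDivergenceFormula Ω fun y => ρ i y * f y := fun i =>
    hU i _ (hpd i) (hpc i) ((tsupport_mul_subset_left).trans (hρ i))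
  have hsum : ∀ s : Finset t, ContDiff ℝ 1 (fun y => ∑ i ∈ s, ρ i y * f y) ∧
      HasCompactSupport (fun y => ∑ i ∈ s, ρ i y * f y) ∧
      HasDivergenceFormula Ω fun y => ∑ i ∈ s, ρ i y * f y := by
    intro s
    classical
    induction s using Finset.induction_on with
    | empty =>
      refine ⟨?_, ?_, fun v => ?_⟩
      · simpa using contDiff_const
      · simp only [Finset.sum_empty]
        exact HasCompactSupport.zero
      · simp
    | insert i s hi ih =>
      obtain ⟨h1, h2, h3⟩ := ih
      simp only [Finset.sum_insert hi]
      exact ⟨(hpd i).add h1, (hpc i).add h2, (hpiece i).add hΩ (hpd i) (hpc i) h1 h2 h3⟩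
  rw [hdec]
  exact (hsum Finset.univ).2.2

end NSD

end

noncomputable section

namespace NSD

/-! ### Multiplicative inequalities for smooth functions -/

/-- The `L²` norm of a nonnegative function. -/
def l2Norm (μ : Measure Plane) (u : Plane → ℝ≥0∞) : ℝ≥0∞ := (∫⁻ y, u y ^ 2 ∂μ) ^ (1 / 2 : ℝ)

theorem l2Norm_sq (μ : Measure Plane) (u : Plane → ℝ≥0∞) :
    l2Norm μ u ^ 2 = ∫⁻ y, u y ^ 2 ∂μ := by
  rw [l2Norm, ← ENNReal.rpow_natCast, ← ENNReal.rpow_mul]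
  norm_num

theorem lintegral_mul_le_l2Norm {μ : Measure Plane} {u v : Plane → ℝ≥0∞} (hu : AEMeasurable u μ)
    (hv : AEMeasurable v μ) : ∫⁻ y, u y * v y ∂μ ≤ l2Norm μ u * l2Norm μ v := by
  have := ENNReal.lintegral_mul_le_Lp_mul_Lq μ Real.HolderConjugate.two_two hu hv
  simpa [l2Norm, Pi.mul_apply] using this

theorem l2Norm_add_le {μ : Measure Plane} {u v : Plane → ℝ≥0∞} (hu : AEMeasurable u μ)
    (hv : AEMeasurable v μ) : l2Norm μ (fun y => u y + v y) ≤ l2Norm μ u + l2Norm μ v := by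
  have := ENNReal.lintegral_Lp_add_le (p := 2) hu hv (by norm_num)
  simpa [l2Norm, Pi.add_apply] using this

theorem eLpNorm_two_eq_l2Norm {F : Type*} [NormedAddCommGroup F] (μ : Measure Plane)
    (f : Plane → F) : eLpNorm f 2 μ = l2Norm μ fun y => ‖f y‖ₑ := by
  rw [eLpNorm_eq_lintegral_rpow_enorm_toReal (by norm_num) (by norm_num), l2Norm]
  simp

theorem eLpNorm_four_pow {F : Type*} [NormedAddCommGroup F] (μ : Measure Plane)
    (f : Plane → F) : eLpNorm f 4 μ ^ 4 = ∫⁻ y, ‖f y‖ₑ ^ 4 ∂μ := by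
  rw [eLpNorm_eq_lintegral_rpow_enorm_toReal (by norm_num) (by norm_num), ← ENNReal.rpow_natCast,
    ← ENNReal.rpow_mul]
  simp

theorem eLpNorm_two_pow {F : Type*} [NormedAddCommGroup F] (μ : Measure Plane)
    (f : Plane → F) : eLpNorm f 2 μ ^ 2 = ∫⁻ y, ‖f y‖ₑ ^ 2 ∂μ := by
  rw [eLpNorm_two_eq_l2Norm, l2Norm_sq]

variable {F : Type} [NormedAddCommGroup F] [InnerProductSpace ℝ F]

theorem norm_fderiv_le_sum (A : Plane →L[ℝ] F) : ‖A‖ₑ ≤ ∑ i, ‖A (basisVec i)‖ₑ := by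
  have h : ‖A‖ ≤ ∑ i, ‖A (basisVec i)‖ := by
    refine A.opNorm_le_bound (Finset.sum_nonneg fun _ _ => norm_nonneg _) fun x => ?_
    have hx : x = ∑ i, x i • basisVec i := by
      ext j
      fin_cases j <;> simp [basisVec]
    nth_rewrite 1 [hx]
    rw [map_sum, Finset.sum_mul]
    refine (norm_sum_le _ _).trans (Finset.sum_le_sum fun i _ => ?_)
    rw [map_smul, norm_smul, mul_comm]
    gcongr
    exact PiLp.norm_apply_le x i
  rw [← ofReal_norm]
  refine (ENNReal.ofReal_le_ofReal h).trans ?_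
  rw [ENNReal.ofReal_sum_of_nonneg fun _ _ => norm_nonneg _]
  simp only [ofReal_norm, le_refl]

/-- Exponents from 2 on make the power of the norm C¹ even at zeros of ψ. These scalar functions are
the ones put into the W^{1,1} inequalities. -/
theorem enorm_fderiv_norm_pow_le {ψ : Plane → F} (hψ : ContDiff ℝ 1 ψ) (k : ℕ) (y : Plane) :
    ContDiff ℝ 1 (fun x => ‖ψ x‖ ^ (k + 2)) ∧
    ‖fderiv ℝ (fun x => ‖ψ x‖ ^ (k + 2)) y‖ₑ
      ≤ (k + 2 : ℕ) * (‖ψ y‖ₑ ^ (k + 1) * ‖fderiv ℝ ψ y‖ₑ) := by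
  have h1 : (1 : ℝ) < ((k + 2 : ℕ) : ℝ) := by push_cast; linarith [k.cast_nonneg (α := ℝ)]
  have e1 : (fun x => ‖ψ x‖ ^ (k + 2)) = fun x => ‖ψ x‖ ^ ((k + 2 : ℕ) : ℝ) := by
    funext x; rw [Real.rpow_natCast]
  have e2 : ‖ψ y‖ ^ (((k + 2 : ℕ) : ℝ) - 1) = ‖ψ y‖ ^ (k + 1) := by
    rw [← Real.rpow_natCast]
    congr 1
    push_cast
    ring
  constructor
  · rw [e1]
    exact hψ.norm_rpow h1
  · have h2 := norm_fderiv_norm_rpow_le (hψ.differentiable (by simp)) (x := y) h1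
    rw [← e1, e2] at h2
    have h3 := ENNReal.ofReal_le_ofReal h2
    rw [ofReal_norm, ENNReal.ofReal_mul (by positivity),
      ENNReal.ofReal_mul (by positivity), ENNReal.ofReal_pow (norm_nonneg _), ofReal_norm,
      ofReal_norm, ENNReal.ofReal_natCast, mul_assoc] at h3
    exact h3

/-- The chain rule lowers the power by one and produces one factor |ψ| + |Dψ|; Cauchy–Schwarz
separates the two. -/
theorem lintegral_pow_density_le {μ : Measure Plane} {ψ : Plane → F} (hψ : ContDiff ℝ 1 ψ)
    (k : ℕ) : ∫⁻ y, (‖‖ψ y‖ ^ (k + 2)‖ₑ + ‖fderiv ℝ (fun x => ‖ψ x‖ ^ (k + 2)) y‖ₑ) ∂μ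
      ≤ (k + 2 : ℕ) * (l2Norm μ (fun y => ‖ψ y‖ₑ ^ (k + 1)) *
        (l2Norm μ (fun y => ‖ψ y‖ₑ) + l2Norm μ fun y => ‖fderiv ℝ ψ y‖ₑ)) := by
  have hm : Measurable fun y => ‖ψ y‖ₑ := hψ.continuous.enorm.measurable
  have hm' : Measurable fun y => ‖fderiv ℝ ψ y‖ₑ :=
    (hψ.continuous_fderiv (by simp)).enorm.measurable
  calc _ ≤ ∫⁻ y, (k + 2 : ℕ) * (‖ψ y‖ₑ ^ (k + 1) * (‖ψ y‖ₑ + ‖fderiv ℝ ψ y‖ₑ)) ∂μ := by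
        refine lintegral_mono fun y => ?_
        have h1 := (enorm_fderiv_norm_pow_le hψ k y).2
        have h2 : ‖‖ψ y‖ ^ (k + 2)‖ₑ ≤ (k + 2 : ℕ) * (‖ψ y‖ₑ ^ (k + 1) * ‖ψ y‖ₑ) := by
          rw [enorm_pow, enorm_norm, ← pow_succ]
          refine le_mul_of_one_le_left bot_le ?_
          exact_mod_cast (by omega : 1 ≤ k + 2)
        refine (add_le_add h2 h1).trans (le_of_eq ?_)
        ring
    _ = (k + 2 : ℕ) * ∫⁻ y, ‖ψ y‖ₑ ^ (k + 1) * (‖ψ y‖ₑ + ‖fderiv ℝ ψ y‖ₑ) ∂μ :=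
        lintegral_const_mul' _ _ (by simp)
    _ ≤ _ := by
        gcongr
        refine (lintegral_mul_le_l2Norm (hm.pow_const _).aemeasurable
          (hm.add hm').aemeasurable).trans ?_
        gcongr
        exact l2Norm_add_le hm.aemeasurable hm'.aemeasurable

variable (F) in
/-- Interior and boundary estimates for smooth functions on a bounded Lipschitz domain. -/
theorem IsBoundedLipschitz.exists_smooth_bounds {Ω : Set Plane} (hΩ : IsBoundedLipschitz Ω) :
    ∃ C : ℝ≥0∞, C ≠ ⊤ ∧ ∀ ψ : Plane → F, ContDiff ℝ 1 ψ → ∀ N : ℝ≥0∞,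
      eLpNorm ψ 2 (volume.restrict Ω)
        + ∑ i, eLpNorm (fun y => fderiv ℝ ψ y (basisVec i)) 2 (volume.restrict Ω) ≤ N →
      eLpNorm ψ 4 (volume.restrict Ω) ^ 2 ≤ C * (eLpNorm ψ 2 (volume.restrict Ω) * N) ∧
      eLpNorm ψ 2 (bdryMeasure Ω) ^ 2 ≤ C * (eLpNorm ψ 2 (volume.restrict Ω) * N) ∧
      eLpNorm ψ 4 (bdryMeasure Ω) ≤ C * N := by
  obtain ⟨C₁, hC₁, H₁⟩ := hΩ.exists_gagliardo
  obtain ⟨C₂, hC₂, H₂⟩ := hΩ.exists_trace_ineq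
  set c : ℝ≥0∞ := 1 + C₁ + C₂ with hc
  have hc1 : 1 ≤ c := by rw [hc, add_assoc]; exact le_self_add
  have hcC₁ : C₁ ≤ c := by rw [hc, add_right_comm]; exact le_add_self
  have hcC₂ : C₂ ≤ c := le_add_self
  have hcT : c ≠ ⊤ := by finiteness
  set μ : Measure Plane := volume.restrict Ω with hμ
  refine ⟨24 * c ^ 3, by finiteness, fun ψ hψ N hN => ?_⟩
  set a := eLpNorm ψ 2 μ with ha
  have hm : Measurable fun y => ‖ψ y‖ₑ := hψ.continuous.enorm.measurable
  have hNb : l2Norm μ (fun y => ‖ψ y‖ₑ) + l2Norm μ (fun y => ‖fderiv ℝ ψ y‖ₑ) ≤ N := by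
    refine le_trans ?_ hN
    rw [← eLpNorm_two_eq_l2Norm, ← ha]
    gcongr
    have hm' : ∀ i, Measurable fun y => ‖fderiv ℝ ψ y (basisVec i)‖ₑ := fun i =>
      ((hψ.continuous_fderiv (by simp)).clm_apply continuous_const).enorm.measurable
    simp only [eLpNorm_two_eq_l2Norm, Fin.sum_univ_two]
    refine le_trans ?_ (l2Norm_add_le (hm' 0).aemeasurable (hm' 1).aemeasurable)
    rw [l2Norm, l2Norm]
    gcongr with y
    have := norm_fderiv_le_sum (fderiv ℝ ψ y)
    rwa [Fin.sum_univ_two] at this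
  have haN : a ≤ N := le_self_add.trans hN
  have hsq : ∀ x y : ℝ≥0∞, x ^ 2 ≤ y ^ 2 → x ≤ y := fun x y h =>
    (ENNReal.pow_le_pow_left_iff (by norm_num)).1 h
  -- interior bound for powers
  have hint : ∀ k : ℕ, l2Norm μ (fun y => ‖ψ y‖ₑ ^ (k + 2))
      ≤ (k + 2 : ℕ) * c * (l2Norm μ (fun y => ‖ψ y‖ₑ ^ (k + 1)) * N) := by
    intro k
    apply hsq
    have h1 := H₁ _ (enorm_fderiv_norm_pow_le hψ k 0).1
    have h2 := lintegral_pow_density_le (μ := μ) hψ k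
    rw [l2Norm_sq]
    simp only [enorm_pow, enorm_norm] at h1 h2
    refine h1.trans ?_
    calc C₁ * _ ^ 2 ≤ c ^ 2 * ((k + 2 : ℕ) * (l2Norm μ (fun y => ‖ψ y‖ₑ ^ (k + 1)) * N)) ^ 2 := by
          have h3 : C₁ ≤ c ^ 2 := by
            rw [sq]
            exact hcC₁.trans (le_mul_of_one_le_left bot_le hc1)
          gcongr
          refine h2.trans ?_
          gcongr
      _ = _ := by ring
  have hbd : ∀ k : ℕ, ∫⁻ y, ‖ψ y‖ₑ ^ (k + 2) ∂(bdryMeasure Ω)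
      ≤ (k + 2 : ℕ) * c * (l2Norm μ (fun y => ‖ψ y‖ₑ ^ (k + 1)) * N) := by
    intro k
    have h1 := H₂ _ (enorm_fderiv_norm_pow_le hψ k 0).1
    have h2 := lintegral_pow_density_le (μ := μ) hψ k
    simp only [enorm_pow, enorm_norm] at h1 h2
    refine h1.trans ?_
    calc C₂ * _ ≤ c * ((k + 2 : ℕ) * (l2Norm μ (fun y => ‖ψ y‖ₑ ^ (k + 1)) * N)) := by
          gcongr
          refine h2.trans ?_
          gcongr
      _ = _ := by ring
  have e0 : l2Norm μ (fun y => ‖ψ y‖ₑ ^ (0 + 1)) = a := by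
    simp only [zero_add, pow_one]
    rw [ha, eLpNorm_two_eq_l2Norm]
  -- Index 0 gives Ladyzhenskaya's inequality inside and the multiplicative trace inequality on the
  -- boundary. The boundary L⁴ bound takes index 2 on the boundary and then lowers the interior
  -- power with indices 1 and 0.
  have i2 := hint 0
  have i3 := hint 1
  have b2 := hbd 0
  have b4 := hbd 2
  rw [e0] at i2 b2
  simp only [zero_add, Nat.cast_ofNat, Nat.reduceAdd] at i2 i3 b2 b4
  have hk : 2 * c ≤ 24 * c ^ 3 := by
    calc 2 * c ≤ 24 * c * (1 * 1) := by rw [mul_one, mul_one]; gcongr; norm_num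
      _ ≤ 24 * c * (c * c) := by gcongr
      _ = _ := by ring
  refine ⟨?_, ?_, ?_⟩
  · refine le_trans (hsq _ _ ?_) (mul_le_mul_left hk (a * N))
    rw [← pow_mul, eLpNorm_four_pow]
    calc ∫⁻ y, ‖ψ y‖ₑ ^ 4 ∂μ = l2Norm μ (fun y => ‖ψ y‖ₑ ^ 2) ^ 2 := by
          rw [l2Norm_sq]; simp only [← pow_mul]
      _ ≤ _ := by gcongr
  · rw [eLpNorm_two_pow]
    exact b2.trans (mul_le_mul_left hk (a * N))
  · refine (ENNReal.pow_le_pow_left_iff (by norm_num : (4 : ℕ) ≠ 0)).1 ?_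
    rw [eLpNorm_four_pow]
    calc ∫⁻ y, ‖ψ y‖ₑ ^ 4 ∂(bdryMeasure Ω)
        ≤ 4 * c * (3 * c * (2 * c * (N * N) * N) * N) := by
          refine b4.trans ?_
          gcongr
          refine i3.trans ?_
          gcongr
          refine i2.trans ?_
          gcongr
      _ = 24 * c ^ 3 * N ^ 4 := by ring
      _ ≤ (24 * c ^ 3) ^ 4 * N ^ 4 := by
          gcongr
          refine le_self_pow₀ ?_ (by norm_num)
          calc (1 : ℝ≥0∞) ≤ 1 * 1 ^ 3 := by simp
            _ ≤ 24 * c ^ 3 := by gcongr; norm_num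
      _ = _ := (mul_pow (24 * c ^ 3) N 4).symm

end NSD

end

noncomputable section

namespace NSD

/-! ### Estimates for functions with a trace -/

section Closure

variable {F : Type} [NormedAddCommGroup F]

/-- Convergence in L² gives an a.e. convergent subsequence, and Fatou's lemma carries a bound in any
other exponent, here 4, to the limit. -/
theorem eLpNorm_pow_le_of_tendsto {μ : Measure Plane} {f : Plane → F} {ψ : ℕ → Plane → F}
    (hf : AEStronglyMeasurable f μ) (hψ : ∀ n, AEStronglyMeasurable (ψ n) μ)
    (h : Tendsto (fun n => eLpNorm (fun x => f x - ψ n x) 2 μ) atTop (𝓝 0))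
    {p : ℝ≥0∞} {k : ℕ} (hk : k ≠ 0) {c : ℕ → ℝ≥0∞} {c₀ : ℝ≥0∞} (hc : Tendsto c atTop (𝓝 c₀))
    (hle : ∀ n, eLpNorm (ψ n) p μ ^ k ≤ c n) : eLpNorm f p μ ^ k ≤ c₀ := by
  have hm : TendstoInMeasure μ ψ atTop f := by
    refine tendstoInMeasure_of_tendsto_eLpNorm (p := 2) (by norm_num) hψ hf ?_
    refine h.congr fun n => ?_
    rw [← eLpNorm_neg]
    congr 1
    funext x
    simp
  obtain ⟨ns, hns, hae⟩ := hm.exists_seq_tendsto_ae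
  have hlim : Tendsto (fun n => c (ns n) ^ ((k : ℝ)⁻¹)) atTop (𝓝 (c₀ ^ ((k : ℝ)⁻¹))) :=
    ((ENNReal.continuous_rpow_const.tendsto c₀).comp hc).comp hns.tendsto_atTop
  have hk' : (0 : ℝ) < k := by positivity
  have hle' : ∀ n, eLpNorm (ψ (ns n)) p μ ≤ c (ns n) ^ ((k : ℝ)⁻¹) := fun n => by
    rw [ENNReal.le_rpow_inv_iff hk', ENNReal.rpow_natCast]
    exact hle _
  have h1 : eLpNorm f p μ ≤ c₀ ^ ((k : ℝ)⁻¹) :=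
    (Lp.eLpNorm_lim_le_liminf_eLpNorm (fun n => hψ (ns n)) f hae).trans
      ((liminf_le_liminf (Eventually.of_forall hle')).trans hlim.liminf_eq.le)
  calc eLpNorm f p μ ^ k ≤ (c₀ ^ ((k : ℝ)⁻¹)) ^ k := by gcongr
    _ = c₀ := ENNReal.rpow_inv_natCast_pow hk c₀

theorem eLpNorm_le_add_sub {μ : Measure Plane} {f ψ : Plane → F} (hf : AEStronglyMeasurable f μ)
    (hψ : AEStronglyMeasurable ψ μ) :
    eLpNorm ψ 2 μ ≤ eLpNorm f 2 μ + eLpNorm (fun x => f x - ψ x) 2 μ := by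
  have e : ψ = f - fun x => f x - ψ x := by
    funext x
    simp
  nth_rewrite 1 [e]
  exact eLpNorm_sub_le hf (hf.sub hψ) (by norm_num)

variable [InnerProductSpace ℝ F]

/-- The functions `f`, `G`, `b` are the limits in `L²` of the values, of the partial derivatives
and of the boundary values of a sequence `ψ` of smooth functions. -/
structure IsSmoothLimit (Ω : Set Plane) (f : Plane → F) (G : Fin 2 → Plane → F) (b : Plane → F)
    (ψ : ℕ → Plane → F) : Prop where
  memLp : MemLp f 2 (volume.restrict Ω)
  memLp_grad : ∀ i, MemLp (G i) 2 (volume.restrict Ω)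
  memLp_bdry : MemLp b 2 (bdryMeasure Ω)
  contDiff : ∀ n, ContDiff ℝ ∞ (ψ n)
  hasCompactSupport : ∀ n, HasCompactSupport (ψ n)
  tendsto : Tendsto (fun n => eLpNorm (fun x => f x - ψ n x) 2 (volume.restrict Ω)) atTop (𝓝 0)
  tendsto_grad : ∀ i, Tendsto (fun n => eLpNorm (fun x => G i x - fderiv ℝ (ψ n) x (basisVec i)) 2
    (volume.restrict Ω)) atTop (𝓝 0)
  tendsto_bdry : Tendsto (fun n => eLpNorm (fun x => b x - ψ n x) 2 (bdryMeasure Ω)) atTop (𝓝 0)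

variable (F) in
-- Each approximant satisfies the smooth bounds with the norms of the limit enlarged by the
-- approximation errors; these tend to zero.
theorem IsBoundedLipschitz.exists_limit_bounds {Ω : Set Plane} (hΩ : IsBoundedLipschitz Ω) :
    ∃ C : ℝ≥0∞, C ≠ ⊤ ∧ ∀ (f : Plane → F) (G : Fin 2 → Plane → F) (b : Plane → F)
      (ψ : ℕ → Plane → F), IsSmoothLimit Ω f G b ψ → ∀ N : ℝ≥0∞,
      eLpNorm f 2 (volume.restrict Ω) + ∑ i, eLpNorm (G i) 2 (volume.restrict Ω) = N →
      eLpNorm f 4 (volume.restrict Ω) ^ 2 ≤ C * (eLpNorm f 2 (volume.restrict Ω) * N) ∧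
      eLpNorm b 2 (bdryMeasure Ω) ^ 2 ≤ C * (eLpNorm f 2 (volume.restrict Ω) * N) ∧
      eLpNorm b 4 (bdryMeasure Ω) ≤ C * N := by
  obtain ⟨C, hC, H⟩ := hΩ.exists_smooth_bounds F
  refine ⟨C, hC, fun f G b ψ h N hN => ?_⟩
  set μ : Measure Plane := volume.restrict Ω with hμ
  set α : ℕ → ℝ≥0∞ := fun n => eLpNorm f 2 μ + eLpNorm (fun x => f x - ψ n x) 2 μ with hα
  set γ : ℕ → ℝ≥0∞ := fun n => α n + ∑ i, (eLpNorm (G i) 2 μ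
    + eLpNorm (fun x => G i x - fderiv ℝ (ψ n) x (basisVec i)) 2 μ) with hγ
  have hψc : ∀ n, Continuous (ψ n) := fun n => (h.contDiff n).continuous
  have hψd : ∀ n i, Continuous fun x => fderiv ℝ (ψ n) x (basisVec i) := fun n i =>
    ((h.contDiff n).continuous_fderiv (by simp)).clm_apply continuous_const
  have hf0 : eLpNorm f 2 μ ≠ ⊤ := h.memLp.2.ne
  have hα0 : Tendsto α atTop (𝓝 (eLpNorm f 2 μ)) := by
    simpa using tendsto_const_nhds.add h.tendsto
  have hγ0 : Tendsto γ atTop (𝓝 N) := by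
    rw [← hN]
    refine hα0.add (tendsto_finsetSum _ fun i _ => ?_)
    simpa using tendsto_const_nhds.add (h.tendsto_grad i)
  have hN0 : N ≠ ⊤ := by
    rw [← hN]
    exact ENNReal.add_ne_top.2 ⟨hf0, ENNReal.sum_ne_top.2 fun i _ => (h.memLp_grad i).2.ne⟩
  have hαψ : ∀ n, eLpNorm (ψ n) 2 μ ≤ α n := fun n =>
    eLpNorm_le_add_sub h.memLp.1 (hψc n).aestronglyMeasurable
  have hγψ : ∀ n, eLpNorm (ψ n) 2 μ + ∑ i, eLpNorm (fun x => fderiv ℝ (ψ n) x (basisVec i)) 2 μ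
      ≤ γ n := fun n => add_le_add (hαψ n) (Finset.sum_le_sum fun i _ =>
        eLpNorm_le_add_sub (h.memLp_grad i).1 (hψd n i).aestronglyMeasurable)
  have hprod : Tendsto (fun n => C * (α n * γ n)) atTop (𝓝 (C * (eLpNorm f 2 μ * N))) :=
    ENNReal.Tendsto.const_mul (ENNReal.Tendsto.mul hα0 (Or.inr hN0) hγ0 (Or.inr hf0))
      (Or.inr hC)
  have hB := fun n => H (ψ n) ((h.contDiff n).of_le (by exact_mod_cast le_top)) (γ n) (hγψ n)
  refine ⟨?_, ?_, ?_⟩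
  · refine eLpNorm_pow_le_of_tendsto h.memLp.1 (fun n => (hψc n).aestronglyMeasurable) h.tendsto
      two_ne_zero hprod fun n => (hB n).1.trans ?_
    gcongr
    exact hαψ n
  · refine eLpNorm_pow_le_of_tendsto h.memLp_bdry.1 (fun n => (hψc n).aestronglyMeasurable)
      h.tendsto_bdry two_ne_zero hprod fun n => (hB n).2.1.trans ?_
    gcongr
    exact hαψ n
  · have := eLpNorm_pow_le_of_tendsto h.memLp_bdry.1 (fun n => (hψc n).aestronglyMeasurable)
      h.tendsto_bdry (p := 4) one_ne_zero (ENNReal.Tendsto.const_mul hγ0 (Or.inr hC))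
      fun n => by simpa using (hB n).2.2
    simpa using this

theorem IsTrace.exists_seq {Ω : Set Plane} {w : H1 F Ω} {b : Lp F 2 (bdryMeasure Ω)}
    (h : IsTrace w b) :
    ∃ ψ : ℕ → Plane → F, IsSmoothLimit Ω (val w) (fun i => grad w i) b ψ := by
  have h0 : Tendsto (fun n : ℕ => ((n : ℝ≥0∞) + 1)⁻¹) atTop (𝓝 0) := by
    have := (tendsto_add_atTop_iff_nat 1).2 ENNReal.tendsto_inv_nat_nhds_zero
    simpa using this
  choose ψ h1 h2 h3 h4 h5 using fun n : ℕ => h ((n : ℝ≥0∞) + 1)⁻¹ (by simp)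
  exact ⟨ψ, Lp.memLp _, fun i => Lp.memLp _, Lp.memLp _, h1, h2,
    tendsto_of_tendsto_of_tendsto_of_le_of_le tendsto_const_nhds h0 (fun _ => bot_le)
      fun n => (h3 n).le,
    fun i => tendsto_of_tendsto_of_tendsto_of_le_of_le tendsto_const_nhds h0 (fun _ => bot_le)
      fun n => (h4 n i).le,
    tendsto_of_tendsto_of_tendsto_of_le_of_le tendsto_const_nhds h0 (fun _ => bot_le)
      fun n => (h5 n).le⟩

/-- Subtracting a smooth function. -/
theorem IsSmoothLimit.sub_smooth {Ω : Set Plane} (hΩ : IsBoundedLipschitz Ω) {f : Plane → F}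
    {G : Fin 2 → Plane → F} {b : Plane → F} {ψ : ℕ → Plane → F} (h : IsSmoothLimit Ω f G b ψ)
    {χ : Plane → F} (hχ : ContDiff ℝ ∞ χ) (hχc : HasCompactSupport χ) :
    IsSmoothLimit Ω (fun x => f x - χ x) (fun i x => G i x - fderiv ℝ χ x (basisVec i))
      (fun x => b x - χ x) (fun n x => ψ n x - χ x) := by
  have := hΩ.isFiniteMeasure_bdryMeasure
  have hd : ∀ n x i, fderiv ℝ (fun x => ψ n x - χ x) x (basisVec i)
      = fderiv ℝ (ψ n) x (basisVec i) - fderiv ℝ χ x (basisVec i) := fun n x i => by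
    rw [fderiv_fun_sub (((h.contDiff n).differentiable (by simp)) x)
      ((hχ.differentiable (by simp)) x)]
    rfl
  refine ⟨h.memLp.sub (hχ.continuous.memLp_of_hasCompactSupport hχc), fun i =>
    (h.memLp_grad i).sub (((hχ.continuous_fderiv (by simp)).clm_apply
      continuous_const).memLp_of_hasCompactSupport (hχc.fderiv_apply ℝ (basisVec i))),
    h.memLp_bdry.sub (hχ.continuous.memLp_of_hasCompactSupport hχc),
    fun n => (h.contDiff n).sub hχ, fun n => (h.hasCompactSupport n).sub hχc, ?_, fun i => ?_, ?_⟩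
  · simpa using h.tendsto
  · simpa [hd] using h.tendsto_grad i
  · simpa using h.tendsto_bdry

theorem norm_val_le {Ω : Set Plane} (w : H1 F Ω) : ‖val w‖ ≤ ‖w‖ :=
  norm_fst_le (w : H1Sub F Ω).1

theorem norm_grad_le {Ω : Set Plane} (w : H1 F Ω) (i : Fin 2) : ‖grad w i‖ ≤ ‖w‖ :=
  (norm_le_pi_norm (w : H1Sub F Ω).1.2 i).trans (norm_snd_le (w : H1Sub F Ω).1)

theorem norm_le_of_val_grad {Ω : Set Plane} {w : H1 F Ω} {c : ℝ} (h : ‖val w‖ ≤ c)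
    (h' : ∀ i, ‖grad w i‖ ≤ c) : ‖w‖ ≤ c :=
  max_le h ((pi_norm_le_iff_of_nonneg ((norm_nonneg _).trans h)).2 h')

variable (F) in
/-- The Ladyzhenskaya inequality, the multiplicative trace inequality, and the trace inequality
in `L⁴`. -/
theorem IsBoundedLipschitz.exists_trace_bounds {Ω : Set Plane} (hΩ : IsBoundedLipschitz Ω) :
    ∃ C : ℝ, 0 < C ∧ ∀ (w : H1 F Ω) (b : Lp F 2 (bdryMeasure Ω)), IsTrace w b →
      eLpNorm (val w) 4 (volume.restrict Ω) ≤ ENNReal.ofReal (C * √(‖val w‖ * ‖w‖)) ∧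
      ‖b‖ ≤ C * √(‖val w‖ * ‖w‖) ∧
      eLpNorm b 4 (bdryMeasure Ω) ≤ ENNReal.ofReal (C * ‖w‖) := by
  obtain ⟨C, hC, H⟩ := hΩ.exists_limit_bounds F
  set c : ℝ := C.toReal with hc
  have hc0 : 0 ≤ c := ENNReal.toReal_nonneg
  have hCc : C = ENNReal.ofReal c := (ENNReal.ofReal_toReal hC).symm
  refine ⟨3 * (c + 1), by positivity, fun w b hb => ?_⟩
  obtain ⟨ψ, hψ⟩ := hb.exists_seq
  obtain ⟨h1, h2, h3⟩ := H _ _ _ ψ hψ _ rfl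
  have hL : ∀ (μ : Measure Plane) (f : Lp F 2 μ), eLpNorm f 2 μ = ENNReal.ofReal ‖f‖ := fun μ f => by
    rw [Lp.norm_def, ENNReal.ofReal_toReal (Lp.eLpNorm_ne_top f)]
  -- The H¹ norm is a maximum of three L² norms, hence the factor 3.
  have hN : eLpNorm (val w) 2 (volume.restrict Ω) + ∑ i, eLpNorm (grad w i) 2 (volume.restrict Ω)
      ≤ ENNReal.ofReal (3 * ‖w‖) := by
    simp only [hL, Fin.sum_univ_two]
    rw [← ENNReal.ofReal_add (norm_nonneg _) (norm_nonneg _),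
      ← ENNReal.ofReal_add (norm_nonneg _) (by positivity)]
    refine ENNReal.ofReal_le_ofReal ?_
    linarith [norm_val_le w, norm_grad_le w 0, norm_grad_le w 1]
  have hsq : ∀ X : ℝ≥0∞, X ^ 2 ≤ C * (eLpNorm (val w) 2 (volume.restrict Ω) *
      (eLpNorm (val w) 2 (volume.restrict Ω) + ∑ i, eLpNorm (grad w i) 2 (volume.restrict Ω))) →
      X ≤ ENNReal.ofReal (3 * (c + 1) * √(‖val w‖ * ‖w‖)) := by
    intro X hX
    refine (ENNReal.pow_le_pow_left_iff two_ne_zero).1 (hX.trans ?_)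
    rw [← ENNReal.ofReal_pow (by positivity), mul_pow, Real.sq_sqrt (by positivity)]
    calc _ ≤ C * (ENNReal.ofReal ‖val w‖ * ENNReal.ofReal (3 * ‖w‖)) := by
          rw [← hL]
          gcongr
      _ = ENNReal.ofReal (c * (‖val w‖ * (3 * ‖w‖))) := by
          rw [hCc, ENNReal.ofReal_mul hc0, ENNReal.ofReal_mul (norm_nonneg _)]
      _ ≤ _ := by
          refine ENNReal.ofReal_le_ofReal ?_
          have : 3 * c ≤ (3 * (c + 1)) ^ 2 := by nlinarith
          calc c * (‖val w‖ * (3 * ‖w‖)) = 3 * c * (‖val w‖ * ‖w‖) := by ring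
            _ ≤ _ := by gcongr
  refine ⟨hsq _ h1, ?_, h3.trans ?_⟩
  · have := hsq _ h2
    rw [hL] at this
    exact (ENNReal.ofReal_le_ofReal_iff (by positivity)).1 this
  · calc _ ≤ C * ENNReal.ofReal (3 * ‖w‖) := by gcongr
      _ = ENNReal.ofReal (c * (3 * ‖w‖)) := by rw [hCc, ENNReal.ofReal_mul hc0]
      _ ≤ _ := by
          refine ENNReal.ofReal_le_ofReal ?_
          nlinarith [norm_nonneg w]

theorem IsTrace.sub {Ω : Set Plane} {w w' : H1 F Ω} {b b' : Lp F 2 (bdryMeasure Ω)}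
    (h : IsTrace w b) (h' : IsTrace w' b') : IsTrace (w - w') (b - b') := by
  have := h.add (h'.smul (-1))
  simpa [sub_eq_add_neg] using this

/-- The trace is unique. -/
theorem IsTrace.unique {Ω : Set Plane} (hΩ : IsBoundedLipschitz Ω) {w : H1 F Ω}
    {b b' : Lp F 2 (bdryMeasure Ω)} (h : IsTrace w b) (h' : IsTrace w b') : b = b' := by
  obtain ⟨C, _, H⟩ := hΩ.exists_trace_bounds F
  have := (H _ _ (h.sub h')).2.1
  rw [sub_self] at this
  simp only [norm_zero, mul_zero, Real.sqrt_zero] at this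
  exact sub_eq_zero.1 (norm_le_zero_iff.1 this)

theorem IsTrace.trace_eq {Ω : Set Plane} (hΩ : IsBoundedLipschitz Ω) {w : H1 F Ω}
    {b : Lp F 2 (bdryMeasure Ω)} (h : IsTrace w b) : trace w = b := by
  have hex : ∃ b, IsTrace w b := ⟨b, h⟩
  rw [trace, dif_pos hex]
  exact hex.choose_spec.unique hΩ h

/-- Membership in `H1Vanishing` includes the existence of a trace, so the default value in the
definition of `trace` never occurs here. -/
theorem isTrace_trace {Ω S : Set Plane} (w : H1Vanishing F Ω S) :
    IsTrace (w : H1 F Ω) (trace (w : H1 F Ω)) := by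
  obtain ⟨b, hb, -⟩ := w.2
  have hex : ∃ b, IsTrace (w : H1 F Ω) b := ⟨b, hb⟩
  rw [trace, dif_pos hex]
  exact hex.choose_spec

theorem trace_add {Ω S : Set Plane} (hΩ : IsBoundedLipschitz Ω) (w z : H1Vanishing F Ω S) :
    trace ((w + z : H1Vanishing F Ω S) : H1 F Ω) = trace (w : H1 F Ω) + trace (z : H1 F Ω) :=
  ((isTrace_trace w).add (isTrace_trace z)).trace_eq hΩ

theorem trace_smul {Ω S : Set Plane} (hΩ : IsBoundedLipschitz Ω) (c : ℝ)
    (w : H1Vanishing F Ω S) :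
    trace ((c • w : H1Vanishing F Ω S) : H1 F Ω) = c • trace (w : H1 F Ω) :=
  ((isTrace_trace w).smul c).trace_eq hΩ

/-- The trace vanishes on the prescribed part of the boundary. -/
theorem trace_ae_eq_zero {Ω S : Set Plane} (hΩ : IsBoundedLipschitz Ω) (w : H1Vanishing F Ω S) :
    ∀ᵐ x ∂(bdryMeasure Ω), x ∈ S → trace (w : H1 F Ω) x = 0 := by
  obtain ⟨b, hb, h⟩ := w.2
  rw [hb.trace_eq hΩ]
  exact h

end Closure

end NSD
end

noncomputable section

namespace NSD

/-! ### Completeness of `H¹` and uniqueness of weak derivatives -/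

section Complete

variable {F : Type} [NormedAddCommGroup F] [InnerProductSpace ℝ F]

theorem continuous_integral_smul [CompleteSpace F] {Ω : Set Plane} {η : Plane → ℝ}
    (hη : MemLp η 2 (volume.restrict Ω)) :
    Continuous fun u : L2 Ω F => ∫ x in Ω, η x • u x := by
  have h : (fun u : L2 Ω F => ∫ x in Ω, η x • u x) = fun u =>
      (ContinuousLinearMap.lsmul ℝ ℝ).lpPairing (volume.restrict Ω) 2 2 (hη.toLp η) u := by
    funext u
    rw [ContinuousLinearMap.lpPairing_eq_integral]
    refine integral_congr_ae ?_
    filter_upwards [hη.coeFn_toLp] with x hx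
    rw [hx]
    rfl
  rw [h]
  exact ContinuousLinearMap.continuous _

/-- Each defining identity equates two L²-continuous functionals. Closedness gives completeness of
H¹, needed to integrate H¹-valued functions of time. -/
theorem isClosed_H1Sub [CompleteSpace F] (Ω : Set Plane) :
    IsClosed (H1Sub F Ω : Set (L2 Ω F × (Fin 2 → L2 Ω F))) := by
  have h : (H1Sub F Ω : Set (L2 Ω F × (Fin 2 → L2 Ω F))) =
      {w | ∀ i, ∀ η : Plane → ℝ, ContDiff ℝ ∞ η → HasCompactSupport η → tsupport η ⊆ Ω →
        ∫ x in Ω, (fderiv ℝ η x (basisVec i)) • w.1 x = -∫ x in Ω, η x • w.2 i x} := rfl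
  rw [h]
  simp only [Set.ofPred_forall]
  refine isClosed_iInter fun i => isClosed_iInter fun η => isClosed_iInter fun hη =>
    isClosed_iInter fun hc => isClosed_iInter fun _ => isClosed_eq ?_ ?_
  · exact (continuous_integral_smul ((continuous_partial hη i).memLp_of_hasCompactSupport
      (hasCompactSupport_partial hc i))).comp continuous_fst
  · exact ((continuous_integral_smul (hη.continuous.memLp_of_hasCompactSupport hc)).comp
      ((continuous_apply i).comp continuous_snd)).neg

instance [CompleteSpace F] (Ω : Set Plane) : CompleteSpace (H1 F Ω) :=
  (isClosed_H1Sub Ω).completeSpace_coe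

theorem IsWeakDeriv.unique [CompleteSpace F] {Ω : Set Plane} (hΩ : IsOpen Ω) {i : Fin 2}
    {u w w' : L2 Ω F} (h : IsWeakDeriv Ω i u w) (h' : IsWeakDeriv Ω i u w') : w = w' := by
  have hi : LocallyIntegrableOn (fun x => w x - w' x) Ω volume := by
    have hm : MemLp (fun x => w x - w' x) 2 (volume.restrict Ω) := (Lp.memLp w).sub (Lp.memLp w')
    refine (locallyIntegrableOn_iff (hΩ.isLocallyClosed)).2 fun K hK hc => ?_
    have hm' := hm.mono_measure (Measure.restrict_mono_set volume hK)
    have : IsFiniteMeasure (volume.restrict K : Measure Plane) :=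
      ⟨by rw [Measure.restrict_apply_univ]; exact hc.measure_lt_top⟩
    exact hm'.integrable (by norm_num)
  have key := hΩ.ae_eq_zero_of_integral_contDiff_smul_eq_zero hi fun g hg hc hs => by
    have e1 : ∫ x, g x • (w x - w' x) = ∫ x in Ω, g x • (w x - w' x) := by
      refine (setIntegral_eq_integral_of_forall_compl_eq_zero fun x hx => ?_).symm
      rw [image_eq_zero_of_notMem_tsupport fun hh => hx (hs hh), zero_smul]
    rw [e1]
    simp only [smul_sub]
    rw [integral_sub (integrable_smul_L2 hg.continuous hc w)
      (integrable_smul_L2 hg.continuous hc w'), sub_eq_zero, ← neg_inj,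
      ← h g hg hc hs, h' g hg hc hs]
  apply Lp.ext
  filter_upwards [(ae_restrict_iff' hΩ.measurableSet).2 key] with x hx
  exact sub_eq_zero.1 hx

/-- The value map as a continuous linear map. -/
def valL (F : Type) [NormedAddCommGroup F] [InnerProductSpace ℝ F] (Ω : Set Plane) :
    H1 F Ω →L[ℝ] L2 Ω F :=
  (ContinuousLinearMap.fst ℝ (L2 Ω F) (Fin 2 → L2 Ω F)).comp (H1Sub F Ω).subtypeL

/-- By uniqueness of weak derivatives the gradient is determined by the function, so identities
between L² values lift to H¹. -/
theorem val_injective [CompleteSpace F] {Ω : Set Plane} (hΩ : IsOpen Ω) :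
    Function.Injective (val : H1 F Ω → L2 Ω F) := by
  intro w z h
  have h1 : ∀ i, grad w i = grad z i := fun i => by
    have hw : IsWeakDeriv Ω i (val w) (grad w i) := (show H1Sub F Ω from w).2 i
    have hz : IsWeakDeriv Ω i (val z) (grad z i) := (show H1Sub F Ω from z).2 i
    rw [← h] at hz
    exact hw.unique hΩ hz
  exact Subtype.ext (Prod.ext h (funext h1))

theorem val_sub {Ω : Set Plane} (w z : H1 F Ω) : val (w - z) = val w - val z := rfl

theorem grad_add {Ω : Set Plane} (w z : H1 F Ω) (i : Fin 2) :
    grad (w + z) i = grad w i + grad z i := rfl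

theorem grad_smul {Ω : Set Plane} (c : ℝ) (w : H1 F Ω) (i : Fin 2) :
    grad (c • w) i = c • grad w i := rfl

/-- A function of time whose values have a time derivative that is integrable with values in
`H¹` is the integral of this derivative in `H¹`. -/
theorem sub_eq_intervalIntegral [CompleteSpace F] {Ω : Set Plane} (hΩ : IsOpen Ω) {T : ℝ}
    {u : ℝ → H1 F Ω} {u' : ℝ → L2 Ω F} {V : ℝ → H1 F Ω}
    (hu : ∀ t ∈ Icc 0 T, val (u t) = val (u 0) + ∫ s in (0 : ℝ)..t, u' s)
    (hV : IntervalIntegrable V volume 0 T) (hVu : ∀ᵐ t ∂(timeMeasure T), val (V t) = u' t)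
    {s t : ℝ} (hs : 0 ≤ s) (hst : s ≤ t) (ht : t ≤ T) :
    IntervalIntegrable V volume s t ∧ u t - u s = ∫ r in s..t, V r := by
  have hsub : ∀ a b, 0 ≤ a → a ≤ b → b ≤ T → IntervalIntegrable V volume a b := by
    intro a b ha hab hb
    refine hV.mono_set ?_
    rw [uIcc_of_le hab, uIcc_of_le ((ha.trans hab).trans hb)]
    exact Icc_subset_Icc ha hb
  have hval : ∀ b, 0 ≤ b → b ≤ T → val (u b) = val (u 0) + val (∫ r in (0 : ℝ)..b, V r) := by
    intro b hb hbT
    rw [hu b ⟨hb, hbT⟩]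
    congr 1
    have h1 : valL F Ω (∫ r in (0 : ℝ)..b, V r) = ∫ r in (0 : ℝ)..b, valL F Ω (V r) :=
      ((valL F Ω).intervalIntegral_comp_comm (hsub 0 b le_rfl hb hbT)).symm
    refine Eq.trans ?_ h1.symm
    refine intervalIntegral.integral_congr_ae ?_
    have h2 := (ae_restrict_iff' measurableSet_Ioo).1 hVu
    -- `timeMeasure` lives on the open interval, whereas the integration range may contain the
    -- endpoint T.
    have h3 : ∀ᵐ r : ℝ, r ≠ T := by simp [ae_iff, measure_singleton]
    filter_upwards [h2, h3] with r hr hrT hrb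
    rw [uIoc_of_le hb] at hrb
    exact (hr ⟨hrb.1, lt_of_le_of_ne (hrb.2.trans hbT) hrT⟩).symm
  refine ⟨hsub s t hs hst ht, ?_⟩
  have hI : (∫ r in (0 : ℝ)..t, V r) - ∫ r in (0 : ℝ)..s, V r = ∫ r in s..t, V r :=
    intervalIntegral.integral_interval_sub_left (hsub 0 t le_rfl (hs.trans hst) ht)
      (hsub 0 s le_rfl hs (hst.trans ht))
  rw [← hI]
  apply val_injective hΩ
  rw [val_sub, val_sub, hval t (hs.trans hst) ht, hval s hs (hst.trans ht)]
  abel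

end Complete

end NSD
end

noncomputable section

namespace NSD

/-! ### Bounds for the forms of the model -/

theorem integrable_and_abs_integral_le {μ : Measure Plane} {h : Plane → ℝ} {D : ℝ} (hD : 0 ≤ D)
    (hh : AEStronglyMeasurable h μ) (hle : ∫⁻ x, ‖h x‖ₑ ∂μ ≤ ENNReal.ofReal D) :
    Integrable h μ ∧ |∫ x, h x ∂μ| ≤ D := by
  refine ⟨⟨hh, hle.trans_lt ENNReal.ofReal_lt_top⟩, ?_⟩
  have h1 : ‖∫ x, h x ∂μ‖ₑ ≤ ENNReal.ofReal D := (enorm_integral_le_lintegral_enorm _).trans hle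
  rw [← ofReal_norm, ENNReal.ofReal_le_ofReal_iff hD] at h1
  exact h1

section Holder

variable {E₁ E₂ E₃ : Type*} [NormedAddCommGroup E₁] [NormedAddCommGroup E₂]
  [NormedAddCommGroup E₃]

theorem integral_le_of_two_two {μ : Measure Plane} {h : Plane → ℝ} {f : Plane → E₁}
    {g : Plane → E₂} (hh : AEStronglyMeasurable h μ) (hf : AEStronglyMeasurable f μ)
    (hg : AEStronglyMeasurable g μ) (hle : ∀ᵐ x ∂μ, |h x| ≤ ‖f x‖ * ‖g x‖) {A B : ℝ} (hA0 : 0 ≤ A)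
    (hB0 : 0 ≤ B) (hA : eLpNorm f 2 μ ≤ ENNReal.ofReal A) (hB : eLpNorm g 2 μ ≤ ENNReal.ofReal B) :
    Integrable h μ ∧ |∫ x, h x ∂μ| ≤ A * B := by
  refine integrable_and_abs_integral_le (by positivity) hh ?_
  calc ∫⁻ x, ‖h x‖ₑ ∂μ ≤ ∫⁻ x, ‖f x‖ₑ * ‖g x‖ₑ ∂μ := by
        refine lintegral_mono_ae ?_
        filter_upwards [hle] with x hx
        rw [← ofReal_norm, ← ofReal_norm, ← ofReal_norm, ← ENNReal.ofReal_mul (norm_nonneg _)]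
        exact ENNReal.ofReal_le_ofReal hx
    _ ≤ eLpNorm f 2 μ * eLpNorm g 2 μ := by
        rw [eLpNorm_two_eq_l2Norm, eLpNorm_two_eq_l2Norm]
        exact lintegral_mul_le_l2Norm hf.enorm hg.enorm
    _ ≤ ENNReal.ofReal A * ENNReal.ofReal B := by gcongr
    _ = _ := (ENNReal.ofReal_mul hA0).symm

theorem l2Norm_sq_eq_eLpNorm_four {μ : Measure Plane} (f : Plane → E₁) :
    l2Norm μ (fun y => ‖f y‖ₑ ^ 2) = eLpNorm f 4 μ ^ 2 := by
  have h : l2Norm μ (fun y => ‖f y‖ₑ ^ 2) ^ 2 = (eLpNorm f 4 μ ^ 2) ^ 2 := by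
    rw [l2Norm_sq, ← pow_mul, eLpNorm_four_pow]
    simp only [← pow_mul]
  exact le_antisymm ((ENNReal.pow_le_pow_left_iff two_ne_zero).1 h.le)
    ((ENNReal.pow_le_pow_left_iff two_ne_zero).1 h.ge)

theorem l2Norm_mul_le_eLpNorm_four {μ : Measure Plane} {f : Plane → E₁} {g : Plane → E₂}
    (hf : AEStronglyMeasurable f μ) (hg : AEStronglyMeasurable g μ) :
    l2Norm μ (fun y => ‖f y‖ₑ * ‖g y‖ₑ) ≤ eLpNorm f 4 μ * eLpNorm g 4 μ := by
  refine (ENNReal.pow_le_pow_left_iff two_ne_zero).1 ?_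
  rw [l2Norm_sq, mul_pow, ← l2Norm_sq_eq_eLpNorm_four, ← l2Norm_sq_eq_eLpNorm_four]
  simp only [mul_pow]
  exact lintegral_mul_le_l2Norm (hf.enorm.pow_const 2) (hg.enorm.pow_const 2)

theorem lintegral_le_of_four_two_four {μ : Measure Plane} {f : Plane → E₁} {g : Plane → E₂}
    {k : Plane → E₃} (hf : AEStronglyMeasurable f μ) (hg : AEStronglyMeasurable g μ)
    (hk : AEStronglyMeasurable k μ) :
    ∫⁻ x, ‖f x‖ₑ * ‖g x‖ₑ * ‖k x‖ₑ ∂μ ≤ eLpNorm f 4 μ * eLpNorm g 2 μ * eLpNorm k 4 μ := by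
  calc ∫⁻ x, ‖f x‖ₑ * ‖g x‖ₑ * ‖k x‖ₑ ∂μ = ∫⁻ x, ‖g x‖ₑ * (‖f x‖ₑ * ‖k x‖ₑ) ∂μ := by
        refine lintegral_congr fun x => ?_
        ring
    _ ≤ l2Norm μ (fun x => ‖g x‖ₑ) * l2Norm μ (fun x => ‖f x‖ₑ * ‖k x‖ₑ) :=
        lintegral_mul_le_l2Norm hg.enorm (hf.enorm.mul hk.enorm)
    _ ≤ eLpNorm g 2 μ * (eLpNorm f 4 μ * eLpNorm k 4 μ) := by
        rw [← eLpNorm_two_eq_l2Norm]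
        gcongr
        exact l2Norm_mul_le_eLpNorm_four hf hk
    _ = _ := by ring

theorem integral_le_of_four_two_four {μ : Measure Plane} {h : Plane → ℝ} {f : Plane → E₁}
    {g : Plane → E₂} {k : Plane → E₃} (hh : AEStronglyMeasurable h μ)
    (hf : AEStronglyMeasurable f μ) (hg : AEStronglyMeasurable g μ)
    (hk : AEStronglyMeasurable k μ) (hle : ∀ᵐ x ∂μ, |h x| ≤ ‖f x‖ * ‖g x‖ * ‖k x‖) {A B C : ℝ}
    (hA0 : 0 ≤ A) (hB0 : 0 ≤ B) (hC0 : 0 ≤ C) (hA : eLpNorm f 4 μ ≤ ENNReal.ofReal A)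
    (hB : eLpNorm g 2 μ ≤ ENNReal.ofReal B) (hC : eLpNorm k 4 μ ≤ ENNReal.ofReal C) :
    Integrable h μ ∧ |∫ x, h x ∂μ| ≤ A * B * C := by
  refine integrable_and_abs_integral_le (by positivity) hh ?_
  calc ∫⁻ x, ‖h x‖ₑ ∂μ ≤ ∫⁻ x, ‖f x‖ₑ * ‖g x‖ₑ * ‖k x‖ₑ ∂μ := by
        refine lintegral_mono_ae ?_
        filter_upwards [hle] with x hx
        rw [← ofReal_norm, ← ofReal_norm, ← ofReal_norm, ← ofReal_norm,
          ← ENNReal.ofReal_mul (norm_nonneg _), ← ENNReal.ofReal_mul (by positivity)]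
        exact ENNReal.ofReal_le_ofReal hx
    _ ≤ eLpNorm f 4 μ * eLpNorm g 2 μ * eLpNorm k 4 μ := lintegral_le_of_four_two_four hf hg hk
    _ ≤ ENNReal.ofReal A * ENNReal.ofReal B * ENNReal.ofReal C := by gcongr
    _ = _ := by rw [ENNReal.ofReal_mul (by positivity), ENNReal.ofReal_mul hA0]

end Holder

theorem eLpNorm_two_eq_ofReal {F : Type} [NormedAddCommGroup F] {μ : Measure Plane}
    (f : Lp F 2 μ) : eLpNorm f 2 μ = ENNReal.ofReal ‖f‖ := by
  rw [Lp.norm_def, ENNReal.ofReal_toReal (Lp.eLpNorm_ne_top f)]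

/-- Arc length on the interface. -/
def ifaceMeasure (Ωf Ωp : Set Plane) : Measure Plane :=
  (Measure.hausdorffMeasure 1 : Measure Plane).restrict (interface Ωf Ωp)

theorem ifaceMeasure_le_left (Ωf Ωp : Set Plane) : ifaceMeasure Ωf Ωp ≤ bdryMeasure Ωf :=
  Measure.restrict_mono_set _ inter_subset_left

theorem ifaceMeasure_le_right (Ωf Ωp : Set Plane) : ifaceMeasure Ωf Ωp ≤ bdryMeasure Ωp :=
  Measure.restrict_mono_set _ inter_subset_right

/-- The quantity `√(‖w‖_{L²} ‖w‖_{H¹})`. -/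
def halfNorm {F : Type} [NormedAddCommGroup F] [InnerProductSpace ℝ F] {Ω : Set Plane}
    (w : H1 F Ω) : ℝ := √(‖val w‖ * ‖w‖)

section Bounds

variable {F : Type} [NormedAddCommGroup F] [InnerProductSpace ℝ F]

theorem halfNorm_nonneg {Ω : Set Plane} (w : H1 F Ω) : 0 ≤ halfNorm w := Real.sqrt_nonneg _

theorem halfNorm_le {Ω : Set Plane} (w : H1 F Ω) : halfNorm w ≤ ‖w‖ := by
  refine (Real.sqrt_le_left (norm_nonneg _)).2 ?_
  rw [sq]
  gcongr
  exact norm_val_le w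

variable (F) in
/-- The inequalities satisfied by the functions in `H¹` and their traces on a part of the
boundary, with measure `γ`. -/
theorem IsBoundedLipschitz.exists_interface_bounds {Ω S : Set Plane} (hΩ : IsBoundedLipschitz Ω)
    {γ : Measure Plane} (hγ : γ ≤ bdryMeasure Ω) :
    ∃ C : ℝ, 0 < C ∧ ∀ w : H1Vanishing F Ω S,
      eLpNorm (val (w : H1 F Ω)) 4 (volume.restrict Ω) ≤ ENNReal.ofReal (C * halfNorm (w : H1 F Ω)) ∧
      AEStronglyMeasurable (trace (w : H1 F Ω)) γ ∧
      eLpNorm (trace (w : H1 F Ω)) 2 γ ≤ ENNReal.ofReal (C * halfNorm (w : H1 F Ω)) ∧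
      eLpNorm (trace (w : H1 F Ω)) 4 γ ≤ ENNReal.ofReal (C * ‖w‖) := by
  obtain ⟨C, hC, H⟩ := hΩ.exists_trace_bounds F
  refine ⟨C, hC, fun w => ?_⟩
  obtain ⟨h1, h2, h3⟩ := H w _ (isTrace_trace w)
  refine ⟨h1, (Lp.aestronglyMeasurable _).mono_measure hγ, ?_, ?_⟩
  · refine (eLpNorm_mono_measure _ hγ).trans ?_
    rw [eLpNorm_two_eq_ofReal]
    exact ENNReal.ofReal_le_ofReal h2
  · exact (eLpNorm_mono_measure _ hγ).trans h3

end Bounds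

theorem IsBoundedLipschitz.aestronglyMeasurable_normal {Ωf : Set Plane}
    (hΩf : IsBoundedLipschitz Ωf) (Ωp : Set Plane) :
    AEStronglyMeasurable (outwardNormal Ωf) (ifaceMeasure Ωf Ωp) :=
  (hΩf.aemeasurable_outwardNormal.aestronglyMeasurable).mono_measure (ifaceMeasure_le_left Ωf Ωp)

theorem IsBoundedLipschitz.aestronglyMeasurable_tangent {Ωf : Set Plane}
    (hΩf : IsBoundedLipschitz Ωf) (Ωp : Set Plane) :
    AEStronglyMeasurable (unitTangent Ωf) (ifaceMeasure Ωf Ωp) :=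
  (hΩf.aemeasurable_unitTangent.aestronglyMeasurable).mono_measure (ifaceMeasure_le_left Ωf Ωp)

theorem abs_inner_le_of_norm_le_one {x n : Plane} (hn : ‖n‖ ≤ 1) : |inner ℝ x n| ≤ ‖x‖ := by
  refine (abs_real_inner_le_norm x n).trans ?_
  nlinarith [norm_nonneg x]

/-- The integrand of the interior part of the convective form, for one partial derivative. -/
def convDensity {Ωf Ωp : Set Plane} (u v w : VelSpace Ωf Ωp) (i : Fin 2) (x : Plane) : ℝ :=
  val (u : H1 Plane Ωf) x i * inner ℝ (grad (v : H1 Plane Ωf) i x) (val (w : H1 Plane Ωf) x)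

/-- The integrand of the boundary part of the convective form. -/
def convBdryDensity {Ωf Ωp : Set Plane} (u v w : VelSpace Ωf Ωp) (x : Plane) : ℝ :=
  inner ℝ (trace (u : H1 Plane Ωf) x) (trace (v : H1 Plane Ωf) x) *
    inner ℝ (trace (w : H1 Plane Ωf) x) (outwardNormal Ωf x)

/-- The integrand of the tangential form. -/
def tangentialDensity {Ωf Ωp : Set Plane} (u v : VelSpace Ωf Ωp) (x : Plane) : ℝ :=
  inner ℝ (trace (u : H1 Plane Ωf) x) (unitTangent Ωf x) *
    inner ℝ (trace (v : H1 Plane Ωf) x) (unitTangent Ωf x)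

/-- The integrand of the coupling form. -/
def couplingDensity {Ωf Ωp : Set Plane} (v : VelSpace Ωf Ωp) (φ : HeadSpace Ωf Ωp) (x : Plane) :
    ℝ :=
  trace (φ : H1 ℝ Ωp) x * inner ℝ (trace (v : H1 Plane Ωf) x) (outwardNormal Ωf x)

/-- Inside, Hölder with exponents 4, 2, 4 puts u and w in L⁴, which Ladyzhenskaya bounds by half
norms. On the interface u and v take the L⁴ trace bound and w the multiplicative L² one. In both
terms w pays only `halfNorm`. -/
theorem IsBoundedLipschitz.exists_convForm_bounds {Ωf : Set Plane} (hΩf : IsBoundedLipschitz Ωf)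
    (Ωp : Set Plane) : ∃ C : ℝ, 0 < C ∧ ∀ u v w : VelSpace Ωf Ωp,
      (∀ i, Integrable (convDensity u v w i) (volume.restrict Ωf)) ∧
      Integrable (convBdryDensity u v w) (ifaceMeasure Ωf Ωp) ∧
      |convForm u v w| ≤ C * ‖u‖ * ‖v‖ * halfNorm (w : H1 Plane Ωf) := by
  obtain ⟨C, hC, H⟩ := hΩf.exists_interface_bounds Plane (S := frontier Ωf \ interface Ωf Ωp)
    (ifaceMeasure_le_left Ωf Ωp)
  refine ⟨2 * C ^ 2 + C ^ 3, by positivity, fun u v w => ?_⟩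
  obtain ⟨u1, u2, -, u4⟩ := H u
  obtain ⟨-, v2, -, v4⟩ := H v
  obtain ⟨w1, w2, w3, -⟩ := H w
  have hu0 := halfNorm_nonneg (u : H1 Plane Ωf)
  have hw0 := halfNorm_nonneg (w : H1 Plane Ωf)
  have hmu := Lp.aestronglyMeasurable (val (u : H1 Plane Ωf))
  have hmw := Lp.aestronglyMeasurable (val (w : H1 Plane Ωf))
  have hmn := hΩf.aestronglyMeasurable_normal Ωp
  have I : ∀ i, Integrable (convDensity u v w i) (volume.restrict Ωf) ∧
      |∫ x in Ωf, convDensity u v w i x| ≤ C * halfNorm (u : H1 Plane Ωf) * ‖v‖ *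
        (C * halfNorm (w : H1 Plane Ωf)) := by
    intro i
    have hmv := Lp.aestronglyMeasurable (grad (v : H1 Plane Ωf) i)
    refine integral_le_of_four_two_four ?_ hmu hmv hmw ?_ (by positivity) (norm_nonneg _)
      (by positivity) u1 ?_ w1
    · exact ((EuclideanSpace.proj i).continuous.comp_aestronglyMeasurable hmu).mul (hmv.inner hmw)
    · refine Eventually.of_forall fun x => ?_
      rw [convDensity, abs_mul, mul_assoc]
      gcongr
      · exact PiLp.norm_apply_le (val (u : H1 Plane Ωf) x) i
      · exact abs_real_inner_le_norm _ _
    · rw [eLpNorm_two_eq_ofReal]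
      exact ENNReal.ofReal_le_ofReal (norm_grad_le _ i)
  have J : Integrable (convBdryDensity u v w) (ifaceMeasure Ωf Ωp) ∧
      |∫ x, convBdryDensity u v w x ∂(ifaceMeasure Ωf Ωp)| ≤ C * ‖u‖ *
        (C * halfNorm (w : H1 Plane Ωf)) * (C * ‖v‖) := by
    refine integral_le_of_four_two_four ?_ u2 w2 v2 ?_ (by positivity) (by positivity)
      (by positivity) u4 w3 v4
    · exact (u2.inner v2).mul (w2.inner hmn)
    · refine Eventually.of_forall fun x => ?_
      rw [convBdryDensity, abs_mul, mul_right_comm]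
      gcongr
      · exact abs_real_inner_le_norm _ _
      · exact abs_inner_le_of_norm_le_one (norm_outwardNormal_le Ωf x)
  refine ⟨fun i => (I i).1, J.1, ?_⟩
  have e : convForm u v w = (∑ i, ∫ x in Ωf, convDensity u v w i x)
      - 1 / 2 * ∫ x, convBdryDensity u v w x ∂(ifaceMeasure Ωf Ωp) := by
    rw [← integral_finsetSum _ fun i _ => (I i).1]
    rfl
  have hu1 := halfNorm_le (u : H1 Plane Ωf)
  have hI : ∀ i, |∫ x in Ωf, convDensity u v w i x| ≤ C ^ 2 * (‖u‖ * ‖v‖ * halfNorm (w : H1 Plane Ωf)) :=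
    fun i => (I i).2.trans <| by
      calc _ = C ^ 2 * (halfNorm (u : H1 Plane Ωf) * ‖v‖ * halfNorm (w : H1 Plane Ωf)) := by ring
        _ ≤ _ := by
          gcongr
          exact hu1
  rw [e, Fin.sum_univ_two]
  have h0 := abs_le.1 (hI 0)
  have h1 := abs_le.1 (hI 1)
  have h2 := abs_le.1 J.2
  have hpos : 0 ≤ C ^ 3 * (‖u‖ * ‖v‖ * halfNorm (w : H1 Plane Ωf)) := by positivity
  refine abs_le.2 ⟨?_, ?_⟩ <;> nlinarith

/-- The multiplicative trace inequality, applied on each side of the interface, lets both arguments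
pay only their half norms; either can then serve as test function. -/
theorem IsBoundedLipschitz.exists_coupling_bounds {Ωf Ωp : Set Plane}
    (hΩf : IsBoundedLipschitz Ωf) (hΩp : IsBoundedLipschitz Ωp) (P : Params) :
    ∃ C : ℝ, 0 < C ∧ ∀ (v : VelSpace Ωf Ωp) (φ : HeadSpace Ωf Ωp),
      Integrable (couplingDensity v φ) (ifaceMeasure Ωf Ωp) ∧
      |P.coupling v φ| ≤ C * halfNorm (v : H1 Plane Ωf) * halfNorm (φ : H1 ℝ Ωp) := by
  obtain ⟨C, hC, H⟩ := hΩf.exists_interface_bounds Plane (S := frontier Ωf \ interface Ωf Ωp)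
    (ifaceMeasure_le_left Ωf Ωp)
  obtain ⟨D, hD, H'⟩ := hΩp.exists_interface_bounds ℝ (S := frontier Ωp \ interface Ωf Ωp)
    (ifaceMeasure_le_right Ωf Ωp)
  have hg := P.g_pos
  refine ⟨P.g * C * D, by positivity, fun v φ => ?_⟩
  obtain ⟨-, v2, v3, -⟩ := H v
  obtain ⟨-, p2, p3, -⟩ := H' φ
  have hv0 := halfNorm_nonneg (v : H1 Plane Ωf)
  have hp0 := halfNorm_nonneg (φ : H1 ℝ Ωp)
  have I := integral_le_of_two_two (h := couplingDensity v φ)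
    (p2.mul (v2.inner (hΩf.aestronglyMeasurable_normal Ωp))) v2 p2 (Eventually.of_forall fun x => by
      rw [couplingDensity, abs_mul, mul_comm]
      gcongr
      · exact abs_inner_le_of_norm_le_one (norm_outwardNormal_le Ωf x)
      · exact le_rfl) (by positivity) (by positivity) v3 p3
  refine ⟨I.1, ?_⟩
  have e : P.coupling v φ = P.g * ∫ x, couplingDensity v φ x ∂(ifaceMeasure Ωf Ωp) := rfl
  rw [e, abs_mul, abs_of_pos hg]
  calc _ ≤ P.g * (C * halfNorm (v : H1 Plane Ωf) * (D * halfNorm (φ : H1 ℝ Ωp))) := by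
        gcongr
        exact I.2
    _ = _ := by ring

theorem IsBoundedLipschitz.exists_tangentialForm_bounds {Ωf : Set Plane}
    (hΩf : IsBoundedLipschitz Ωf) (Ωp : Set Plane) : ∃ C : ℝ, 0 < C ∧ ∀ u v : VelSpace Ωf Ωp,
      Integrable (tangentialDensity u v) (ifaceMeasure Ωf Ωp) ∧
      |tangentialForm u v| ≤ C * ‖u‖ * ‖v‖ := by
  obtain ⟨C, hC, H⟩ := hΩf.exists_interface_bounds Plane (S := frontier Ωf \ interface Ωf Ωp)
    (ifaceMeasure_le_left Ωf Ωp)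
  refine ⟨C ^ 2, by positivity, fun u v => ?_⟩
  obtain ⟨-, u2, u3, -⟩ := H u
  obtain ⟨-, v2, v3, -⟩ := H v
  have hu0 := halfNorm_nonneg (u : H1 Plane Ωf)
  have hv0 := halfNorm_nonneg (v : H1 Plane Ωf)
  have hmt := hΩf.aestronglyMeasurable_tangent Ωp
  have I := integral_le_of_two_two (h := tangentialDensity u v) ((u2.inner hmt).mul (v2.inner hmt))
    u2 v2 (Eventually.of_forall fun x => by
      rw [tangentialDensity, abs_mul]
      gcongr
      · exact abs_inner_le_of_norm_le_one (norm_unitTangent_le Ωf x)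
      · exact abs_inner_le_of_norm_le_one (norm_unitTangent_le Ωf x)) (by positivity)
      (by positivity) u3 v3
  refine ⟨I.1, I.2.trans ?_⟩
  calc _ = C ^ 2 * halfNorm (u : H1 Plane Ωf) * halfNorm (v : H1 Plane Ωf) := by ring
    _ ≤ _ := by
      gcongr
      · exact halfNorm_le (u : H1 Plane Ωf)
      · exact halfNorm_le (v : H1 Plane Ωf)

end NSD
end

noncomputable section

namespace NSD

/-! ### Linearity of the forms of the model -/

section Linear

variable {Ωf Ωp : Set Plane}

theorem vel_trace_add_ae (hΩf : IsBoundedLipschitz Ωf) (u v : VelSpace Ωf Ωp) :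
    ∀ᵐ x ∂(ifaceMeasure Ωf Ωp), trace ((u + v : VelSpace Ωf Ωp) : H1 Plane Ωf) x
      = trace (u : H1 Plane Ωf) x + trace (v : H1 Plane Ωf) x := by
  refine ae_mono (ifaceMeasure_le_left Ωf Ωp) ?_
  rw [trace_add hΩf]
  exact Lp.coeFn_add _ _

theorem vel_trace_smul_ae (hΩf : IsBoundedLipschitz Ωf) (c : ℝ) (u : VelSpace Ωf Ωp) :
    ∀ᵐ x ∂(ifaceMeasure Ωf Ωp), trace ((c • u : VelSpace Ωf Ωp) : H1 Plane Ωf) x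
      = c • trace (u : H1 Plane Ωf) x := by
  refine ae_mono (ifaceMeasure_le_left Ωf Ωp) ?_
  rw [trace_smul hΩf]
  exact Lp.coeFn_smul _ _

theorem head_trace_add_ae (hΩp : IsBoundedLipschitz Ωp) (φ ψ : HeadSpace Ωf Ωp) :
    ∀ᵐ x ∂(ifaceMeasure Ωf Ωp), trace ((φ + ψ : HeadSpace Ωf Ωp) : H1 ℝ Ωp) x
      = trace (φ : H1 ℝ Ωp) x + trace (ψ : H1 ℝ Ωp) x := by
  refine ae_mono (ifaceMeasure_le_right Ωf Ωp) ?_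
  rw [trace_add hΩp]
  exact Lp.coeFn_add _ _

theorem convForm_eq (hΩf : IsBoundedLipschitz Ωf) (u v w : VelSpace Ωf Ωp) :
    convForm u v w = (∑ i, ∫ x in Ωf, convDensity u v w i x)
      - 1 / 2 * ∫ x, convBdryDensity u v w x ∂(ifaceMeasure Ωf Ωp) := by
  obtain ⟨_, -, H⟩ := hΩf.exists_convForm_bounds Ωp
  rw [← integral_finsetSum _ fun i _ => (H u v w).1 i]
  rfl

theorem convForm_add_left (hΩf : IsBoundedLipschitz Ωf) (u u' v w : VelSpace Ωf Ωp) :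
    convForm (u + u') v w = convForm u v w + convForm u' v w := by
  obtain ⟨_, -, H⟩ := hΩf.exists_convForm_bounds Ωp
  have h1 : ∀ i, ∫ x in Ωf, convDensity (u + u') v w i x
      = (∫ x in Ωf, convDensity u v w i x) + ∫ x in Ωf, convDensity u' v w i x := fun i => by
    rw [← integral_add ((H u v w).1 i) ((H u' v w).1 i)]
    refine integral_congr_ae ?_
    filter_upwards [Lp.coeFn_add (val (u : H1 Plane Ωf)) (val (u' : H1 Plane Ωf))] with x hx
    have hx' : val ((u + u' : VelSpace Ωf Ωp) : H1 Plane Ωf) x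
      = val (u : H1 Plane Ωf) x + val (u' : H1 Plane Ωf) x := hx
    simp only [convDensity, hx', PiLp.add_apply]
    ring
  have h2 : ∫ x, convBdryDensity (u + u') v w x ∂(ifaceMeasure Ωf Ωp)
      = (∫ x, convBdryDensity u v w x ∂(ifaceMeasure Ωf Ωp))
        + ∫ x, convBdryDensity u' v w x ∂(ifaceMeasure Ωf Ωp) := by
    rw [← integral_add (H u v w).2.1 (H u' v w).2.1]
    refine integral_congr_ae ?_
    filter_upwards [vel_trace_add_ae hΩf u u'] with x hx
    simp only [convBdryDensity, hx, inner_add_left]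
    ring
  simp only [convForm_eq hΩf, h1, h2, Finset.sum_add_distrib]
  ring

theorem convForm_add_mid (hΩf : IsBoundedLipschitz Ωf) (u v v' w : VelSpace Ωf Ωp) :
    convForm u (v + v') w = convForm u v w + convForm u v' w := by
  obtain ⟨_, -, H⟩ := hΩf.exists_convForm_bounds Ωp
  have h1 : ∀ i, ∫ x in Ωf, convDensity u (v + v') w i x
      = (∫ x in Ωf, convDensity u v w i x) + ∫ x in Ωf, convDensity u v' w i x := fun i => by
    rw [← integral_add ((H u v w).1 i) ((H u v' w).1 i)]
    refine integral_congr_ae ?_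
    filter_upwards [Lp.coeFn_add (grad (v : H1 Plane Ωf) i) (grad (v' : H1 Plane Ωf) i)] with x hx
    have hx' : grad ((v + v' : VelSpace Ωf Ωp) : H1 Plane Ωf) i x
      = grad (v : H1 Plane Ωf) i x + grad (v' : H1 Plane Ωf) i x := hx
    simp only [convDensity, hx', inner_add_left]
    ring
  have h2 : ∫ x, convBdryDensity u (v + v') w x ∂(ifaceMeasure Ωf Ωp)
      = (∫ x, convBdryDensity u v w x ∂(ifaceMeasure Ωf Ωp))
        + ∫ x, convBdryDensity u v' w x ∂(ifaceMeasure Ωf Ωp) := by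
    rw [← integral_add (H u v w).2.1 (H u v' w).2.1]
    refine integral_congr_ae ?_
    filter_upwards [vel_trace_add_ae hΩf v v'] with x hx
    simp only [convBdryDensity, hx, inner_add_right]
    ring
  simp only [convForm_eq hΩf, h1, h2, Finset.sum_add_distrib]
  ring

theorem coupling_add_left (hΩf : IsBoundedLipschitz Ωf) (hΩp : IsBoundedLipschitz Ωp) (P : Params)
    (v v' : VelSpace Ωf Ωp) (φ : HeadSpace Ωf Ωp) :
    P.coupling (v + v') φ = P.coupling v φ + P.coupling v' φ := by
  obtain ⟨_, -, H⟩ := hΩf.exists_coupling_bounds hΩp P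
  have e : ∀ v : VelSpace Ωf Ωp,
    P.coupling v φ = P.g * ∫ x, couplingDensity v φ x ∂(ifaceMeasure Ωf Ωp) := fun _ => rfl
  rw [e, e, e, ← mul_add, ← integral_add (H v φ).1 (H v' φ).1]
  congr 1
  refine integral_congr_ae ?_
  filter_upwards [vel_trace_add_ae hΩf v v'] with x hx
  simp only [couplingDensity, hx, inner_add_left]
  ring

theorem coupling_add_right (hΩf : IsBoundedLipschitz Ωf) (hΩp : IsBoundedLipschitz Ωp) (P : Params)
    (v : VelSpace Ωf Ωp) (φ φ' : HeadSpace Ωf Ωp) :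
    P.coupling v (φ + φ') = P.coupling v φ + P.coupling v φ' := by
  obtain ⟨_, -, H⟩ := hΩf.exists_coupling_bounds hΩp P
  have e : ∀ φ : HeadSpace Ωf Ωp,
    P.coupling v φ = P.g * ∫ x, couplingDensity v φ x ∂(ifaceMeasure Ωf Ωp) := fun _ => rfl
  rw [e, e, e, ← mul_add, ← integral_add (H v φ).1 (H v φ').1]
  congr 1
  refine integral_congr_ae ?_
  filter_upwards [head_trace_add_ae hΩp φ φ'] with x hx
  simp only [couplingDensity, hx]
  ring

theorem tangentialForm_add_left (hΩf : IsBoundedLipschitz Ωf) (u u' v : VelSpace Ωf Ωp) :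
    tangentialForm (u + u') v = tangentialForm u v + tangentialForm u' v := by
  obtain ⟨_, -, H⟩ := hΩf.exists_tangentialForm_bounds Ωp
  have e : ∀ u : VelSpace Ωf Ωp,
    tangentialForm u v = ∫ x, tangentialDensity u v x ∂(ifaceMeasure Ωf Ωp) := fun _ => rfl
  rw [e, e, e, ← integral_add (H u v).1 (H u' v).1]
  refine integral_congr_ae ?_
  filter_upwards [vel_trace_add_ae hΩf u u'] with x hx
  simp only [tangentialDensity, hx, inner_add_left]
  ring

theorem tangentialForm_smul_left (hΩf : IsBoundedLipschitz Ωf) (c : ℝ) (u v : VelSpace Ωf Ωp) :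
    tangentialForm (c • u) v = c * tangentialForm u v := by
  have e : ∀ u : VelSpace Ωf Ωp,
    tangentialForm u v = ∫ x, tangentialDensity u v x ∂(ifaceMeasure Ωf Ωp) := fun _ => rfl
  rw [e, e, ← integral_const_mul]
  refine integral_congr_ae ?_
  filter_upwards [vel_trace_smul_ae hΩf c u] with x hx
  simp only [tangentialDensity, hx, real_inner_smul_left]
  ring

theorem tangentialForm_comm (u v : VelSpace Ωf Ωp) : tangentialForm u v = tangentialForm v u := by
  simp only [tangentialForm]
  congr 1
  funext x
  ring

theorem tangentialForm_self_nonneg (u : VelSpace Ωf Ωp) : 0 ≤ tangentialForm u u :=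
  integral_nonneg fun _ => mul_self_nonneg _

theorem Params.friction_nonneg (P : Params) : 0 ≤ P.friction :=
  mul_nonneg P.α_nonneg (Real.sqrt_nonneg _)

section Grad

variable {F : Type} [NormedAddCommGroup F] [InnerProductSpace ℝ F] {Ω : Set Plane}

theorem gradInner_comm (w z : H1 F Ω) : gradInner w z = gradInner z w :=
  Finset.sum_congr rfl fun _ _ => real_inner_comm _ _

theorem gradInner_add_left (w w' z : H1 F Ω) :
    gradInner (w + w') z = gradInner w z + gradInner w' z := by
  simp only [gradInner, grad_add, inner_add_left, Finset.sum_add_distrib]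

theorem gradInner_smul_left (c : ℝ) (w z : H1 F Ω) :
    gradInner (c • w) z = c * gradInner w z := by
  simp only [gradInner, grad_smul, real_inner_smul_left, Finset.mul_sum]

theorem gradInner_self (w : H1 F Ω) : gradInner w w = ∑ i, ‖grad w i‖ ^ 2 :=
  Finset.sum_congr rfl fun _ _ => real_inner_self_eq_norm_sq _

theorem gradInner_self_nonneg (w : H1 F Ω) : 0 ≤ gradInner w w := by
  rw [gradInner_self]
  positivity

theorem abs_gradInner_le (w z : H1 F Ω) : |gradInner w z| ≤ 2 * (‖w‖ * ‖z‖) := by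
  have h : ∀ i, |inner ℝ (grad w i) (grad z i)| ≤ ‖w‖ * ‖z‖ := fun i =>
    (abs_real_inner_le_norm _ _).trans
      (mul_le_mul (norm_grad_le w i) (norm_grad_le z i) (norm_nonneg _) (norm_nonneg _))
  rw [gradInner, Fin.sum_univ_two]
  linarith [abs_add_le (inner ℝ (grad w 0) (grad z 0)) (inner ℝ (grad w 1) (grad z 1)), h 0, h 1]

theorem norm_sq_le_val_add_grad (w : H1 F Ω) : ‖w‖ ^ 2 ≤ ‖val w‖ ^ 2 + gradInner w w := by
  have h0 := gradInner_self_nonneg w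
  have hg : ∀ i, ‖grad w i‖ ^ 2 ≤ gradInner w w := fun i => by
    rw [gradInner_self]
    exact Finset.single_le_sum (f := fun i => ‖grad w i‖ ^ 2) (fun _ _ => by positivity)
      (Finset.mem_univ i)
  have h : ‖w‖ ≤ √(‖val w‖ ^ 2 + gradInner w w) := by
    refine norm_le_of_val_grad (Real.le_sqrt_of_sq_le ?_) fun i => Real.le_sqrt_of_sq_le ?_
    · linarith
    · linarith [hg i, sq_nonneg ‖val w‖]
  calc ‖w‖ ^ 2 ≤ √(‖val w‖ ^ 2 + gradInner w w) ^ 2 := by gcongr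
    _ = _ := Real.sq_sqrt (by positivity)

end Grad

end Linear

/-! ### The mass and dissipation forms -/

/-- The pairs formed by a velocity and a head. -/
abbrev StateSpace (Ωf Ωp : Set Plane) : Type := VelSpace Ωf Ωp × HeadSpace Ωf Ωp

namespace Params

variable (P : Params) {Ωf Ωp : Set Plane}

/-- The form `(u, v)_f + g S₀ (φ, ψ)_p`. -/
def massForm (Ωf Ωp : Set Plane) : StateSpace Ωf Ωp →ₗ[ℝ] StateSpace Ωf Ωp →ₗ[ℝ] ℝ :=
  LinearMap.mk₂ ℝ (fun w z => inner ℝ (val (w.1 : H1 Plane Ωf)) (val (z.1 : H1 Plane Ωf))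
      + P.g * P.S₀ * inner ℝ (val (w.2 : H1 ℝ Ωp)) (val (z.2 : H1 ℝ Ωp)))
    (fun w w' z => by
      have e1 : val ((w + w').1 : H1 Plane Ωf) = val (w.1 : H1 Plane Ωf) + val (w'.1 : H1 Plane Ωf) :=
        rfl
      have e2 : val ((w + w').2 : H1 ℝ Ωp) = val (w.2 : H1 ℝ Ωp) + val (w'.2 : H1 ℝ Ωp) := rfl
      rw [e1, e2, inner_add_left, inner_add_left]
      ring)
    (fun c w z => by
      have e1 : val ((c • w).1 : H1 Plane Ωf) = c • val (w.1 : H1 Plane Ωf) := rfl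
      have e2 : val ((c • w).2 : H1 ℝ Ωp) = c • val (w.2 : H1 ℝ Ωp) := rfl
      rw [e1, e2, real_inner_smul_left, real_inner_smul_left, smul_eq_mul]
      ring)
    (fun z w w' => by
      have e1 : val ((w + w').1 : H1 Plane Ωf) = val (w.1 : H1 Plane Ωf) + val (w'.1 : H1 Plane Ωf) :=
        rfl
      have e2 : val ((w + w').2 : H1 ℝ Ωp) = val (w.2 : H1 ℝ Ωp) + val (w'.2 : H1 ℝ Ωp) := rfl
      rw [e1, e2, inner_add_right, inner_add_right]
      ring)
    (fun c z w => by
      have e1 : val ((c • w).1 : H1 Plane Ωf) = c • val (w.1 : H1 Plane Ωf) := rfl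
      have e2 : val ((c • w).2 : H1 ℝ Ωp) = c • val (w.2 : H1 ℝ Ωp) := rfl
      rw [e1, e2, real_inner_smul_right, real_inner_smul_right, smul_eq_mul]
      ring)

theorem massForm_apply (w z : StateSpace Ωf Ωp) : P.massForm Ωf Ωp w z
    = inner ℝ (val (w.1 : H1 Plane Ωf)) (val (z.1 : H1 Plane Ωf))
      + P.g * P.S₀ * inner ℝ (val (w.2 : H1 ℝ Ωp)) (val (z.2 : H1 ℝ Ωp)) := rfl

/-- The bilinear form associated with the dissipation. -/
def dissipationFun (w z : StateSpace Ωf Ωp) : ℝ :=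
  P.ν * gradInner (w.1 : H1 Plane Ωf) (z.1 : H1 Plane Ωf) + P.friction * tangentialForm w.1 z.1
    + P.g * P.K * gradInner (w.2 : H1 ℝ Ωp) (z.2 : H1 ℝ Ωp)

theorem dissipationFun_comm (w z : StateSpace Ωf Ωp) :
    P.dissipationFun w z = P.dissipationFun z w := by
  rw [dissipationFun, dissipationFun, gradInner_comm, tangentialForm_comm,
    gradInner_comm (z.2 : H1 ℝ Ωp)]

theorem dissipationFun_add_left (hΩf : IsBoundedLipschitz Ωf) (w w' z : StateSpace Ωf Ωp) :
    P.dissipationFun (w + w') z = P.dissipationFun w z + P.dissipationFun w' z := by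
  simp only [dissipationFun, Prod.fst_add, Prod.snd_add, Submodule.coe_add, gradInner_add_left,
    tangentialForm_add_left hΩf]
  ring

theorem dissipationFun_smul_left (hΩf : IsBoundedLipschitz Ωf) (c : ℝ) (w z : StateSpace Ωf Ωp) :
    P.dissipationFun (c • w) z = c * P.dissipationFun w z := by
  simp only [dissipationFun, Prod.smul_fst, Prod.smul_snd, Submodule.coe_smul,
    gradInner_smul_left, tangentialForm_smul_left hΩf]
  ring

/-- The bilinear form associated with the dissipation, as a bilinear map. -/
def dissipationForm (hΩf : IsBoundedLipschitz Ωf) (Ωp : Set Plane) :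
    StateSpace Ωf Ωp →ₗ[ℝ] StateSpace Ωf Ωp →ₗ[ℝ] ℝ :=
  LinearMap.mk₂ ℝ P.dissipationFun (P.dissipationFun_add_left hΩf)
    (P.dissipationFun_smul_left hΩf)
    (fun w z z' => by
      rw [P.dissipationFun_comm, P.dissipationFun_add_left hΩf, P.dissipationFun_comm z,
        P.dissipationFun_comm z'])
    (fun c w z => by
      rw [P.dissipationFun_comm, P.dissipationFun_smul_left hΩf, P.dissipationFun_comm z]
      rfl)

theorem dissipationForm_apply (hΩf : IsBoundedLipschitz Ωf) (w z : StateSpace Ωf Ωp) :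
    P.dissipationForm hΩf Ωp w z = P.dissipationFun w z := rfl

theorem energy_eq (w : StateSpace Ωf Ωp) :
    P.energy w.1 w.2 = 1 / 2 * P.massForm Ωf Ωp w w := by
  rw [massForm_apply, real_inner_self_eq_norm_sq, real_inner_self_eq_norm_sq, energy]
  ring

theorem massForm_comm (w z : StateSpace Ωf Ωp) :
    P.massForm Ωf Ωp w z = P.massForm Ωf Ωp z w := by
  rw [massForm_apply, massForm_apply, real_inner_comm, real_inner_comm (val (z.2 : H1 ℝ Ωp))]

theorem massForm_self (w : StateSpace Ωf Ωp) : P.massForm Ωf Ωp w w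
    = ‖val (w.1 : H1 Plane Ωf)‖ ^ 2 + P.g * P.S₀ * ‖val (w.2 : H1 ℝ Ωp)‖ ^ 2 := by
  rw [massForm_apply, real_inner_self_eq_norm_sq, real_inner_self_eq_norm_sq]

theorem massForm_self_nonneg (w : StateSpace Ωf Ωp) : 0 ≤ P.massForm Ωf Ωp w w := by
  have := P.g_pos
  have := P.S₀_pos
  rw [massForm_self]
  positivity

theorem dissipationForm_self_nonneg (hΩf : IsBoundedLipschitz Ωf) (w : StateSpace Ωf Ωp) :
    0 ≤ P.dissipationForm hΩf Ωp w w := by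
  have := P.g_pos
  have := P.K_pos
  have := P.ν_pos
  have := P.friction_nonneg
  have := gradInner_self_nonneg (w.1 : H1 Plane Ωf)
  have := gradInner_self_nonneg (w.2 : H1 ℝ Ωp)
  have := tangentialForm_self_nonneg w.1
  rw [dissipationForm_apply, dissipationFun]
  positivity

theorem norm_vel_le (w : StateSpace Ωf Ωp) : ‖(w.1 : H1 Plane Ωf)‖ ≤ ‖w‖ := norm_fst_le w

theorem norm_head_le (w : StateSpace Ωf Ωp) : ‖(w.2 : H1 ℝ Ωp)‖ ≤ ‖w‖ := norm_snd_le w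

theorem abs_massForm_le (w z : StateSpace Ωf Ωp) :
    |P.massForm Ωf Ωp w z| ≤ (1 + P.g * P.S₀) * ‖w‖ * ‖z‖ := by
  have hg := mul_pos P.g_pos P.S₀_pos
  have h1 : |inner ℝ (val (w.1 : H1 Plane Ωf)) (val (z.1 : H1 Plane Ωf))| ≤ ‖w‖ * ‖z‖ :=
    (abs_real_inner_le_norm _ _).trans (mul_le_mul ((norm_val_le _).trans (norm_vel_le w))
      ((norm_val_le _).trans (norm_vel_le z)) (norm_nonneg _) (norm_nonneg _))
  have h2 : |inner ℝ (val (w.2 : H1 ℝ Ωp)) (val (z.2 : H1 ℝ Ωp))| ≤ ‖w‖ * ‖z‖ :=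
    (abs_real_inner_le_norm _ _).trans (mul_le_mul ((norm_val_le _).trans (norm_head_le w))
      ((norm_val_le _).trans (norm_head_le z)) (norm_nonneg _) (norm_nonneg _))
  rw [massForm_apply]
  refine (abs_add_le _ _).trans ?_
  rw [abs_mul, abs_of_pos hg]
  nlinarith

theorem exists_abs_dissipationForm_le (hΩf : IsBoundedLipschitz Ωf) (Ωp : Set Plane) :
    ∃ C : ℝ, 0 < C ∧ ∀ w z : StateSpace Ωf Ωp,
      |P.dissipationForm hΩf Ωp w z| ≤ C * ‖w‖ * ‖z‖ := by
  obtain ⟨C, hC, H⟩ := hΩf.exists_tangentialForm_bounds Ωp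
  have hg := P.g_pos
  have hK := P.K_pos
  have hν := P.ν_pos
  have hf := P.friction_nonneg
  refine ⟨P.ν * 2 + P.friction * C + P.g * P.K * 2, by positivity, fun w z => ?_⟩
  have h0 : ∀ a b : ℝ, 0 ≤ a → 0 ≤ b → a ≤ ‖w‖ → b ≤ ‖z‖ → a * b ≤ ‖w‖ * ‖z‖ :=
    fun a b _ hb h h' => mul_le_mul h h' hb (norm_nonneg _)
  have h1 := (abs_gradInner_le (w.1 : H1 Plane Ωf) (z.1 : H1 Plane Ωf)).trans
    (mul_le_mul_of_nonneg_left (h0 _ _ (norm_nonneg _) (norm_nonneg _) (norm_vel_le w)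
      (norm_vel_le z)) zero_le_two)
  have h2 := (abs_gradInner_le (w.2 : H1 ℝ Ωp) (z.2 : H1 ℝ Ωp)).trans
    (mul_le_mul_of_nonneg_left (h0 _ _ (norm_nonneg _) (norm_nonneg _) (norm_head_le w)
      (norm_head_le z)) zero_le_two)
  have h3 : |tangentialForm w.1 z.1| ≤ C * (‖w‖ * ‖z‖) := by
    refine (H w.1 z.1).2.trans ?_
    rw [mul_assoc]
    exact mul_le_mul_of_nonneg_left (h0 _ _ (norm_nonneg _) (norm_nonneg _) (norm_vel_le w)
      (norm_vel_le z)) hC.le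
  rw [dissipationForm_apply, dissipationFun]
  refine (abs_add_le _ _).trans ((add_le_add_left (abs_add_le _ _) _).trans ?_)
  rw [abs_mul, abs_mul, abs_mul, abs_of_pos hν, abs_of_nonneg hf, abs_of_pos (mul_pos hg hK)]
  calc _ ≤ P.ν * (2 * (‖w‖ * ‖z‖)) + P.friction * (C * (‖w‖ * ‖z‖))
        + P.g * P.K * (2 * (‖w‖ * ‖z‖)) := by gcongr
    _ = _ := by ring

/-- The mass form supplies the L² norms and the dissipation the gradients, so no Poincaré inequality
is involved; the friction term is nonnegative and is dropped. The constant contains the reciprocal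
of each coefficient. -/
theorem exists_norm_sq_le (hΩf : IsBoundedLipschitz Ωf) (Ωp : Set Plane) :
    ∃ C : ℝ, 0 < C ∧ ∀ w : StateSpace Ωf Ωp,
      ‖w‖ ^ 2 ≤ C * (P.massForm Ωf Ωp w w + P.dissipationForm hΩf Ωp w w) := by
  have hg := P.g_pos
  have hK := P.K_pos
  have hν := P.ν_pos
  have hS := P.S₀_pos
  have hgS := mul_pos hg hS
  have hgK := mul_pos hg hK
  have hf := P.friction_nonneg
  refine ⟨1 + P.ν⁻¹ + (P.g * P.S₀)⁻¹ + (P.g * P.K)⁻¹, by positivity, fun w => ?_⟩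
  set C := 1 + P.ν⁻¹ + (P.g * P.S₀)⁻¹ + (P.g * P.K)⁻¹ with hC
  have c1 : 1 ≤ C := by
    rw [hC, add_assoc, add_assoc]
    linarith [show 0 < P.ν⁻¹ + ((P.g * P.S₀)⁻¹ + (P.g * P.K)⁻¹) by positivity]
  have c2 : 1 ≤ C * P.ν := by
    rw [← inv_le_iff_one_le_mul₀ hν, hC]
    linarith [show 0 < (P.g * P.S₀)⁻¹ + (P.g * P.K)⁻¹ by positivity]
  have c3 : 1 ≤ C * (P.g * P.S₀) := by
    rw [← inv_le_iff_one_le_mul₀ hgS, hC]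
    linarith [show 0 < P.ν⁻¹ by positivity, show 0 < (P.g * P.K)⁻¹ by positivity]
  have c4 : 1 ≤ C * (P.g * P.K) := by
    rw [← inv_le_iff_one_le_mul₀ hgK, hC]
    linarith [show 0 < P.ν⁻¹ + (P.g * P.S₀)⁻¹ by positivity]
  have hC0 : 0 < C := by linarith
  have g1 := gradInner_self_nonneg (w.1 : H1 Plane Ωf)
  have g2 := gradInner_self_nonneg (w.2 : H1 ℝ Ωp)
  have t1 := mul_nonneg hf (tangentialForm_self_nonneg w.1)
  have n1 := norm_sq_le_val_add_grad (w.1 : H1 Plane Ωf)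
  have n2 := norm_sq_le_val_add_grad (w.2 : H1 ℝ Ωp)
  have hm := P.massForm_self w
  have hA : P.dissipationForm hΩf Ωp w w = P.ν * gradInner (w.1 : H1 Plane Ωf) (w.1 : H1 Plane Ωf)
      + P.friction * tangentialForm w.1 w.1
      + P.g * P.K * gradInner (w.2 : H1 ℝ Ωp) (w.2 : H1 ℝ Ωp) := rfl
  have hw : ‖w‖ ^ 2 ≤ ‖(w.1 : H1 Plane Ωf)‖ ^ 2 + ‖(w.2 : H1 ℝ Ωp)‖ ^ 2 := by
    have hmax : ‖w‖ = max ‖(w.1 : H1 Plane Ωf)‖ ‖(w.2 : H1 ℝ Ωp)‖ := rfl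
    rcases max_choice ‖(w.1 : H1 Plane Ωf)‖ ‖(w.2 : H1 ℝ Ωp)‖ with h | h <;> rw [hmax, h]
    · linarith [sq_nonneg ‖(w.2 : H1 ℝ Ωp)‖]
    · linarith [sq_nonneg ‖(w.1 : H1 Plane Ωf)‖]
  have m1 := le_mul_of_one_le_left (sq_nonneg ‖val (w.1 : H1 Plane Ωf)‖) c1
  have m2 := le_mul_of_one_le_left g1 c2
  have m3 := le_mul_of_one_le_left (sq_nonneg ‖val (w.2 : H1 ℝ Ωp)‖) c3
  have m4 := le_mul_of_one_le_left g2 c4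
  have m5 := mul_nonneg hC0.le t1
  rw [hm, hA]
  linarith

/-- The nonlinear and coupling terms. -/
def explicitForm (w z : StateSpace Ωf Ωp) : ℝ :=
  convForm w.1 w.1 z.1 + P.coupling z.1 w.2 - P.coupling w.1 z.2

/-- The difference expands, by linearity in each slot, into two convective and two interface terms,
each containing w - w' once. The test pair enters every term through `halfNorm`; this is what allows
an explicit treatment of N. -/
theorem exists_explicitForm_bound (hΩf : IsBoundedLipschitz Ωf) (hΩp : IsBoundedLipschitz Ωp) :
    ∃ C : ℝ, 0 < C ∧ ∀ w w' z : StateSpace Ωf Ωp,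
      |P.explicitForm w z - P.explicitForm w' z|
        ≤ C * (1 + ‖w‖ + ‖w'‖) * ‖w - w'‖ * √(√(P.massForm Ωf Ωp z z) * ‖z‖) := by
  obtain ⟨C, hC, H⟩ := hΩf.exists_convForm_bounds Ωp
  obtain ⟨D, hD, H'⟩ := hΩf.exists_coupling_bounds hΩp P
  have hgS := mul_pos P.g_pos P.S₀_pos
  -- The head enters the mass form with weight g S₀; passing from its half norm to the geometric
  -- mean for the mass form costs the fourth root of the reciprocal weight.
  set R : ℝ := 1 + √(√(P.g * P.S₀))⁻¹ with hR
  have hR0 : 0 < R := by positivity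
  refine ⟨C * R + 2 * D * R, by positivity, fun w w' z => ?_⟩
  set h : ℝ := √(√(P.massForm Ωf Ωp z z) * ‖z‖) with hh
  have h1 : halfNorm (z.1 : H1 Plane Ωf) ≤ R * h := by
    have : halfNorm (z.1 : H1 Plane Ωf) ≤ h := by
      refine Real.sqrt_le_sqrt ?_
      gcongr
      · refine Real.le_sqrt_of_sq_le ?_
        rw [massForm_self]
        have : 0 ≤ P.g * P.S₀ * ‖val (z.2 : H1 ℝ Ωp)‖ ^ 2 := by positivity
        linarith
      · exact norm_vel_le z
    refine this.trans (le_mul_of_one_le_left (Real.sqrt_nonneg _) ?_)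
    rw [hR]
    linarith [show 0 ≤ √(√(P.g * P.S₀))⁻¹ by positivity]
  have h2 : halfNorm (z.2 : H1 ℝ Ωp) ≤ R * h := by
    have e : halfNorm (z.2 : H1 ℝ Ωp) ≤ √((√(P.g * P.S₀))⁻¹) * h := by
      rw [hh, ← Real.sqrt_mul (by positivity), halfNorm, ← mul_assoc]
      refine Real.sqrt_le_sqrt ?_
      gcongr
      · rw [← Real.sqrt_inv, ← Real.sqrt_mul (by positivity)]
        refine Real.le_sqrt_of_sq_le ?_
        rw [massForm_self, mul_add, inv_mul_cancel_left₀ hgS.ne']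
        have : 0 ≤ (P.g * P.S₀)⁻¹ * ‖val (z.1 : H1 Plane Ωf)‖ ^ 2 := by positivity
        linarith
      · exact norm_head_le z
    refine e.trans (mul_le_mul_of_nonneg_right ?_ (Real.sqrt_nonneg _))
    rw [hR]
    linarith
  have d1 : (w - w').1 + w'.1 = w.1 := by simp
  have d2 : (w - w').2 + w'.2 = w.2 := by simp
  have e : P.explicitForm w z - P.explicitForm w' z = convForm (w - w').1 w.1 z.1
      + convForm w'.1 (w - w').1 z.1 + P.coupling z.1 (w - w').2 - P.coupling (w - w').1 z.2 := by
    have e1 := convForm_add_left hΩf (w - w').1 w'.1 w.1 z.1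
    have e2 := convForm_add_mid hΩf w'.1 (w - w').1 w'.1 z.1
    have e3 := coupling_add_right hΩf hΩp P z.1 (w - w').2 w'.2
    have e4 := coupling_add_left hΩf hΩp P (w - w').1 w'.1 z.2
    rw [d1] at e1 e2 e4
    rw [d2] at e3
    rw [explicitForm, explicitForm, e1, e2, e3, e4]
    ring
  have hn0 := norm_nonneg (w - w')
  have hh0 : 0 ≤ h := Real.sqrt_nonneg _
  have hn1 : ‖(w - w').1‖ ≤ ‖w - w'‖ := norm_fst_le _
  have hn2 : ‖(w - w').2‖ ≤ ‖w - w'‖ := norm_snd_le _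
  have hb1 : |convForm (w - w').1 w.1 z.1| ≤ C * ‖w - w'‖ * ‖w‖ * (R * h) := by
    refine (H _ _ _).2.2.trans ?_
    gcongr
    · exact halfNorm_nonneg _
    · exact norm_fst_le w
  have hb2 : |convForm w'.1 (w - w').1 z.1| ≤ C * ‖w'‖ * ‖w - w'‖ * (R * h) := by
    refine (H _ _ _).2.2.trans ?_
    gcongr
    · exact halfNorm_nonneg _
    · exact norm_fst_le w'
  have hb3 : |P.coupling z.1 (w - w').2| ≤ D * (R * h) * ‖w - w'‖ := by
    refine (H' _ _).2.trans ?_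
    gcongr
    · exact halfNorm_nonneg _
    · exact (halfNorm_le _).trans hn2
  have hb4 : |P.coupling (w - w').1 z.2| ≤ D * ‖w - w'‖ * (R * h) := by
    refine (H' _ _).2.trans ?_
    gcongr
    · exact halfNorm_nonneg _
    · exact (halfNorm_le _).trans hn1
  rw [e]
  have t1 := abs_le.1 hb1
  have t2 := abs_le.1 hb2
  have t3 := abs_le.1 hb3
  have t4 := abs_le.1 hb4
  have s1 : 0 ≤ C * R * (‖w - w'‖ * h) := by positivity
  have s2 : 0 ≤ D * R * ((‖w‖ + ‖w'‖) * (‖w - w'‖ * h)) := by positivity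
  refine abs_le.2 ⟨?_, ?_⟩ <;> linarith [t1.1, t1.2, t2.1, t2.2, t3.1, t3.2, t4.1, t4.2]

end Params

end NSD
end

noncomputable section

namespace NSD

/-! ### The convective form vanishes on divergence-free fields -/

instance holderTriple_four_four_two : ENNReal.HolderTriple 4 4 2 where
  inv_add_inv_eq_inv := by
    rw [← two_mul, show (4 : ℝ≥0∞) = 2 * 2 by norm_num,
      ENNReal.mul_inv (Or.inl two_ne_zero) (Or.inl (by norm_num)), ← mul_assoc,
      ENNReal.mul_inv_cancel two_ne_zero (by norm_num), one_mul]

/-- Hölder with 1/4 + 1/4 + 1/2 = 1 makes the integral a jointly continuous function on L⁴ × L⁴ ×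
L². -/
theorem tendsto_integral_trilinear {E₁ E₂ E₃ : Type*} [NormedAddCommGroup E₁] [NormedSpace ℝ E₁]
    [NormedAddCommGroup E₂] [NormedSpace ℝ E₂] [NormedAddCommGroup E₃] [NormedSpace ℝ E₃]
    (B : E₁ →L[ℝ] E₂ →L[ℝ] E₃ →L[ℝ] ℝ) {μ : Measure Plane} {f : Plane → E₁} {k : Plane → E₂}
    {g : Plane → E₃} {fn : ℕ → Plane → E₁} {kn : ℕ → Plane → E₂} {gn : ℕ → Plane → E₃}
    (hf : MemLp f 4 μ) (hk : MemLp k 4 μ) (hg : MemLp g 2 μ) (hfn : ∀ n, MemLp (fn n) 4 μ)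
    (hkn : ∀ n, MemLp (kn n) 4 μ) (hgn : ∀ n, MemLp (gn n) 2 μ)
    (tf : Tendsto (fun n => eLpNorm (fn n - f) 4 μ) atTop (𝓝 0))
    (tk : Tendsto (fun n => eLpNorm (kn n - k) 4 μ) atTop (𝓝 0))
    (tg : Tendsto (fun n => eLpNorm (gn n - g) 2 μ) atTop (𝓝 0)) :
    Tendsto (fun n => ∫ x, B (fn n x) (kn n x) (gn n x) ∂μ) atTop
      (𝓝 (∫ x, B (f x) (k x) (g x) ∂μ)) := by
  have : Fact ((1 : ℝ≥0∞) ≤ 4) := ⟨by norm_num⟩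
  let T : Lp E₁ 4 μ → Lp E₂ 4 μ → Lp E₃ 2 μ → ℝ := fun a b c =>
    (ContinuousLinearMap.id ℝ (E₃ →L[ℝ] ℝ)).lpPairing μ 2 2 (B.holderL μ 4 4 2 a b) c
  have hT : ∀ {f : Plane → E₁} {k : Plane → E₂} {g : Plane → E₃} (hf : MemLp f 4 μ)
      (hk : MemLp k 4 μ) (hg : MemLp g 2 μ),
      T (hf.toLp f) (hk.toLp k) (hg.toLp g) = ∫ x, B (f x) (k x) (g x) ∂μ := by
    intro f k g hf hk hg
    simp only [T]
    rw [ContinuousLinearMap.lpPairing_eq_integral]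
    refine integral_congr_ae ?_
    have h1 := B.coeFn_holder (r := 2) (hf.toLp f) (hk.toLp k)
    filter_upwards [h1, hf.coeFn_toLp, hk.coeFn_toLp, hg.coeFn_toLp] with x hx hx1 hx2 hx3
    have hx' : (B.holderL μ 4 4 2 (hf.toLp f) (hk.toLp k)) x
      = B (hf.toLp f x) (hk.toLp k x) := hx
    rw [hx', hx1, hx2, hx3]
    rfl
  have hc : Continuous fun q : Lp E₁ 4 μ × Lp E₂ 4 μ × Lp E₃ 2 μ => T q.1 q.2.1 q.2.2 := by
    simp only [T]
    fun_prop
  have h1 := (Lp.tendsto_Lp_iff_tendsto_eLpNorm'' fn hfn f hf).2 tf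
  have h2 := (Lp.tendsto_Lp_iff_tendsto_eLpNorm'' kn hkn k hk).2 tk
  have h3 := (Lp.tendsto_Lp_iff_tendsto_eLpNorm'' gn hgn g hg).2 tg
  have := (hc.tendsto (hf.toLp f, hk.toLp k, hg.toLp g)).comp
    (h1.prodMk_nhds (h2.prodMk_nhds h3))
  rw [hT] at this
  refine this.congr fun n => ?_
  exact hT (hfn n) (hkn n) (hgn n)

/-- The real inner product as a continuous bilinear map. -/
def innerBilin : Plane →L[ℝ] Plane →L[ℝ] ℝ :=
  (isBoundedBilinearMap_inner (𝕜 := ℝ) (E := Plane)).toContinuousLinearMap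

/-- The trilinear map `(x, y, r) ↦ ⟪x, y⟫ r`. -/
def innerMul : Plane →L[ℝ] Plane →L[ℝ] ℝ →L[ℝ] ℝ :=
  (ContinuousLinearMap.compL ℝ Plane ℝ (ℝ →L[ℝ] ℝ) (ContinuousLinearMap.mul ℝ ℝ)).comp innerBilin

theorem innerMul_apply (x y : Plane) (r : ℝ) : innerMul x y r = inner ℝ x y * r := rfl

/-- The trilinear map `(x, y, z) ↦ xᵢ ⟪y, z⟫`. -/
def coordInner (i : Fin 2) : Plane →L[ℝ] Plane →L[ℝ] Plane →L[ℝ] ℝ :=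
  (EuclideanSpace.proj i : Plane →L[ℝ] ℝ).smulRight innerBilin

theorem coordInner_apply (i : Fin 2) (x y z : Plane) :
    coordInner i x y z = x i * inner ℝ y z := rfl

section Smooth

variable {Ω : Set Plane} {ψ : Plane → Plane}

theorem fderiv_normSq_mul_coord (hψ : ContDiff ℝ ∞ ψ) (i : Fin 2) (x : Plane) :
    fderiv ℝ (fun y => ‖ψ y‖ ^ 2 * ψ y i) x (basisVec i)
      = 2 * (ψ x i * inner ℝ (ψ x) (fderiv ℝ ψ x (basisVec i)))
        + inner ℝ (ψ x) (ψ x) * (fderiv ℝ ψ x (basisVec i) i) := by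
  have hd : HasFDerivAt ψ (fderiv ℝ ψ x) x := ((hψ.differentiable (by simp)) x).hasFDerivAt
  have h1 := hd.norm_sq
  have h2 : HasFDerivAt (fun y => ψ y i)
      ((EuclideanSpace.proj i : Plane →L[ℝ] ℝ).comp (fderiv ℝ ψ x)) x :=
    ((EuclideanSpace.proj i : Plane →L[ℝ] ℝ).hasFDerivAt).comp x hd
  rw [(h1.fun_mul h2).fderiv]
  simp
  ring

/-- The divergence theorem for the field |ψ|²ψ, one coordinate at a time; the product rule yields
the convective term twice plus |ψ|² times the divergence. -/
theorem integral_cubic_smooth (hΩ : IsBoundedLipschitz Ω) (hψ : ContDiff ℝ ∞ ψ)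
    (hc : HasCompactSupport ψ) :
    2 * (∑ i, ∫ x in Ω, coordInner i (ψ x) (ψ x) (fderiv ℝ ψ x (basisVec i)))
      + (∫ x in Ω, innerMul (ψ x) (ψ x) (∑ i, fderiv ℝ ψ x (basisVec i) i))
      = ∫ x, innerMul (ψ x) (ψ x) (inner ℝ (ψ x) (outwardNormal Ω x)) ∂(bdryMeasure Ω) := by
  have := hΩ.isFiniteMeasure_bdryMeasure
  have hcd : ∀ i : Fin 2, ContDiff ℝ ∞ fun y => ‖ψ y‖ ^ 2 * ψ y i := fun i =>
    (hψ.norm_sq ℝ).mul ((EuclideanSpace.proj i : Plane →L[ℝ] ℝ).contDiff.comp hψ)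
  have hcs : ∀ i : Fin 2, HasCompactSupport fun y => ‖ψ y‖ ^ 2 * ψ y i := fun i =>
    hc.mono fun y hy hz => hy (by simp [hz])
  have hdf := fun i => hΩ.hasDivergenceFormula ((hcd i).of_le (by exact_mod_cast le_top)) (hcs i)
    (basisVec i)
  have hψd : ∀ i, Continuous fun x => fderiv ℝ ψ x (basisVec i) := fun i =>
    (hψ.continuous_fderiv (by simp)).clm_apply continuous_const
  have hψc := hψ.continuous
  have hint : ∀ {h : Plane → ℝ}, Continuous h → (∀ x, ψ x = 0 → h x = 0) →
      Integrable h (volume.restrict Ω) := fun hh h0 =>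
    (hh.integrable_of_hasCompactSupport (hc.mono fun y hy hz => hy (h0 y hz))).restrict
  have e1 : ∀ i : Fin 2, Integrable (fun x => ψ x i * inner ℝ (ψ x) (fderiv ℝ ψ x (basisVec i)))
      (volume.restrict Ω) := fun i => by
    refine hint ?_ fun x hx => by simp [hx]
    have := hψd i
    fun_prop
  have e2 : ∀ i : Fin 2, Integrable (fun x => inner ℝ (ψ x) (ψ x) * (fderiv ℝ ψ x (basisVec i) i))
      (volume.restrict Ω) := fun i => by
    refine hint ?_ fun x hx => by simp [hx]
    have := hψd i
    fun_prop
  have hL : ∀ i : Fin 2, ∫ x in Ω, fderiv ℝ (fun y => ‖ψ y‖ ^ 2 * ψ y i) x (basisVec i)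
      = 2 * (∫ x in Ω, ψ x i * inner ℝ (ψ x) (fderiv ℝ ψ x (basisVec i)))
        + ∫ x in Ω, inner ℝ (ψ x) (ψ x) * (fderiv ℝ ψ x (basisVec i) i) := fun i => by
    simp only [fderiv_normSq_mul_coord hψ]
    rw [integral_add ((e1 i).const_mul 2) (e2 i), integral_const_mul]
  have hR : ∀ i : Fin 2, Integrable (fun y => ‖ψ y‖ ^ 2 * ψ y i *
      inner ℝ (outwardNormal Ω y) (basisVec i)) (bdryMeasure Ω) := fun i => by
    refine (((hcd i).continuous.integrable_of_hasCompactSupport (hcs i))).mul_bdd (c := 1) ?_ ?_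
    · exact hΩ.aemeasurable_outwardNormal.aestronglyMeasurable.inner aestronglyMeasurable_const
    · refine Eventually.of_forall fun y => ?_
      refine (norm_inner_le_norm _ _).trans ?_
      have : ‖basisVec i‖ = 1 := by simp [basisVec]
      rw [this, mul_one]
      exact norm_outwardNormal_le Ω y
  have hS : ∑ i : Fin 2, ∫ y, ‖ψ y‖ ^ 2 * ψ y i * inner ℝ (outwardNormal Ω y) (basisVec i)
        ∂(bdryMeasure Ω)
      = ∫ x, innerMul (ψ x) (ψ x) (inner ℝ (ψ x) (outwardNormal Ω x)) ∂(bdryMeasure Ω) := by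
    rw [← integral_finsetSum _ fun i _ => hR i]
    refine integral_congr_ae (Eventually.of_forall fun y => ?_)
    simp only [innerMul_apply, Fin.sum_univ_two, ← real_inner_self_eq_norm_sq, basisVec,
      PiLp.inner_apply]
    simp
    ring
  rw [← hS, ← Finset.sum_congr rfl fun i _ => hdf i, Finset.sum_congr rfl fun i _ => hL i,
    Finset.sum_add_distrib, ← Finset.mul_sum]
  congr 1
  rw [← integral_finsetSum _ fun i _ => e2 i]
  refine integral_congr_ae (Eventually.of_forall fun y => ?_)
  simp only [innerMul_apply, Finset.mul_sum]

end Smooth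

/-- The difference between the limit and one approximant is itself a smooth limit, so the
multiplicative bounds apply to it and upgrade H¹ convergence to L⁴ convergence, inside and on the
boundary. -/
theorem IsSmoothLimit.tendsto_four {F : Type} [NormedAddCommGroup F] [InnerProductSpace ℝ F]
    {Ω : Set Plane} (hΩ : IsBoundedLipschitz Ω) {f : Plane → F}
    {G : Fin 2 → Plane → F} {b : Plane → F} {ψ : ℕ → Plane → F} (h : IsSmoothLimit Ω f G b ψ) :
    Tendsto (fun n => eLpNorm (ψ n - f) 4 (volume.restrict Ω)) atTop (𝓝 0) ∧
    Tendsto (fun n => eLpNorm (ψ n - b) 4 (bdryMeasure Ω)) atTop (𝓝 0) := by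
  obtain ⟨C, hC, H⟩ := hΩ.exists_limit_bounds F
  set μ : Measure Plane := volume.restrict Ω with hμ
  have hB := fun n => H _ _ _ _ (h.sub_smooth hΩ (h.contDiff n) (h.hasCompactSupport n)) _ rfl
  have hN : Tendsto (fun n => eLpNorm (fun x => f x - ψ n x) 2 μ
      + ∑ i, eLpNorm (fun x => G i x - fderiv ℝ (ψ n) x (basisVec i)) 2 μ) atTop (𝓝 0) := by
    have := h.tendsto.add (tendsto_finsetSum Finset.univ fun i _ => h.tendsto_grad i)
    simpa using this
  have hP : Tendsto (fun n => C * (eLpNorm (fun x => f x - ψ n x) 2 μ *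
      (eLpNorm (fun x => f x - ψ n x) 2 μ
      + ∑ i, eLpNorm (fun x => G i x - fderiv ℝ (ψ n) x (basisVec i)) 2 μ))) atTop (𝓝 0) := by
    have := ENNReal.Tendsto.const_mul (a := C) (ENNReal.Tendsto.mul h.tendsto
      (Or.inr ENNReal.zero_ne_top) hN (Or.inr ENNReal.zero_ne_top)) (Or.inr hC)
    simpa using this
  have hM : Tendsto (fun n => C * (eLpNorm (fun x => f x - ψ n x) 2 μ
      + ∑ i, eLpNorm (fun x => G i x - fderiv ℝ (ψ n) x (basisVec i)) 2 μ)) atTop (𝓝 0) := by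
    simpa using ENNReal.Tendsto.const_mul (a := C) hN (Or.inr hC)
  constructor
  · have h2 : Tendsto (fun n => (eLpNorm (fun x => f x - ψ n x) 4 μ ^ 2) ^ ((2 : ℕ) : ℝ)⁻¹) atTop
        (𝓝 0) := by
      have := (ENNReal.continuous_rpow_const (y := ((2 : ℕ) : ℝ)⁻¹)).tendsto 0
      rw [ENNReal.zero_rpow_of_pos (by norm_num)] at this
      exact this.comp (tendsto_of_tendsto_of_tendsto_of_le_of_le tendsto_const_nhds hP
        (fun _ => bot_le) fun n => (hB n).1)
    refine h2.congr fun n => ?_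
    rw [ENNReal.pow_rpow_inv_natCast two_ne_zero]
    exact eLpNorm_sub_comm f (ψ n) 4 μ
  · refine tendsto_of_tendsto_of_tendsto_of_le_of_le tendsto_const_nhds hM
      (fun _ => bot_le) fun n => ?_
    simp only [eLpNorm_sub_comm (ψ n) b]
    exact (hB n).2.2

theorem memLp_coord {μ : Measure Plane} {G : Plane → Plane} (i : Fin 2) (h : MemLp G 2 μ) :
    MemLp (fun x => G x i) 2 μ :=
  (EuclideanSpace.proj i : Plane →L[ℝ] ℝ).comp_memLp' h

theorem memLp_inner_outwardNormal {Ω : Set Plane} (hΩ : IsBoundedLipschitz Ω) {b : Plane → Plane}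
    (hb : MemLp b 2 (bdryMeasure Ω)) :
    MemLp (fun x => inner ℝ (b x) (outwardNormal Ω x)) 2 (bdryMeasure Ω) :=
  hb.mono (hb.1.inner hΩ.aemeasurable_outwardNormal.aestronglyMeasurable)
    (Eventually.of_forall fun x => abs_inner_le_of_norm_le_one (norm_outwardNormal_le Ω x))

/-- The identity obtained by integrating the divergence of `|u|² u`. -/
theorem IsSmoothLimit.integral_cubic {Ω : Set Plane} (hΩ : IsBoundedLipschitz Ω)
    {f : Plane → Plane} {G : Fin 2 → Plane → Plane} {b : Plane → Plane} {ψ : ℕ → Plane → Plane}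
    (h : IsSmoothLimit Ω f G b ψ) (m4 : MemLp f 4 (volume.restrict Ω))
    (m4b : MemLp b 4 (bdryMeasure Ω)) :
    2 * (∑ i, ∫ x in Ω, coordInner i (f x) (f x) (G i x))
      + (∫ x in Ω, innerMul (f x) (f x) (∑ i, G i x i))
      = ∫ x, innerMul (b x) (b x) (inner ℝ (b x) (outwardNormal Ω x)) ∂(bdryMeasure Ω) := by
  have hfin := hΩ.isFiniteMeasure_bdryMeasure
  obtain ⟨t4, t4b⟩ := h.tendsto_four hΩ
  have hψc : ∀ k, Continuous (ψ k) := fun k => (h.contDiff k).continuous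
  have pg2 : ∀ k i, MemLp (fun x => fderiv ℝ (ψ k) x (basisVec i)) 2 (volume.restrict Ω) :=
    fun k i => (((h.contDiff k).continuous_fderiv (by simp)).clm_apply
      continuous_const).memLp_of_hasCompactSupport
      ((h.hasCompactSupport k).fderiv_apply ℝ (basisVec i))
  have tg : ∀ i, Tendsto (fun k => eLpNorm ((fun x => fderiv ℝ (ψ k) x (basisVec i)) - G i)
      2 (volume.restrict Ω)) atTop (𝓝 0) := fun i => by
    refine (h.tendsto_grad i).congr fun k => ?_
    exact eLpNorm_sub_comm (G i) (fun x => fderiv ℝ (ψ k) x (basisVec i)) 2 _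
  have td : Tendsto (fun k => eLpNorm ((fun x => ∑ i, fderiv ℝ (ψ k) x (basisVec i) i)
      - fun x => ∑ i, G i x i) 2 (volume.restrict Ω)) atTop (𝓝 0) := by
    have hsum := tendsto_finsetSum Finset.univ fun i _ => tg i
    simp only [Finset.sum_const_zero] at hsum
    refine tendsto_of_tendsto_of_tendsto_of_le_of_le tendsto_const_nhds hsum
      (fun _ => bot_le) fun k => ?_
    have e : ((fun x => ∑ i, fderiv ℝ (ψ k) x (basisVec i) i) - fun x => ∑ i, G i x i)
        = ∑ i, fun x => (fderiv ℝ (ψ k) x (basisVec i) - G i x) i := by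
      funext x
      simp [Finset.sum_apply, Finset.sum_sub_distrib]
    rw [e]
    refine (eLpNorm_sum_le (fun i _ => (memLp_coord i ((pg2 k i).sub (h.memLp_grad i))).1)
      (by norm_num)).trans (Finset.sum_le_sum fun i _ => ?_)
    exact eLpNorm_mono fun x => PiLp.norm_apply_le (fderiv ℝ (ψ k) x (basisVec i) - G i x) i
  have tn : Tendsto (fun k => eLpNorm ((fun x => inner ℝ (ψ k x) (outwardNormal Ω x))
      - fun x => inner ℝ (b x) (outwardNormal Ω x)) 2 (bdryMeasure Ω)) atTop (𝓝 0) := by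
    refine tendsto_of_tendsto_of_tendsto_of_le_of_le tendsto_const_nhds h.tendsto_bdry
      (fun _ => bot_le) fun k => eLpNorm_mono fun x => ?_
    rw [Pi.sub_apply, ← inner_sub_left, norm_sub_rev (b x)]
    exact abs_inner_le_of_norm_le_one (norm_outwardNormal_le Ω x)
  have L1 := fun i => tendsto_integral_trilinear (coordInner i) m4 m4 (h.memLp_grad i)
    (fun k => (hψc k).memLp_of_hasCompactSupport (h.hasCompactSupport k))
    (fun k => (hψc k).memLp_of_hasCompactSupport (h.hasCompactSupport k))
    (fun k => pg2 k i) t4 t4 (tg i)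
  have L2 := tendsto_integral_trilinear innerMul m4 m4
    (memLp_finsetSum _ fun i _ => memLp_coord i (h.memLp_grad i))
    (fun k => (hψc k).memLp_of_hasCompactSupport (h.hasCompactSupport k))
    (fun k => (hψc k).memLp_of_hasCompactSupport (h.hasCompactSupport k))
    (fun k => memLp_finsetSum _ fun i _ => memLp_coord i (pg2 k i)) t4 t4 td
  have L3 := tendsto_integral_trilinear innerMul m4b m4b (memLp_inner_outwardNormal hΩ h.memLp_bdry)
    (fun k => (hψc k).memLp_of_hasCompactSupport (h.hasCompactSupport k))
    (fun k => (hψc k).memLp_of_hasCompactSupport (h.hasCompactSupport k))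
    (fun k => memLp_inner_outwardNormal hΩ
      ((hψc k).memLp_of_hasCompactSupport (h.hasCompactSupport k))) t4b t4b tn
  refine tendsto_nhds_unique ((((tendsto_finsetSum Finset.univ fun i _ => L1 i).const_mul 2).add
    L2).congr fun k => ?_) L3
  exact integral_cubic_smooth hΩ (h.contDiff k) (h.hasCompactSupport k)

/-- In the cubic identity the divergence term vanishes, and the zero trace off Γ reduces the
boundary integral to the interface. What remains says that twice the convective integral equals the
interface integral, which the factor 1/2 in the form cancels. -/
theorem convForm_self_eq_zero {Ωf Ωp : Set Plane} (hΩf : IsBoundedLipschitz Ωf)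
    (u : VelSpace Ωf Ωp) (hdiv : ∀ q : L2 Ωf ℝ, divPairing q (u : H1 Plane Ωf) = 0) :
    convForm u u u = 0 := by
  obtain ⟨ψ, hψ⟩ := (isTrace_trace u).exists_seq
  obtain ⟨C, -, HC⟩ := hΩf.exists_trace_bounds Plane
  obtain ⟨b1, -, b3⟩ := HC _ _ (isTrace_trace u)
  have m4 : MemLp (val u.1) 4 (volume.restrict Ωf) :=
    ⟨Lp.aestronglyMeasurable _, b1.trans_lt ENNReal.ofReal_lt_top⟩
  have m4b : MemLp (trace u.1) 4 (bdryMeasure Ωf) :=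
    ⟨Lp.aestronglyMeasurable _, b3.trans_lt ENNReal.ofReal_lt_top⟩
  have key := hψ.integral_cubic hΩf m4 m4b
  -- The divergence is tested with |u|², admissible because u is in L⁴.
  have hq : MemLp (fun x => inner ℝ (val u.1 x) (val u.1 x)) 2 (volume.restrict Ωf) := by
    have h1 : MemLp (fun x => ‖val u.1 x‖ * ‖val u.1 x‖) 2 (volume.restrict Ωf) :=
      MemLp.mul (p := 4) (q := 4) m4.norm m4.norm
    refine h1.congr_norm (m4.1.inner m4.1) (Eventually.of_forall fun x => ?_)
    rw [real_inner_self_eq_norm_mul_norm]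
  have hdiv0 : ∫ x in Ωf, innerMul (val u.1 x) (val u.1 x) (∑ i, grad u.1 i x i) = 0 := by
    rw [← hdiv (hq.toLp _), divPairing]
    refine integral_congr_ae ?_
    filter_upwards [hq.coeFn_toLp] with x hx
    rw [hx, innerMul_apply]
  have hbd : ∫ x, innerMul (trace u.1 x) (trace u.1 x)
        (inner ℝ (trace u.1 x) (outwardNormal Ωf x)) ∂(bdryMeasure Ωf)
      = ∫ x, convBdryDensity u u u x ∂(ifaceMeasure Ωf Ωp) := by
    have hr : ifaceMeasure Ωf Ωp = (bdryMeasure Ωf).restrict (interface Ωf Ωp) := by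
      have hm : MeasurableSet (interface Ωf Ωp) :=
        (isClosed_frontier.inter isClosed_frontier).measurableSet
      have hs : interface Ωf Ωp ⊆ frontier Ωf := inter_subset_left
      rw [ifaceMeasure, bdryMeasure, Measure.restrict_restrict hm, inter_eq_self_of_subset_left hs]
    rw [hr]
    refine (setIntegral_eq_integral_of_ae_compl_eq_zero ?_).symm
    have hfr : ∀ᵐ x ∂(bdryMeasure Ωf), x ∈ frontier Ωf :=
      ae_restrict_mem isClosed_frontier.measurableSet
    filter_upwards [trace_ae_eq_zero hΩf u, hfr] with x hx hxf hxi
    have hx0 : trace u.1 x = 0 := hx ⟨hxf, hxi⟩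
    simp [hx0]
  have e : ∑ i, ∫ x in Ωf, convDensity u u u i x
      = ∑ i, ∫ x in Ωf, coordInner i (val u.1 x) (val u.1 x) (grad u.1 i x) := by
    refine Finset.sum_congr rfl fun i _ => integral_congr_ae (Eventually.of_forall fun x => ?_)
    simp only [convDensity, coordInner_apply, real_inner_comm (val u.1 x)]
  rw [hdiv0, add_zero, hbd] at key
  rw [convForm_eq hΩf, e, ← key]
  ring

end NSD
end

noncomputable section

namespace NSD

/-! ### Consistency in time -/

instance isFiniteMeasure_timeMeasure (T : ℝ) : IsFiniteMeasure (timeMeasure T) :=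
  inferInstanceAs (IsFiniteMeasure (volume.restrict (Ioo 0 T)))

theorem intervalIntegrable_of_timeMeasure {E : Type*} [NormedAddCommGroup E] {T : ℝ} {f : ℝ → E}
    (hf : Integrable f (timeMeasure T)) {s t : ℝ} (hs : 0 ≤ s) (hst : s ≤ t) (ht : t ≤ T) :
    IntervalIntegrable f volume s t := by
  rw [intervalIntegrable_iff_integrableOn_Ioo_of_le hst]
  exact IntegrableOn.mono_set hf (Ioo_subset_Ioo hs ht)

theorem ae_mem_uIoc_of_timeMeasure {T : ℝ} {p : ℝ → Prop} (h : ∀ᵐ t ∂(timeMeasure T), p t)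
    {s t : ℝ} (hs : 0 ≤ s) (hst : s ≤ t) (ht : t ≤ T) : ∀ᵐ r : ℝ, r ∈ uIoc s t → p r := by
  have h2 := (ae_restrict_iff' measurableSet_Ioo).1 h
  have h3 : ∀ᵐ r : ℝ, r ≠ T := by simp [ae_iff, measure_singleton]
  filter_upwards [h2, h3] with r hr hrT hrb
  rw [uIoc_of_le hst] at hrb
  exact hr ⟨hs.trans_lt hrb.1, lt_of_le_of_ne (hrb.2.trans ht) hrT⟩

section Consistency

variable {F : Type} [NormedAddCommGroup F] [InnerProductSpace ℝ F] [CompleteSpace F]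
  {Ω S : Set Plane} {T : ℝ} {u : ℝ → H1Vanishing F Ω S} {u' : ℝ → L2 Ω F} {V : ℝ → H1 F Ω}
  {Z : ℝ → H1Vanishing F Ω S →L[ℝ] ℝ}

omit [CompleteSpace F] in
theorem memLp_norm_functional (hZ : MemLp Z 2 (timeMeasure T)) :
    MemLp (fun t => ‖Z t‖) 2 (timeMeasure T) := by
  have h1 : Continuous fun A : H1Vanishing F Ω S →L[ℝ] ℝ => ‖A‖ :=
    continuous_norm (E := H1Vanishing F Ω S →L[ℝ] ℝ)
  refine ⟨h1.comp_aestronglyMeasurable hZ.1, lt_of_eq_of_lt ?_ hZ.2⟩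
  exact eLpNorm_norm (F := H1Vanishing F Ω S →L[ℝ] ℝ) Z

theorem norm_sub_le_integral (hΩ : IsOpen Ω)
    (hu : ∀ t ∈ Icc 0 T, val (u t : H1 F Ω) = val (u 0 : H1 F Ω) + ∫ s in (0 : ℝ)..t, u' s)
    (hV : MemLp V 2 (timeMeasure T)) (hVu : ∀ᵐ t ∂(timeMeasure T), val (V t) = u' t)
    {s t : ℝ} (hs : 0 ≤ s) (hst : s ≤ t) (ht : t ≤ T) :
    ‖u t - u s‖ ≤ ∫ r in s..t, ‖V r‖ := by
  have hVi := intervalIntegrable_of_timeMeasure (hV.integrable one_le_two) le_rfl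
    ((hs.trans hst).trans ht) le_rfl
  have h : (u t : H1 F Ω) - (u s : H1 F Ω) = ∫ r in s..t, V r :=
    (sub_eq_intervalIntegral (u := fun t => (u t : H1 F Ω)) hΩ hu hVi hVu hs hst ht).2
  have e : ‖u t - u s‖ = ‖(u t : H1 F Ω) - (u s : H1 F Ω)‖ := rfl
  rw [e, h]
  exact intervalIntegral.norm_integral_le_integral_norm hst

/-- The increment is the integral of u', and each value of u' differs from that at the right
endpoint by an integral of the second derivative. That derivative is known only in the dual space,
so the test function is measured in H¹. -/
theorem abs_inner_increment_sub_le (hΩ : IsOpen Ω)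
    (hu : ∀ t ∈ Icc 0 T, val (u t : H1 F Ω) = val (u 0 : H1 F Ω) + ∫ s in (0 : ℝ)..t, u' s)
    (hV : MemLp V 2 (timeMeasure T)) (hVu : ∀ᵐ t ∂(timeMeasure T), val (V t) = u' t)
    (hZ : Integrable (fun r => ‖Z r‖) (timeMeasure T))
    (hZu : ∀ s ∈ Ioc 0 T, ∀ t ∈ Ioc 0 T, ∀ v : H1Vanishing F Ω S,
      inner ℝ (u' t - u' s) (val (v : H1 F Ω)) = ∫ r in s..t, Z r v)
    {s t : ℝ} (hs : 0 ≤ s) (hst : s ≤ t) (ht : t ≤ T) (v : H1Vanishing F Ω S) :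
    |inner ℝ (val (u t : H1 F Ω) - val (u s : H1 F Ω)) (val (v : H1 F Ω))
        - (t - s) * inner ℝ (u' t) (val (v : H1 F Ω))|
      ≤ (t - s) * ((∫ r in s..t, ‖Z r‖) * ‖v‖) := by
  have hVi := intervalIntegrable_of_timeMeasure (hV.integrable one_le_two) le_rfl
    ((hs.trans hst).trans ht) le_rfl
  obtain ⟨hI, hd⟩ := sub_eq_intervalIntegral (u := fun t => (u t : H1 F Ω)) hΩ hu hVi hVu hs hst ht
  have hZi := intervalIntegrable_of_timeMeasure hZ hs hst ht
  let L : H1 F Ω →L[ℝ] ℝ := (innerSL ℝ (val (v : H1 F Ω))).comp (valL F Ω)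
  have hL : ∀ w : H1 F Ω, L w = inner ℝ (val w) (val (v : H1 F Ω)) := fun w =>
    real_inner_comm (val w) (val (v : H1 F Ω))
  have e1 : inner ℝ (val (u t : H1 F Ω) - val (u s : H1 F Ω)) (val (v : H1 F Ω))
      = ∫ r in s..t, inner ℝ (val (V r)) (val (v : H1 F Ω)) := by
    rw [← val_sub, ← hL, hd, ← L.intervalIntegral_comp_comm hI]
    simp only [hL]
  have hLi : IntervalIntegrable (fun r => inner ℝ (val (V r)) (val (v : H1 F Ω))) volume s t := by
    simp only [← hL]
    exact ⟨L.integrable_comp hI.1, L.integrable_comp hI.2⟩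
  have e2 : (t - s) * inner ℝ (u' t) (val (v : H1 F Ω))
      = ∫ _ in s..t, inner ℝ (u' t) (val (v : H1 F Ω)) := by
    rw [intervalIntegral.integral_const, smul_eq_mul]
  rw [e1, e2, ← intervalIntegral.integral_sub hLi intervalIntegrable_const]
  -- The integral from r to t is enlarged to the whole step, which gives a bound uniform in r.
  have hb : ∀ᵐ r : ℝ, r ∈ uIoc s t → ‖inner ℝ (val (V r)) (val (v : H1 F Ω))
      - inner ℝ (u' t) (val (v : H1 F Ω))‖ ≤ (∫ r in s..t, ‖Z r‖) * ‖v‖ := by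
    filter_upwards [ae_mem_uIoc_of_timeMeasure hVu hs hst ht] with r hr hrm
    rw [hr hrm]
    rw [uIoc_of_le hst] at hrm
    have hr0 : 0 < r := hs.trans_lt hrm.1
    rw [← inner_sub_left, hZu t ⟨hr0.trans_le hrm.2, ht⟩ r ⟨hr0, hrm.2.trans ht⟩ v,
      intervalIntegral.integral_symm, norm_neg]
    have hZr := intervalIntegrable_of_timeMeasure hZ hr0.le hrm.2 ht
    calc ‖∫ q in r..t, Z q v‖ ≤ ∫ q in r..t, ‖Z q‖ * ‖v‖ :=
          intervalIntegral.norm_integral_le_of_norm_le hrm.2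
            (Eventually.of_forall fun q _ => (Z q).le_opNorm v) (hZr.mul_const _)
      _ = (∫ q in r..t, ‖Z q‖) * ‖v‖ := intervalIntegral.integral_mul_const _ _
      _ ≤ _ := by
          gcongr
          exact intervalIntegral.integral_mono_interval hrm.1.le hrm.2 le_rfl
            (Eventually.of_forall fun q => norm_nonneg (Z q)) hZi
  have := intervalIntegral.norm_integral_le_of_norm_le_const_ae hb
  rw [abs_of_nonneg (sub_nonneg.2 hst), mul_comm] at this
  exact this

omit [CompleteSpace F] in
theorem continuousOn_val {T : ℝ} (hT : 0 ≤ T)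
    (hu : ∀ t ∈ Icc 0 T, val (u t : H1 F Ω) = val (u 0 : H1 F Ω) + ∫ s in (0 : ℝ)..t, u' s)
    (hV : MemLp V 2 (timeMeasure T)) (hVu : ∀ᵐ t ∂(timeMeasure T), val (V t) = u' t) :
    ContinuousOn (fun t => val (u t : H1 F Ω)) (Icc 0 T) := by
  have hi : Integrable u' (timeMeasure T) :=
    ((valL F Ω).integrable_comp (hV.integrable one_le_two)).congr hVu
  have hi' : IntegrableOn u' (uIcc 0 T) := by
    rw [uIcc_of_le hT, integrableOn_Icc_iff_integrableOn_Ioo]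
    exact hi
  have := (intervalIntegral.continuousOn_primitive_interval hi').const_add (val (u 0 : H1 F Ω))
  rw [uIcc_of_le hT] at this
  exact this.congr hu

end Consistency

/-- The integral of the squared deviation of ϖ from its mean over the interval is nonnegative. -/
theorem sq_intervalIntegral_le {ϖ : ℝ → ℝ} {s t : ℝ} (hst : s < t)
    (h : IntervalIntegrable ϖ volume s t) (h2 : IntervalIntegrable (fun r => ϖ r ^ 2) volume s t) :
    (∫ r in s..t, ϖ r) ^ 2 ≤ (t - s) * ∫ r in s..t, ϖ r ^ 2 := by
  set I := ∫ r in s..t, ϖ r with hI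
  have hd : 0 < t - s := sub_pos.2 hst
  set c := I / (t - s) with hc
  have hcI : c * (t - s) = I := div_mul_cancel₀ _ hd.ne'
  have h0 : 0 ≤ ∫ r in s..t, (ϖ r - c) ^ 2 :=
    intervalIntegral.integral_nonneg hst.le fun _ _ => sq_nonneg _
  have e : ∫ r in s..t, (ϖ r - c) ^ 2 = (∫ r in s..t, ϖ r ^ 2) - 2 * c * I + c ^ 2 * (t - s) := by
    have e1 : ∀ r, (ϖ r - c) ^ 2 = ϖ r ^ 2 - 2 * c * ϖ r + c ^ 2 := fun r => by ring
    simp only [e1]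
    rw [intervalIntegral.integral_add (h2.sub (h.const_mul _)) intervalIntegrable_const,
      intervalIntegral.integral_sub h2 (h.const_mul _), intervalIntegral.integral_const_mul,
      intervalIntegral.integral_const, smul_eq_mul]
    ring
  rw [e] at h0
  calc I ^ 2 = (t - s) * (2 * c * I - c ^ 2 * (t - s)) := by rw [← hcI]; ring
    _ ≤ _ := by
      gcongr
      linarith

/-- Sums of the integrals of a square integrable function over the steps of a uniform grid. -/
theorem sum_step_integral_le {ϖ : ℝ → ℝ} {T : ℝ} (h0 : ∀ r, 0 ≤ ϖ r)
    (h : Integrable ϖ (timeMeasure T)) (h2 : Integrable (fun r => ϖ r ^ 2) (timeMeasure T))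
    {Δt : ℝ} (hΔ : 0 < Δt) {K : ℕ} (hK : K * Δt ≤ T) :
    (∑ j ∈ Finset.range K, ∫ r in (j * Δt)..((j + 1 : ℕ) * Δt), ϖ r) ≤ ∫ r in (0 : ℝ)..T, ϖ r ∧
    (∑ j ∈ Finset.range K, (∫ r in (j * Δt)..((j + 1 : ℕ) * Δt), ϖ r) ^ 2)
      ≤ Δt * ∫ r in (0 : ℝ)..T, ϖ r ^ 2 := by
  have hKT : 0 ≤ (K : ℝ) * Δt := by positivity
  have hT : 0 ≤ T := hKT.trans hK
  have hle : ∀ j : ℕ, (j : ℝ) * Δt < ((j + 1 : ℕ) : ℝ) * Δt := fun j => by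
    push_cast
    linarith
  have hbd : ∀ j < K, ((j + 1 : ℕ) : ℝ) * Δt ≤ T := fun j hj => by
    refine le_trans ?_ hK
    gcongr
    exact hj
  have hint : ∀ {f : ℝ → ℝ}, Integrable f (timeMeasure T) → ∀ j < K,
      IntervalIntegrable f volume (j * Δt) ((j + 1 : ℕ) * Δt) := fun hf j hj =>
    intervalIntegrable_of_timeMeasure hf (by positivity) (hle j).le (hbd j hj)
  have hsum : ∀ {f : ℝ → ℝ}, Integrable f (timeMeasure T) → (∀ r, 0 ≤ f r) →
      ∑ j ∈ Finset.range K, ∫ r in (j * Δt)..((j + 1 : ℕ) * Δt), f r ≤ ∫ r in (0 : ℝ)..T, f r := by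
    intro f hf hf0
    rw [intervalIntegral.sum_integral_adjacent_intervals (a := fun j : ℕ => (j : ℝ) * Δt)
      (hint hf)]
    rw [Nat.cast_zero, zero_mul]
    exact intervalIntegral.integral_mono_interval le_rfl hKT hK (Eventually.of_forall hf0)
      (intervalIntegrable_of_timeMeasure hf le_rfl hT le_rfl)
  refine ⟨hsum h h0, ?_⟩
  calc _ ≤ ∑ j ∈ Finset.range K, Δt * ∫ r in (j * Δt)..((j + 1 : ℕ) * Δt), ϖ r ^ 2 := by
        refine Finset.sum_le_sum fun j hj => ?_
        have hj' := Finset.mem_range.1 hj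
        refine (sq_intervalIntegral_le (hle j) (hint h j hj') (hint h2 j hj')).trans (le_of_eq ?_)
        congr 1
        push_cast
        ring
    _ = Δt * ∑ j ∈ Finset.range K, ∫ r in (j * Δt)..((j + 1 : ℕ) * Δt), ϖ r ^ 2 :=
        (Finset.mul_sum _ _ _).symm
    _ ≤ _ := by
        gcongr
        exact hsum h2 fun r => sq_nonneg _

end NSD
end

noncomputable section

namespace NSD

/-! ### The exact solution as a curve in the state space -/

/-- The map `toH1` as a continuous linear map. -/
def toH1L (F : Type) [NormedAddCommGroup F] [InnerProductSpace ℝ F] (Ω : Set Plane) :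
    H2 F Ω →L[ℝ] H1 F Ω :=
  (ContinuousLinearMap.fst ℝ (H1 F Ω) (Fin 2 → H1 F Ω)).comp (H2 F Ω).subtypeL

theorem memLp_toH1 {F : Type} [NormedAddCommGroup F] [InnerProductSpace ℝ F] {Ω : Set Plane}
    {T : ℝ} {V : ℝ → H2 F Ω} (hV : MemLp V 2 (timeMeasure T)) :
    MemLp (fun t => toH1 (V t)) 2 (timeMeasure T) :=
  (toH1L F Ω).comp_memLp' hV

variable {P : Params} {Ωf Ωp : Set Plane} {ff : ℝ → VelSpace Ωf Ωp →L[ℝ] ℝ}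
  {fp : ℝ → HeadSpace Ωf Ωp →L[ℝ] ℝ} {u : ℝ → VelSpace Ωf Ωp} {u' : ℝ → L2 Ωf Plane}
  {p : ℝ → L2 Ωf ℝ} {φ : ℝ → HeadSpace Ωf Ωp} {φ' : ℝ → L2 Ωp ℝ}

/-- The pairing of the time derivative of the solution with a test pair. -/
def Params.rateForm (P : Params) (u' : ℝ → L2 Ωf Plane) (φ' : ℝ → L2 Ωp ℝ) (t : ℝ)
    (z : StateSpace Ωf Ωp) : ℝ :=
  inner ℝ (u' t) (val (z.1 : H1 Plane Ωf)) + P.g * P.S₀ * inner ℝ (φ' t) (val (z.2 : H1 ℝ Ωp))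

/-- A square integrable function of time that controls the increments of the solution and the
error made by the backward difference quotient. -/
theorem exists_time_modulus (hΩf : IsOpen Ωf) (hΩp : IsOpen Ωp)
    (hsol : IsWeakSolution P ff fp u u' p φ φ') (hreg : IsRegular P ff fp u u' p φ φ') :
    ∃ ϖ : ℝ → ℝ, (∀ r, 0 ≤ ϖ r) ∧ MemLp ϖ 2 (timeMeasure P.T) ∧
      ∀ s t : ℝ, 0 ≤ s → s ≤ t → t ≤ P.T →
        ‖((u t, φ t) : StateSpace Ωf Ωp) - (u s, φ s)‖ ≤ ∫ r in s..t, ϖ r ∧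
        ∀ z : StateSpace Ωf Ωp,
          |P.massForm Ωf Ωp ((u t, φ t) - (u s, φ s)) z - (t - s) * P.rateForm u' φ' t z|
            ≤ (t - s) * (∫ r in s..t, ϖ r) * ‖z‖ := by
  obtain ⟨V, hV, hVu⟩ := hreg.u'_H2
  obtain ⟨V', hV', hVφ⟩ := hreg.φ'_H2
  obtain ⟨Z, hZ, hZu⟩ := hreg.u''
  obtain ⟨Z', hZ', hZφ⟩ := hreg.φ''
  have hgS := mul_pos P.g_pos P.S₀_pos
  have mV := memLp_toH1 hV
  have mV' := memLp_toH1 hV'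
  have mZ := memLp_norm_functional hZ
  have mZ' := memLp_norm_functional hZ'
  set a : ℝ → ℝ := fun r => ‖toH1 (V r)‖ with ha
  set b : ℝ → ℝ := fun r => ‖toH1 (V' r)‖ with hb
  set c : ℝ → ℝ := fun r => ‖Z r‖ with hc
  set d : ℝ → ℝ := fun r => P.g * P.S₀ * ‖Z' r‖ with hd
  -- One modulus serves both estimates: the H¹ norms of the first derivatives control increments,
  -- the dual norms of the second derivatives control the difference quotient. The factor g S₀ on
  -- the last term comes from the mass form.
  have mϖ : MemLp (fun r => a r + b r + c r + d r) 2 (timeMeasure P.T) :=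
    ((mV.norm.add mV'.norm).add mZ).add (mZ'.const_mul (P.g * P.S₀))
  have a0 : ∀ r, 0 ≤ a r := fun r => norm_nonneg _
  have b0 : ∀ r, 0 ≤ b r := fun r => norm_nonneg _
  have c0 : ∀ r, 0 ≤ c r := fun r => norm_nonneg (Z r)
  have d0 : ∀ r, 0 ≤ d r := fun r => mul_nonneg hgS.le (norm_nonneg (Z' r))
  refine ⟨fun r => a r + b r + c r + d r, fun r => by linarith [a0 r, b0 r, c0 r, d0 r], mϖ,
    fun s t hs hst ht => ?_⟩
  have hle : ∀ {f : ℝ → ℝ}, Integrable f (timeMeasure P.T) →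
      (∀ r, f r ≤ a r + b r + c r + d r) →
      ∫ r in s..t, f r ≤ ∫ r in s..t, (a r + b r + c r + d r) := fun hf h =>
    intervalIntegral.integral_mono_on hst (intervalIntegrable_of_timeMeasure hf hs hst ht)
      (intervalIntegrable_of_timeMeasure (mϖ.integrable one_le_two) hs hst ht) fun r _ => h r
  have hnu := norm_sub_le_integral hΩf hsol.deriv_u mV hVu hs hst ht
  have hnφ := norm_sub_le_integral hΩp hsol.deriv_φ mV' hVφ hs hst ht
  refine ⟨?_, fun z => ?_⟩
  · refine max_le (hnu.trans (hle (mV.norm.integrable one_le_two) fun r => ?_))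
      (hnφ.trans (hle (mV'.norm.integrable one_le_two) fun r => ?_))
    · have : ‖toH1 (V r)‖ = a r := rfl
      linarith [b0 r, c0 r, d0 r]
    · have : ‖toH1 (V' r)‖ = b r := rfl
      linarith [a0 r, c0 r, d0 r]
  · have h1 := abs_inner_increment_sub_le hΩf hsol.deriv_u mV hVu (mZ.integrable one_le_two) hZu
      hs hst ht z.1
    have h2 := abs_inner_increment_sub_le hΩp hsol.deriv_φ mV' hVφ (mZ'.integrable one_le_two) hZφ
      hs hst ht z.2
    have hz1 : ‖z.1‖ ≤ ‖z‖ := norm_fst_le z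
    have hz2 : ‖z.2‖ ≤ ‖z‖ := norm_snd_le z
    have ic : 0 ≤ ∫ r in s..t, c r := intervalIntegral.integral_nonneg hst fun r _ => c0 r
    have id0 : 0 ≤ ∫ r in s..t, ‖Z' r‖ :=
      intervalIntegral.integral_nonneg hst fun r _ => norm_nonneg (Z' r)
    have hcd : (∫ r in s..t, c r) + P.g * P.S₀ * ∫ r in s..t, ‖Z' r‖
        ≤ ∫ r in s..t, (a r + b r + c r + d r) := by
      rw [← intervalIntegral.integral_const_mul, ← intervalIntegral.integral_add
        (intervalIntegrable_of_timeMeasure (mZ.integrable one_le_two) hs hst ht)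
        ((intervalIntegrable_of_timeMeasure (mZ'.integrable one_le_two) hs hst ht).const_mul _)]
      refine hle ((mZ.add (mZ'.const_mul (P.g * P.S₀))).integrable one_le_two) fun r => ?_
      have : c r + P.g * P.S₀ * ‖Z' r‖ = c r + d r := rfl
      linarith [a0 r, b0 r]
    have e : P.massForm Ωf Ωp ((u t, φ t) - (u s, φ s)) z - (t - s) * P.rateForm u' φ' t z
        = (inner ℝ (val (u t : H1 Plane Ωf) - val (u s : H1 Plane Ωf)) (val (z.1 : H1 Plane Ωf))
            - (t - s) * inner ℝ (u' t) (val (z.1 : H1 Plane Ωf)))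
          + P.g * P.S₀ * (inner ℝ (val (φ t : H1 ℝ Ωp) - val (φ s : H1 ℝ Ωp))
            (val (z.2 : H1 ℝ Ωp)) - (t - s) * inner ℝ (φ' t) (val (z.2 : H1 ℝ Ωp))) := by
      have e1 : P.massForm Ωf Ωp ((u t, φ t) - (u s, φ s)) z
        = inner ℝ (val (u t : H1 Plane Ωf) - val (u s : H1 Plane Ωf)) (val (z.1 : H1 Plane Ωf))
          + P.g * P.S₀ * inner ℝ (val (φ t : H1 ℝ Ωp) - val (φ s : H1 ℝ Ωp))
            (val (z.2 : H1 ℝ Ωp)) := rfl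
      rw [e1, Params.rateForm]
      ring
    have hts : 0 ≤ t - s := sub_nonneg.2 hst
    rw [e]
    refine (abs_add_le _ _).trans ?_
    rw [abs_mul, abs_of_pos hgS]
    calc _ ≤ (t - s) * ((∫ r in s..t, c r) * ‖z‖)
          + P.g * P.S₀ * ((t - s) * ((∫ r in s..t, ‖Z' r‖) * ‖z‖)) := by
          refine add_le_add (h1.trans ?_) (mul_le_mul_of_nonneg_left (h2.trans ?_) hgS.le)
          · gcongr
          · gcongr
      _ = (t - s) * ((∫ r in s..t, c r) + P.g * P.S₀ * ∫ r in s..t, ‖Z' r‖) * ‖z‖ := by ring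
      _ ≤ _ := by gcongr

/-- The energy is continuous in time because the solution is the primitive of an integrable
L²-valued function, so on the compact interval it attains a positive minimum. -/
theorem exists_energy_lower_bound (hsol : IsWeakSolution P ff fp u u' p φ φ')
    (hreg : IsRegular P ff fp u u' p φ φ')
    (hpos : ∀ t ∈ Set.Icc 0 P.T, 0 < P.energy (u t) (φ t)) :
    ∃ c₀ > (0 : ℝ), ∀ t ∈ Icc 0 P.T, c₀ ≤ P.massForm Ωf Ωp (u t, φ t) (u t, φ t) := by
  obtain ⟨V, hV, hVu⟩ := hreg.u'_H2
  obtain ⟨V', hV', hVφ⟩ := hreg.φ'_H2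
  have cu := continuousOn_val P.T_pos.le hsol.deriv_u (memLp_toH1 hV) hVu
  have cφ := continuousOn_val P.T_pos.le hsol.deriv_φ (memLp_toH1 hV') hVφ
  have hc : ContinuousOn (fun t => P.massForm Ωf Ωp (u t, φ t) (u t, φ t)) (Icc 0 P.T) := by
    simp only [Params.massForm_self]
    exact (cu.norm.pow 2).add (continuousOn_const.mul (cφ.norm.pow 2))
  obtain ⟨t₀, ht₀, hmin⟩ := isCompact_Icc.exists_isMinOn (nonempty_Icc.2 P.T_pos.le) hc
  refine ⟨_, ?_, fun t ht => hmin ht⟩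
  have := hpos t₀ ht₀
  rw [P.energy_eq (u t₀, φ t₀)] at this
  linarith

theorem divPairing_sub {Ω : Set Plane} (q : L2 Ω ℝ) (v w : H1 Plane Ω) :
    divPairing q (v - w) = divPairing q v - divPairing q w := by
  have hi : ∀ v : H1 Plane Ω, Integrable (fun x => q x * ∑ i, grad v i x i) (volume.restrict Ω) :=
    fun v => MemLp.integrable_mul (p := 2) (q := 2) (Lp.memLp q)
      (memLp_finsetSum _ fun i _ => memLp_coord i (Lp.memLp (grad v i)))
  rw [divPairing, divPairing, divPairing, ← integral_sub (hi v) (hi w)]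
  refine integral_congr_ae ?_
  have h := fun i => Lp.coeFn_sub (grad v i) (grad w i)
  filter_upwards [h 0, h 1] with x h0 h1
  have h0' : grad (v - w) 0 x = grad v 0 x - grad w 0 x := h0
  have h1' : grad (v - w) 1 x = grad v 1 x - grad w 1 x := h1
  simp only [Fin.sum_univ_two, h0', h1', PiLp.sub_apply]
  ring

theorem norm_val_vel_le (P : Params) (w : StateSpace Ωf Ωp) :
    ‖val (w.1 : H1 Plane Ωf)‖ ≤ √(P.massForm Ωf Ωp w w) := by
  have := mul_pos P.g_pos P.S₀_pos
  refine Real.le_sqrt_of_sq_le ?_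
  rw [P.massForm_self]
  have : 0 ≤ P.g * P.S₀ * ‖val (w.2 : H1 ℝ Ωp)‖ ^ 2 := by positivity
  linarith

theorem norm_val_head_le (P : Params) (w : StateSpace Ωf Ωp) :
    ‖val (w.2 : H1 ℝ Ωp)‖ ≤ √((P.g * P.S₀)⁻¹) * √(P.massForm Ωf Ωp w w) := by
  have hgS := mul_pos P.g_pos P.S₀_pos
  rw [← Real.sqrt_mul (by positivity)]
  refine Real.le_sqrt_of_sq_le ?_
  rw [P.massForm_self, mul_add, inv_mul_cancel_left₀ hgS.ne']
  have : 0 ≤ (P.g * P.S₀)⁻¹ * ‖val (w.1 : H1 Plane Ωf)‖ ^ 2 := by positivity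
  linarith

/-- The weak form tested with a divergence-free pair. -/
theorem IsWeakSolution.equation_state (hΩf : IsBoundedLipschitz Ωf)
    (hsol : IsWeakSolution P ff fp u u' p φ φ') {t : ℝ} (ht : t ∈ Ioc 0 P.T)
    (z : StateSpace Ωf Ωp) (hz : divPairing (p t) (z.1 : H1 Plane Ωf) = 0) :
    P.rateForm u' φ' t z + P.dissipationForm hΩf Ωp (u t, φ t) z + P.explicitForm (u t, φ t) z
      = ff t z.1 + P.g * fp t z.2 := by
  have h := hsol.equation t ht z.1 z.2
  rw [hz] at h
  have e : P.dissipationForm hΩf Ωp (u t, φ t) z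
    = P.ν * gradInner (u t : H1 Plane Ωf) (z.1 : H1 Plane Ωf)
      + P.friction * tangentialForm (u t) z.1
      + P.g * P.K * gradInner (φ t : H1 ℝ Ωp) (z.2 : H1 ℝ Ωp) := rfl
  rw [e, Params.rateForm, Params.explicitForm]
  linarith

/-- The energy balance of the exact solution. -/
theorem IsWeakSolution.energy_balance (hΩf : IsBoundedLipschitz Ωf)
    (hsol : IsWeakSolution P ff fp u u' p φ φ')
    (hwork : ∀ t ∈ Set.Ioc 0 P.T, ff t (u t) + P.g * fp t (φ t) = 0) {t : ℝ}
    (ht : t ∈ Ioc 0 P.T) :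
    P.rateForm u' φ' t (u t, φ t) + P.dissipationForm hΩf Ωp (u t, φ t) (u t, φ t) = 0 := by
  have h := hsol.equation_state hΩf ht (u t, φ t) (hsol.div_free t ht (p t))
  -- Tested with the solution itself, the two interface terms of `explicitForm` are equal with
  -- opposite signs and cancel.
  rw [Params.explicitForm, convForm_self_eq_zero hΩf (u t) (hsol.div_free t ht), hwork t ht] at h
  linarith

/-- The prediction step tested with a divergence-free pair. -/
theorem IsSchemeI.prediction_state (hΩf : IsBoundedLipschitz Ωf) {u₀ : VelSpace Ωf Ωp}
    {φ₀ : HeadSpace Ωf Ωp} {Δt : ℝ} (hΔ : 0 < Δt) {D : DiscreteSolution Ωf Ωp}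
    (hD : IsSchemeI P ff fp u₀ φ₀ Δt D) {n : ℕ} (hn : ((n : ℝ) + 1) * Δt ≤ P.T)
    (z : StateSpace Ωf Ωp) (hz : divPairing (D.p (n + 1)) (z.1 : H1 Plane Ωf) = 0) :
    P.massForm Ωf Ωp ((D.ut (n + 1), D.φt (n + 1)) - (D.ut n, D.φt n)) z
      + Δt * (P.dissipationForm hΩf Ωp (D.ut (n + 1), D.φt (n + 1)) z
        + P.explicitForm (D.u n, D.φ n) z)
      = Δt * (ff (((n : ℝ) + 1) * Δt) z.1 + P.g * fp (((n : ℝ) + 1) * Δt) z.2) := by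
  have h1 := hD.momentum n hn z.1
  have h2 := hD.darcy n hn z.2
  rw [hz] at h1
  rw [real_inner_smul_left] at h1 h2
  have e1 : P.massForm Ωf Ωp ((D.ut (n + 1), D.φt (n + 1)) - (D.ut n, D.φt n)) z
    = inner ℝ (val (D.ut (n + 1) : H1 Plane Ωf) - val (D.ut n : H1 Plane Ωf))
        (val (z.1 : H1 Plane Ωf))
      + P.g * P.S₀ * inner ℝ (val (D.φt (n + 1) : H1 ℝ Ωp) - val (D.φt n : H1 ℝ Ωp))
        (val (z.2 : H1 ℝ Ωp)) := rfl
  have e2 : P.dissipationForm hΩf Ωp (D.ut (n + 1), D.φt (n + 1)) z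
    = P.ν * gradInner (D.ut (n + 1) : H1 Plane Ωf) (z.1 : H1 Plane Ωf)
      + P.friction * tangentialForm (D.ut (n + 1)) z.1
      + P.g * P.K * gradInner (D.φt (n + 1) : H1 ℝ Ωp) (z.2 : H1 ℝ Ωp) := rfl
  have hΔ' : Δt * Δt⁻¹ = 1 := mul_inv_cancel₀ hΔ.ne'
  rw [e1, e2, Params.explicitForm]
  linear_combination Δt * h1 + Δt * h2
    - (inner ℝ (val (D.ut (n + 1) : H1 Plane Ωf) - val (D.ut n : H1 Plane Ωf))
        (val (z.1 : H1 Plane Ωf))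
      + P.g * P.S₀ * inner ℝ (val (D.φt (n + 1) : H1 ℝ Ωp) - val (D.φt n : H1 ℝ Ωp))
        (val (z.2 : H1 ℝ Ωp))) * hΔ'

end NSD

end

noncomputable section

/-! ### Error estimates for Scheme I in the Navier–Stokes–Darcy model -/

namespace NSD

/-- The error estimate in terms of the mass form. -/
theorem exists_state_error_bound {P : Params} {Ωf Ωp : Set Plane}
    (hΩf : IsBoundedLipschitz Ωf) (hΩp : IsBoundedLipschitz Ωp)
    {ff : ℝ → VelSpace Ωf Ωp →L[ℝ] ℝ} {fp : ℝ → HeadSpace Ωf Ωp →L[ℝ] ℝ}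
    {u : ℝ → VelSpace Ωf Ωp} {u' : ℝ → L2 Ωf Plane} {p : ℝ → L2 Ωf ℝ}
    {φ : ℝ → HeadSpace Ωf Ωp} {φ' : ℝ → L2 Ωp ℝ}
    (hsol : IsWeakSolution P ff fp u u' p φ φ')
    (hreg : IsRegular P ff fp u u' p φ φ')
    (hwork : ∀ t ∈ Set.Ioc 0 P.T, ff t (u t) + P.g * fp t (φ t) = 0)
    (hpos : ∀ t ∈ Set.Icc 0 P.T, 0 < P.energy (u t) (φ t)) :
    ∃ C > (0 : ℝ), ∃ δ > (0 : ℝ), ∀ Δt : ℝ, 0 < Δt → Δt ≤ δ →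
      ∀ D : DiscreteSolution Ωf Ωp, IsSchemeI P ff fp (u 0) (φ 0) Δt D →
        ∀ k : ℕ, (k + 1) * Δt ≤ P.T → ∀ x : StateSpace Ωf Ωp,
          x = (u ((k + 1) * Δt), φ ((k + 1) * Δt)) →
          √(P.massForm Ωf Ωp ((D.ut (k + 1), D.φt (k + 1)) - x)
            ((D.ut (k + 1), D.φt (k + 1)) - x)) ≤ C * Δt ∧
          |D.E (k + 1) - 1 / 2 * P.massForm Ωf Ωp x x| ≤ C * Δt ∧
          √(P.massForm Ωf Ωp ((D.u (k + 1), D.φ (k + 1)) - x)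
            ((D.u (k + 1), D.φ (k + 1)) - x)) ≤ C * Δt := by
  obtain ⟨ϖ, ϖ0, mϖ, hϖ⟩ := exists_time_modulus hΩf.isOpen hΩp.isOpen hsol hreg
  obtain ⟨c₀, hc₀, hlow⟩ := exists_energy_lower_bound hsol hreg hpos
  obtain ⟨cA, hcA, HA⟩ := P.exists_abs_dissipationForm_le hΩf Ωp
  obtain ⟨cC, hcC, HC⟩ := P.exists_norm_sq_le hΩf Ωp
  obtain ⟨cN, hcN, HN⟩ := P.exists_explicitForm_bound hΩf hΩp
  have hgS := mul_pos P.g_pos P.S₀_pos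
  have hT := P.T_pos
  let x : ℝ → StateSpace Ωf Ωp := fun t => (u t, φ t)
  -- The sum dominates every constant required by the abstract theorem, and its first summand makes
  -- it at least 1.
  set c : ℝ := (1 + P.g * P.S₀) + cA + cC + cN with hc
  -- An H¹ bound of the exact solution at all times: the initial norm plus the total increment.
  set M : ℝ := ‖x 0‖ + ∫ r in (0 : ℝ)..P.T, ϖ r with hM
  set J : ℝ := (∫ r in (0 : ℝ)..P.T, ϖ r) + ∫ r in (0 : ℝ)..P.T, ϖ r ^ 2 with hJ
  have i1 : 0 ≤ ∫ r in (0 : ℝ)..P.T, ϖ r := intervalIntegral.integral_nonneg hT.le fun r _ => ϖ0 r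
  have i2 : 0 ≤ ∫ r in (0 : ℝ)..P.T, ϖ r ^ 2 :=
    intervalIntegral.integral_nonneg hT.le fun r _ => sq_nonneg _
  have hcs : ∀ {a : ℝ} (w z : StateSpace Ωf Ωp), a ≤ c → a * ‖w‖ * ‖z‖ ≤ c * ‖w‖ * ‖z‖ :=
    fun w z h => by gcongr
  obtain ⟨C, hC, δ, hδ, H⟩ := abstract_scheme_error (W := StateSpace Ωf Ωp)
    (m := P.massForm Ωf Ωp) (A := P.dissipationForm hΩf Ωp) (N := P.explicitForm) (c := c) (M := M)
    (c₀ := c₀) (T := P.T) (Ω := J) (by linarith) (by positivity) hc₀ hT (by positivity)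
    P.massForm_comm P.massForm_self_nonneg P.dissipationFun_comm
    (P.dissipationForm_self_nonneg hΩf)
    (fun w z => (P.abs_massForm_le w z).trans (hcs w z (by linarith)))
    (fun w z => (HA w z).trans (hcs w z (by linarith)))
    (fun w => (HC w).trans (mul_le_mul_of_nonneg_right (by linarith)
      (add_nonneg (P.massForm_self_nonneg w) (P.dissipationForm_self_nonneg hΩf w))))
    (fun w w' z => (HN w w' z).trans (by
      have : cN ≤ c := by linarith
      gcongr))
  refine ⟨C, hC, δ, hδ, fun Δt hΔ hΔδ D hD k hk y hy => ?_⟩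
  have hK : ((k + 1 : ℕ) : ℝ) * Δt ≤ P.T := by exact_mod_cast hk
  have hstep : ∀ j < k + 1, ((j : ℝ) + 1) * Δt ≤ P.T := fun j hj => by
    refine le_trans ?_ hk
    have : (j : ℝ) + 1 ≤ k + 1 := by exact_mod_cast hj
    gcongr
  have hcast : ∀ j : ℕ, ((j + 1 : ℕ) : ℝ) = (j : ℝ) + 1 := fun j => by push_cast; ring
  have hpos' : ∀ j : ℕ, 0 ≤ (j : ℝ) * Δt := fun j => by positivity
  have hle : ∀ j : ℕ, (j : ℝ) * Δt ≤ ((j + 1 : ℕ) : ℝ) * Δt := fun j => by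
    rw [hcast]
    linarith
  have hin : ∀ j ≤ k + 1, (j : ℝ) * Δt ≤ P.T := fun j hj => by
    refine le_trans ?_ hK
    gcongr
  have hIoc : ∀ j < k + 1, ((j + 1 : ℕ) : ℝ) * Δt ∈ Ioc 0 P.T := fun j hj =>
    ⟨by positivity, hin _ hj⟩
  let X : ℕ → StateSpace Ωf Ωp := fun j => x (j * Δt)
  let Y : ℕ → StateSpace Ωf Ωp := fun j => (D.ut j, D.φt j)
  have hXY : ∀ j, X j + (Y j - X j) = Y j := fun j => add_sub_cancel _ _
  obtain ⟨s1, s2⟩ := sum_step_integral_le ϖ0 (mϖ.integrable one_le_two) mϖ.integrable_sq hΔ hK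
  -- At positive levels both the prediction and the exact velocity are divergence-free, so the error
  -- is an admissible test pair that removes both pressures.
  have hdiv : ∀ j < k + 1, ∀ q : L2 Ωf ℝ,
      divPairing q ((Y (j + 1) - X (j + 1)).1 : H1 Plane Ωf) = 0 := fun j hj q => by
    have h1 := hD.div_free j (hstep j hj) q
    have h2 := hsol.div_free _ (hIoc j hj) q
    have h3 := divPairing_sub q (D.ut (j + 1) : H1 Plane Ωf) (u (((j + 1 : ℕ) : ℝ) * Δt))
    rw [h1, h2, sub_zero] at h3
    exact h3
  have key := H Δt hΔ hΔδ (k + 1) hK X (fun j => Y j - X j) (fun j => (D.u j, D.φ j))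
    -- The scheme leaves ξ at level 0 unspecified; the value 1 expresses that the initial correction
    -- equals the initial prediction.
    (fun j => if j = 0 then 1 else √(D.ξ j)) D.ξ D.E
    (fun j => ∫ r in ((j : ℝ) * Δt)..(((j + 1 : ℕ) : ℝ) * Δt), ϖ r)
    (fun j z => P.rateForm u' φ' (((j + 1 : ℕ) : ℝ) * Δt) z)
    (fun j z => ff (((j + 1 : ℕ) : ℝ) * Δt) z.1 + P.g * fp (((j + 1 : ℕ) : ℝ) * Δt) z.2)
    (fun j hj => by
      have h1 := (hϖ 0 (j * Δt) le_rfl (hpos' j) (hin j hj)).1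
      have h2 : ∫ r in (0 : ℝ)..(j * Δt), ϖ r ≤ ∫ r in (0 : ℝ)..P.T, ϖ r :=
        intervalIntegral.integral_mono_interval le_rfl (hpos' j) (hin j hj)
          (Filter.Eventually.of_forall ϖ0)
          (intervalIntegrable_of_timeMeasure (mϖ.integrable one_le_two) le_rfl hT.le le_rfl)
      calc ‖x (j * Δt)‖ ≤ ‖x 0‖ + ‖x (j * Δt) - x 0‖ := by
            have := norm_add_le (x 0) (x (j * Δt) - x 0)
            rwa [add_sub_cancel] at this
        _ ≤ M := by linarith [h1.trans h2])
    (fun j hj => hlow _ ⟨hpos' j, hin j hj⟩)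
    (fun j => intervalIntegral.integral_nonneg (hle j) fun r _ => ϖ0 r)
    (s1.trans (by linarith))
    (s2.trans (by
      rw [mul_comm]
      gcongr
      linarith))
    (fun j hj => (hϖ _ _ (hpos' j) (hle j) (hin _ hj)).1)
    (fun j hj z => by
      have h1 := (hϖ _ _ (hpos' j) (hle j) (hin _ hj)).2 z
      have h2 : ((j + 1 : ℕ) : ℝ) * Δt - j * Δt = Δt := by
        rw [hcast]
        ring
      rw [h2] at h1
      exact h1)
    (fun j hj => hsol.equation_state hΩf (hIoc j hj) _ (hdiv j hj _))
    (fun j hj => hsol.energy_balance hΩf hwork (hIoc j hj))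
    (fun j hj => by
      have h1 := hD.prediction_state hΩf hΔ (hstep j hj) (Y (j + 1) - X (j + 1)) (hdiv j hj _)
      simp only [hXY]
      rw [hcast]
      exact h1)
    (by
      have e1 : Y 0 = X 0 := by
        simp only [Y, X, x, hD.init_ut, hD.init_φt, Nat.cast_zero, zero_mul]
      exact sub_eq_zero.2 e1)
    (if_pos rfl)
    (by
      have e1 : X 0 = (u 0, φ 0) := by simp only [X, x, Nat.cast_zero, zero_mul]
      rw [e1, hD.init_E]
      exact P.energy_eq (u 0, φ 0))
    (fun j hj => by
      simp only [hXY]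
      rcases j with _ | j
      · simp only [if_true, one_smul, Y, hD.init_u, hD.init_φ, hD.init_ut, hD.init_φt]
      · rw [if_neg (Nat.succ_ne_zero j), hD.correct_u j (hstep j hj), hD.correct_φ j (hstep j hj)]
        rfl)
    (fun j _ => if_neg (Nat.succ_ne_zero j))
    (fun j hj => by
      simp only [hXY]
      rw [hD.energy_eq j (hstep j hj), P.energy_eq (D.ut (j + 1), D.φt (j + 1))])
    (fun j hj => by
      simp only [hXY]
      exact hD.relaxation j (hstep j hj))
    (k + 1) le_rfl
  have hXk : X (k + 1) = y := by
    simp only [hy, X, x, hcast]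
  rw [hXk] at key
  exact key

theorem norm_val_sub_le (P : Params) {Ωf Ωp : Set Plane} {v v' : VelSpace Ωf Ωp}
    {ψ ψ' : HeadSpace Ωf Ωp} {b : ℝ}
    (h : √(P.massForm Ωf Ωp ((v, ψ) - (v', ψ')) ((v, ψ) - (v', ψ'))) ≤ b) :
    ‖val ((v - v' : VelSpace Ωf Ωp) : H1 Plane Ωf)‖ ≤ b ∧
      ‖val ((ψ - ψ' : HeadSpace Ωf Ωp) : H1 ℝ Ωp)‖ ≤ √((P.g * P.S₀)⁻¹) * b :=
  ⟨(norm_val_vel_le P ((v, ψ) - (v', ψ'))).trans h,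
    (norm_val_head_le P ((v, ψ) - (v', ψ'))).trans
      (mul_le_mul_of_nonneg_left h (Real.sqrt_nonneg _))⟩

end NSD

end

open NSD

theorem theorem4p2 (P : Params) (Ωf Ωp : Set Plane)
    (hΩf : IsBoundedLipschitz Ωf) (hΩp : IsBoundedLipschitz Ωp) (hdisj : Disjoint Ωf Ωp)
    (ff : ℝ → VelSpace Ωf Ωp →L[ℝ] ℝ) (fp : ℝ → HeadSpace Ωf Ωp →L[ℝ] ℝ)
    (u : ℝ → VelSpace Ωf Ωp) (u' : ℝ → L2 Ωf Plane) (p : ℝ → L2 Ωf ℝ)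
    (φ : ℝ → HeadSpace Ωf Ωp) (φ' : ℝ → L2 Ωp ℝ)
    (hsol : IsWeakSolution P ff fp u u' p φ φ')
    (hreg : IsRegular P ff fp u u' p φ φ')
    (hwork : ∀ t ∈ Set.Ioc 0 P.T, ff t (u t) + P.g * fp t (φ t) = 0)
    (hpos : ∀ t ∈ Set.Icc 0 P.T, 0 < P.energy (u t) (φ t)) :
    ∃ C > (0 : ℝ), ∃ δ > (0 : ℝ), ∀ Δt : ℝ, 0 < Δt → Δt ≤ δ →
      ∀ D : DiscreteSolution Ωf Ωp, IsSchemeI P ff fp (u 0) (φ 0) Δt D →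
        ∀ k : ℕ, (k + 1) * Δt ≤ P.T →
          |D.E (k + 1) - P.energy (u ((k + 1) * Δt)) (φ ((k + 1) * Δt))|
              + ‖val ((D.ut (k + 1) - u ((k + 1) * Δt) : VelSpace Ωf Ωp) : H1 Plane Ωf)‖
              + ‖val ((D.φt (k + 1) - φ ((k + 1) * Δt) : HeadSpace Ωf Ωp) : H1 ℝ Ωp)‖ ≤ C * Δt ∧
          ‖val ((D.u (k + 1) - u ((k + 1) * Δt) : VelSpace Ωf Ωp) : H1 Plane Ωf)‖
              + ‖val ((D.φ (k + 1) - φ ((k + 1) * Δt) : HeadSpace Ωf Ωp) : H1 ℝ Ωp)‖ ≤ C * Δt := by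
  obtain ⟨C, hC, δ, hδ, H⟩ := exists_state_error_bound hΩf hΩp hsol hreg hwork hpos
  have hR : 0 ≤ √((P.g * P.S₀)⁻¹) := Real.sqrt_nonneg _
  -- One C for the energy and one for the velocity; the head, weighted by g S₀ in the mass form,
  -- costs the remaining term.
  refine ⟨2 * C + √((P.g * P.S₀)⁻¹) * C, by positivity, δ, hδ, fun Δt hΔ hΔδ D hD k hk => ?_⟩
  obtain ⟨r1, r2, r3⟩ := H Δt hΔ hΔδ D hD k hk _ rfl
  rw [← P.energy_eq] at r2
  have n1 := norm_val_sub_le P r1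
  have n3 := norm_val_sub_le P r3
  have hCΔ : 0 < C * Δt := by positivity
  refine ⟨?_, ?_⟩
  · calc _ ≤ C * Δt + C * Δt + √((P.g * P.S₀)⁻¹) * (C * Δt) :=
          add_le_add (add_le_add r2 n1.1) n1.2
      _ = _ := by ring
  · calc _ ≤ C * Δt + √((P.g * P.S₀)⁻¹) * (C * Δt) := add_le_add n3.1 n3.2
      _ ≤ _ := by linarith
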